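/- **Setting.** Let $\mathcal M$ be an $n$-dimensional $C^2$ manifold without boundary with a $C^1$ Riemannian metric, $d$ its Riemannian distance ($d=\infty$ between different components), $\mathfrak W$ a metric space, $S\in\mathbb R$ the final time, $\bar y\in\mathcal M$, and $\mathcal W:=L^1([0,S],\mathfrak W)$. Let $f(s,\cdot,\mathfrak w)$ be a vector field on $\mathcal M$ for each $(s,\mathfrak w)\in[0,S]\times\mathfrak W$, such that (i) $y\mapsto f(s,y,\mathfrak w)$ is $C^1$ for all $s,\mathfrak w$; (ii) there is $c\in L^1([0,S];\mathbb R)$ with, for a.e. $s$, $|f(s,y,\mathfrak w)|\le c(s)$ and $|Df(s,y,\mathfrak w)|\le c(s)$ for all $(y,\mathfrak w)$, where $D$ is the Levi-Civita covariant derivative in $y$ and the norms are those of the Riemannian metric; (iii) $s\mapsto f(s,y,\mathfrak w)$ is measurable for all $y,\mathfrak w$; (iv) $(y,\mathfrak w)\mapsto f(s,y,\mathfrak w)$ is continuous for all $s$. For $w\in\mathcal W$ let $y[w]$ be the absolutely continuous solution on $[0,S]$ of $\dot y=f(s,y,w(s))$ a.e., $y(0)=\bar y$. Let $\mathcal V\subset\mathcal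 W$, $\mathcal R_{\mathcal V}=\{y[v](S):v\in\mathcal V\}$, let $\mathfrak T\subset\mathcal M$ be closed, and let $d_f(w_1,w_2)=\max_{s\in[0,S]}d(y[w_1](s),y[w_2](s))$. **Abundance.** For $N\ge1$ let $\Gamma_N=\{\gamma\in\mathbb R^N:\gamma^j\ge0,\ \sum_j\gamma^j\le1\}$, and let $y_\gamma[w,w_1,\dots,w_N]$ be the solution on $[0,S]$ of $\dot y=f(s,y,w)+\sum_i\gamma^i\big(f(s,y,w_i)-f(s,y,w)\big)$, $y(0)=\bar y$. $\mathcal V$ is *abundant* in $\mathcal W$ if for all $N\ge1$, $(w,w_1,\dots,w_N)\in\mathcal W^{1+N}$ and $\delta>0$ there is a map $\theta:\Gamma_N\to\mathcal V$, continuous for the pseudo-distance $d_f$, such that for every $\gamma\in\Gamma_N$ the solutions $y_\gamma[w,w_1,\dots,w_N]$ and $y[\theta(\gamma)]$ exist on $[0,S]$ and $d\big(y_\gamma[w,w_1,\dots,w_N](S),y[\theta(\gamma)](S)\big)<\delta$. **Scorza-Dragoni points.** $\bar s\in SD\{\varphi\}$, for a time-dependent vector field $\varphi$ on $[0,S]\times\mathcal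 M$, means that $\bar s\in[0,S]$ and for every $y\in\mathcal M$ $$\lim_{r\to0^+}\ \limsup_{\delta\to0,\ \bar s+\delta\in[0,S]}\ \frac1\delta\int_{\bar s}^{\bar s+\delta}\ \sup_{d(x,y)\le r}|\varphi(s,x)-\varphi(\bar s,y)|\,ds=0,$$ the difference being computed in a chart at $y$ and $\delta\neq0$ having either sign. **QDQ approximating cones.** A modulus is a nondecreasing $\rho:[0,\infty)\to[0,\infty)$ with $\rho(0)=\lim_{s\to0^+}\rho(s)=0$. A compact set $\Lambda$ of linear maps $\mathbb R^N\to\mathbb R^n$ is a *QDQ* of a set-valued map $F:\mathbb R^N\rightsquigarrow\mathbb R^n$ at $(0,\bar z)$ in the direction of $\Gamma\subset\mathbb R^N$ if there is a modulus $\rho$ such that for every $\delta>0$ there are continuous $L_\delta,h_\delta$ on $\Gamma\cap B_\delta$ ($B_\delta$ the closed ball), with values in the linear maps $\mathbb R^N\to\mathbb R^n$ and in $\mathbb R^n$, with $\min_{L'\in\Lambda}|L_\delta(\gamma)-L'|\le\rho(\delta)$, $|h_\delta(\gamma)|\le\delta\rho(\delta)$ and $\bar z+L_\delta(\gamma)\gamma+h_\delta(\gamma)\in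 F(\gamma)$ for all $\gamma\in\Gamma\cap B_\delta$. For $F:\mathbb R^N\rightsquigarrow\mathcal M$ the notion is understood in a chart of $\mathcal M$ at $\bar z$ and with $\Gamma$ replaced by $\Gamma\cap U$ for some neighbourhood $U$ of $0$. $C\subset T_z\mathcal M$ is a *QDQ approximating cone* to $\mathcal E\subset\mathcal M$ at $z$ if there are $N\ge0$, $F:\mathbb R^N\rightsquigarrow\mathcal M$, a convex cone $\Gamma\subset\mathbb R^N$ containing $0$ and a linear $L:\mathbb R^N\to T_z\mathcal M$ such that $\{L\}$ is a QDQ of $F$ at $(0,z)$ in the direction of $\Gamma$, $F(\Gamma)\subset\mathcal E$ and $C=L\cdot\Gamma$. **Theorem.** Let $\mathcal V$ be abundant in $\mathcal W$, let $\hat w\in\mathcal W$ and let $\hat y=y[\hat w]$ be a corresponding trajectory on $[0,S]$ with $\hat y(S)\in\mathfrak T$. Let $N\ge1$, $\mathfrak w_1,\dots,\mathfrak w_N\in\mathfrak W$ and $0<s_1<\dots<s_N\le S$ with $s_1,\dots,s_N\in SD\{f(\cdot,\cdot,\hat w(\cdot))\}\cap\bigcap_{j=1}^N SD\{f(\cdot,\cdot,\mathfrak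 w_j)\}$. Let $M(S,s_i):T_{\hat y(s_i)}\mathcal M\to T_{\hat y(S)}\mathcal M$ be the differential at $\hat y(s_i)$ of the flow of $\dot y=f(s,y,\hat w(s))$ from time $s_i$ to time $S$, and let the extended variational cone $\mathbf C\subset T_{\hat y(S)}\mathcal M$ be the smallest convex cone containing the vectors $$M(S,s_i)\cdot\big(f(s_i,\hat y(s_i),\mathfrak w_i)-f(s_i,\hat y(s_i),\hat w(s_i))\big),\qquad i=1,\dots,N.$$ Let $C$ be a QDQ approximating cone to $\mathfrak T$ at $\hat y(S)$. If $\mathbf C$ and $C$ are complementary linear subspaces, i.e. $\mathbf C\oplus C=T_{\hat y(S)}\mathcal M$, then there is a sequence $(z_k)_{k\in\mathbb N}\subset\mathcal R_{\mathcal V}\cap\mathfrak T$ with $\lim_{k\to\infty}z_k=\hat y(S)$. -/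

import Mathlib

open Set Filter Topology MeasureTheory Manifold Bundle
open scoped NNReal ENNReal

attribute [-instance] TopCat.of.chartedSpace

noncomputable section

/-! ### Quasi Differential Quotients and QDQ approximating cones -/

/-- `Λ` is a Quasi Differential Quotient of the set-valued map `F : ℝ^N ⇉ ℝ^n` at `(γ₀, y₀)` in the
direction of `Γ`. The function `ρ` is a modulus. -/
def IsQDQ {N n : ℕ} (F : EuclideanSpace ℝ (Fin N) → Set (EuclideanSpace ℝ (Fin n)))
    (Λ : Set (EuclideanSpace ℝ (Fin N) →L[ℝ] EuclideanSpace ℝ (Fin n)))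
    (γ₀ : EuclideanSpace ℝ (Fin N)) (y₀ : EuclideanSpace ℝ (Fin n))
    (Γ : Set (EuclideanSpace ℝ (Fin N))) : Prop :=
  IsCompact Λ ∧
  ∃ ρ : ℝ≥0 → ℝ≥0, Monotone ρ ∧ ρ 0 = 0 ∧ Tendsto ρ (𝓝 0) (𝓝 0) ∧
    ∀ δ : ℝ≥0, 0 < δ →
      ∃ (L : EuclideanSpace ℝ (Fin N) → EuclideanSpace ℝ (Fin N) →L[ℝ] EuclideanSpace ℝ (Fin n))
        (h : EuclideanSpace ℝ (Fin N) → EuclideanSpace ℝ (Fin n)),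
        ContinuousOn L {γ | ‖γ - γ₀‖ ≤ δ ∧ γ - γ₀ ∈ Γ} ∧
        ContinuousOn h {γ | ‖γ - γ₀‖ ≤ δ ∧ γ - γ₀ ∈ Γ} ∧
        ∀ γ : EuclideanSpace ℝ (Fin N), ‖γ - γ₀‖ ≤ δ → γ - γ₀ ∈ Γ →
          (∃ L' ∈ Λ, ‖L γ - L'‖ ≤ ρ δ) ∧ ‖h γ‖ ≤ δ * ρ δ ∧ y₀ + L γ (γ - γ₀) + h γ ∈ F γ

section Manifold

variable {n : ℕ} {M : Type*}

/-- `Λ` is a Quasi Differential Quotient of `F : ℝ^N ⇉ M` at `(0, z)` in the direction of `Γ`: the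
Euclidean notion for the coordinate representation of `F`, in a chart of `M` at `z` and on some
neighbourhood `U` of `0` in `ℝ^N`. -/
def IsQDQManifold [TopologicalSpace M] [ChartedSpace (EuclideanSpace ℝ (Fin n)) M] {N : ℕ}
    (F : EuclideanSpace ℝ (Fin N) → Set M) (z : M)
    (Λ : Set (EuclideanSpace ℝ (Fin N) →L[ℝ] TangentSpace (𝓡 n) z))
    (Γ : Set (EuclideanSpace ℝ (Fin N))) : Prop :=
  ∃ U ∈ 𝓝 (0 : EuclideanSpace ℝ (Fin N)),
    IsQDQ (fun γ => extChartAt (𝓡 n) z '' (F γ ∩ (extChartAt (𝓡 n) z).source))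
      ((fun L => (mfderiv (𝓡 n) 𝓘(ℝ, EuclideanSpace ℝ (Fin n)) (extChartAt (𝓡 n) z) z).comp L) '' Λ)
      0 (extChartAt (𝓡 n) z z) (Γ ∩ U)

/-- `C` is a QDQ approximating cone to the set `A` at `z`. (A `PointedCone` is a convex cone
containing the origin.) -/
def IsQDQApproxCone [TopologicalSpace M] [ChartedSpace (EuclideanSpace ℝ (Fin n)) M]
    (A : Set M) (z : M) (C : Set (TangentSpace (𝓡 n) z)) : Prop :=
  ∃ (N : ℕ) (F : EuclideanSpace ℝ (Fin N) → Set M)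
    (Γ : PointedCone ℝ (EuclideanSpace ℝ (Fin N)))
    (L : EuclideanSpace ℝ (Fin N) →L[ℝ] TangentSpace (𝓡 n) z),
    IsQDQManifold F z {L} (Γ : Set (EuclideanSpace ℝ (Fin N))) ∧
    (∀ γ ∈ Γ, F γ ⊆ A) ∧ C = L '' (Γ : Set (EuclideanSpace ℝ (Fin N)))

/-- The subsets `C₁, C₂` of `E` are linear subspaces and `C₁ ⊕ C₂ = E`. -/
def AreComplementarySubspaces {E : Type*} [AddCommGroup E] [Module ℝ E] (C₁ C₂ : Set E) : Prop :=
  ∃ V₁ V₂ : Submodule ℝ E, (V₁ : Set E) = C₁ ∧ (V₂ : Set E) = C₂ ∧ IsCompl V₁ V₂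

/-! ### Ordinary differential equations on a manifold -/

section ODE

variable [TopologicalSpace M] [ChartedSpace (EuclideanSpace ℝ (Fin n)) M]

/-- `y` is an absolutely continuous curve on `[a, b]`: it is continuous and, near each instant,
absolutely continuous in a chart. -/
def IsAbsContCurve (n : ℕ) {M : Type*} [TopologicalSpace M]
    [ChartedSpace (EuclideanSpace ℝ (Fin n)) M] (a b : ℝ) (y : ℝ → M) : Prop :=
  ContinuousOn y (Icc a b) ∧
  ∀ s₀ ∈ Icc a b, ∃ r > 0,
    AbsolutelyContinuousOnInterval (fun s => extChartAt (𝓡 n) (y s₀) (y s))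
      (max a (s₀ - r)) (min b (s₀ + r))

/-- `y` is a (Carathéodory) solution on `[a, b]` of `dy/ds = X(s, y)`. -/
def IsSolution (X : ℝ → (x : M) → TangentSpace (𝓡 n) x) (a b : ℝ) (y : ℝ → M) : Prop :=
  IsAbsContCurve n a b y ∧
  ∀ᵐ s ∂(volume.restrict (Icc a b)),
    HasMFDerivAt 𝓘(ℝ, ℝ) (𝓡 n) y s ((1 : ℝ →L[ℝ] ℝ).smulRight (X s (y s)))

open Classical in
/-- The flow from time `a` to time `b` of `dy/ds = X(s, y)`: the value at `b` of the solution that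
starts from `x` at time `a` (a dummy value if there is none). -/
def flowMap (X : ℝ → (x : M) → TangentSpace (𝓡 n) x) (a b : ℝ) (x : M) : M :=
  if h : ∃ y : ℝ → M, IsSolution X a b y ∧ y a = x then h.choose b else x

/-- The differential at `y a` of the flow from time `a` to time `b`, for a solution `y`. Since the
flow maps `y a` to `y b`, it takes values in the tangent space at `y b`. -/
def flowDifferential (X : ℝ → (x : M) → TangentSpace (𝓡 n) x) (y : ℝ → M) (a b : ℝ) :
    TangentSpace (𝓡 n) (y a) →L[ℝ] TangentSpace (𝓡 n) (y b) :=
  mfderiv (𝓡 n) (𝓡 n) (flowMap X a b) (y a)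

end ODE

/-! ### The Levi-Civita derivative of a vector field in charts -/

section Riemannian

variable [TopologicalSpace M] [ChartedSpace (EuclideanSpace ℝ (Fin n)) M]

/-- The representation of the vector field `X` in the chart at `p`. -/
def coordField (X : (x : M) → TangentSpace (𝓡 n) x) (p : M) (x : EuclideanSpace ℝ (Fin n)) :
    EuclideanSpace ℝ (Fin n) :=
  mfderiv (𝓡 n) 𝓘(ℝ, EuclideanSpace ℝ (Fin n)) (extChartAt (𝓡 n) p) ((extChartAt (𝓡 n) p).symm x)
    (X ((extChartAt (𝓡 n) p).symm x))

variable [RiemannianBundle (fun x : M => TangentSpace (𝓡 n) x)]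

/-- The Riemannian metric in the chart at `p`: the number `g_x(u, v)`. -/
def coordMetric (p : M) (x u v : EuclideanSpace ℝ (Fin n)) : ℝ :=
  inner ℝ
    (mfderiv 𝓘(ℝ, EuclideanSpace ℝ (Fin n)) (𝓡 n) (extChartAt (𝓡 n) p).symm x u :
      TangentSpace (𝓡 n) ((extChartAt (𝓡 n) p).symm x))
    (mfderiv 𝓘(ℝ, EuclideanSpace ℝ (Fin n)) (𝓡 n) (extChartAt (𝓡 n) p).symm x v :
      TangentSpace (𝓡 n) ((extChartAt (𝓡 n) p).symm x))

/-- The number `⟨∇_u X, v⟩` at the point `p`, where `∇` is the Levi-Civita connection, in the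
coordinates of the chart at `p`: `g(DX·u, v)` plus the Christoffel term
`½ (∂_u g(X, v) + ∂_X g(u, v) - ∂_v g(u, X))`. -/
def covDerivForm (X : (x : M) → TangentSpace (𝓡 n) x) (p : M)
    (u v : EuclideanSpace ℝ (Fin n)) : ℝ :=
  let x₀ := extChartAt (𝓡 n) p p
  let X₀ := coordField X p x₀
  coordMetric p x₀ (fderiv ℝ (coordField X p) x₀ u) v +
    (1 / 2 : ℝ) * (fderiv ℝ (fun x => coordMetric p x X₀ v) x₀ u
      + fderiv ℝ (fun x => coordMetric p x u v) x₀ X₀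
      - fderiv ℝ (fun x => coordMetric p x u X₀) x₀ v)

/-- `|DX(p)| ≤ c`: the operator norm of `u ↦ ∇_u X` on the tangent space at `p`, with respect to
the Riemannian metric, is at most `c`. -/
def CovDerivNormLE (X : (x : M) → TangentSpace (𝓡 n) x) (p : M) (c : ℝ) : Prop :=
  ∀ u v : EuclideanSpace ℝ (Fin n),
    |covDerivForm X p u v| ≤
      c * √(coordMetric p (extChartAt (𝓡 n) p p) u u) *
        √(coordMetric p (extChartAt (𝓡 n) p p) v v)

end Riemannian

/-! ### The control system -/

section Control

variable {W : Type*} [MetricSpace W]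

/-- The family `L¹([0, S], W)` of extended controls (functions on `[0, S]`; the values elsewhere
are never used). -/
def extendedControls (W : Type*) [MetricSpace W] (S : ℝ) : Set (ℝ → W) :=
  {w | AEStronglyMeasurable w (volume.restrict (Icc 0 S)) ∧
    ∃ w₀ : W, IntegrableOn (fun s => dist (w s) w₀) (Icc 0 S)}

/-- The regularity hypothesis on the controlled vector field `f`. -/
structure HypothesisSH [TopologicalSpace M] [ChartedSpace (EuclideanSpace ℝ (Fin n)) M]
    [IsManifold (𝓡 n) 2 M] [RiemannianBundle (fun x : M => TangentSpace (𝓡 n) x)]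
    (f : ℝ → (x : M) → W → TangentSpace (𝓡 n) x) (S : ℝ) : Prop where
  contMDiff : ∀ s ∈ Icc 0 S, ∀ ω : W,
    ContMDiff (𝓡 n) (𝓡 n).tangent 1 (fun x => (⟨x, f s x ω⟩ : TangentBundle (𝓡 n) M))
  bound : ∃ c : ℝ → ℝ, IntegrableOn c (Icc 0 S) ∧
    ∀ᵐ s ∂(volume.restrict (Icc 0 S)), ∀ (x : M) (ω : W),
      ‖f s x ω‖ ≤ c s ∧ CovDerivNormLE (fun x' => f s x' ω) x (c s)
  measurable : ∀ (x : M) (ω : W),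
    AEStronglyMeasurable (fun s => f s x ω) (volume.restrict (Icc 0 S))
  continuous : ∀ s ∈ Icc 0 S,
    Continuous (fun p : M × W => (⟨p.1, f s p.1 p.2⟩ : TangentBundle (𝓡 n) M))

/-- `y` is the trajectory `y[w]` on `[0, S]` of the control `w` issuing from `y₀`. -/
def IsTrajectory [TopologicalSpace M] [ChartedSpace (EuclideanSpace ℝ (Fin n)) M]
    (f : ℝ → (x : M) → W → TangentSpace (𝓡 n) x) (y₀ : M) (S : ℝ) (w : ℝ → W) (y : ℝ → M) :
    Prop :=
  IsSolution (fun s x => f s x (w s)) 0 S y ∧ y 0 = y₀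

/-- The reachable set of the family `V` of controls. -/
def reachableSet [TopologicalSpace M] [ChartedSpace (EuclideanSpace ℝ (Fin n)) M]
    (f : ℝ → (x : M) → W → TangentSpace (𝓡 n) x) (y₀ : M) (S : ℝ) (V : Set (ℝ → W)) : Set M :=
  {z | ∃ v ∈ V, ∃ y : ℝ → M, IsTrajectory f y₀ S v y ∧ y S = z}

/-- The pseudo-distance `d_f(w₁, w₂) = max_{s ∈ [0, S]} d(y[w₁](s), y[w₂](s))` between controls. -/
def controlDist [EMetricSpace M] [ChartedSpace (EuclideanSpace ℝ (Fin n)) M]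
    (f : ℝ → (x : M) → W → TangentSpace (𝓡 n) x) (y₀ : M) (S : ℝ) (w₁ w₂ : ℝ → W) : ℝ≥0∞ :=
  ⨆ (y₁ : ℝ → M) (_ : IsTrajectory f y₀ S w₁ y₁) (y₂ : ℝ → M) (_ : IsTrajectory f y₀ S w₂ y₂)
    (s ∈ Icc 0 S), edist (y₁ s) (y₂ s)

/-- The convex hull of the origin and the standard simplex of `ℝ^N`. -/
def simplexHull (N : ℕ) : Set (Fin N → ℝ) :=
  {γ | (∀ i, 0 ≤ γ i) ∧ ∑ i, γ i ≤ 1}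

/-- The vector field `f_γ` along the controls `w, w₁, …, w_N`. -/
def convexifiedField [TopologicalSpace M] [ChartedSpace (EuclideanSpace ℝ (Fin n)) M]
    (f : ℝ → (x : M) → W → TangentSpace (𝓡 n) x) {N : ℕ} (γ : Fin N → ℝ)
    (w : ℝ → W) (w' : Fin N → ℝ → W) (s : ℝ) (x : M) : TangentSpace (𝓡 n) x :=
  f s x (w s) + ∑ i, γ i • (f s x (w' i s) - f s x (w s))

/-- The family `V` of controls is abundant in `L¹([0, S], W)`. Continuity of `θ` refers to the
pseudo-distance `d_f`; the solutions that are compared are required to exist on `[0, S]`. -/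
def IsAbundant [EMetricSpace M] [ChartedSpace (EuclideanSpace ℝ (Fin n)) M]
    (f : ℝ → (x : M) → W → TangentSpace (𝓡 n) x) (y₀ : M) (S : ℝ) (V : Set (ℝ → W)) : Prop :=
  ∀ (N : ℕ), 0 < N → ∀ (w : ℝ → W) (w' : Fin N → ℝ → W),
    w ∈ extendedControls W S → (∀ i, w' i ∈ extendedControls W S) → ∀ δ : ℝ, 0 < δ →
      ∃ θ : (Fin N → ℝ) → (ℝ → W),
        (∀ γ ∈ simplexHull N, θ γ ∈ V) ∧
        (∀ γ₀ ∈ simplexHull N,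
          Tendsto (fun γ => controlDist f y₀ S (θ γ) (θ γ₀)) (𝓝[simplexHull N] γ₀) (𝓝 0)) ∧
        ∀ γ ∈ simplexHull N, ∃ y z : ℝ → M,
          IsSolution (convexifiedField f γ w w') 0 S y ∧ y 0 = y₀ ∧
          IsTrajectory f y₀ S (θ γ) z ∧
          edist (y S) (z S) < ENNReal.ofReal δ

/-- `sup { |φ(s, x) - φ(s₀, p)| : d(x, p) ≤ r }`, the vectors being compared in the chart
at `p`. -/
def scorzaDragoniOsc [EMetricSpace M] [ChartedSpace (EuclideanSpace ℝ (Fin n)) M]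
    (φ : ℝ → (x : M) → TangentSpace (𝓡 n) x) (s₀ : ℝ) (p : M) (r : ℝ) (s : ℝ) : ℝ≥0∞ :=
  ⨆ x ∈ {x : M | x ∈ (extChartAt (𝓡 n) p).source ∧ edist x p ≤ ENNReal.ofReal r},
    ‖coordField (φ s) p (extChartAt (𝓡 n) p x) -
      coordField (φ s₀) p (extChartAt (𝓡 n) p p)‖ₑ

/-- `s₀ ∈ [a, b]` is a Scorza-Dragoni point of `φ`: for every point `p`,
`lim_{r → 0} lim_{δ → 0} (1/δ) ∫_{s₀}^{s₀+δ} sup_{d(x,p) ≤ r} |φ(s, x) - φ(s₀, p)| ds = 0`,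
where `δ` has either sign and `s₀ + δ ∈ [a, b]`. -/
def IsScorzaDragoniPoint [EMetricSpace M] [ChartedSpace (EuclideanSpace ℝ (Fin n)) M]
    (φ : ℝ → (x : M) → TangentSpace (𝓡 n) x) (a b s₀ : ℝ) : Prop :=
  s₀ ∈ Icc a b ∧ ∀ p : M,
    Tendsto
      (fun r : ℝ =>
        limsup
          (fun δ : ℝ =>
            (ENNReal.ofReal |δ|)⁻¹ * ∫⁻ s in uIoc s₀ (s₀ + δ), scorzaDragoniOsc φ s₀ p r s)
          (𝓝[{δ : ℝ | δ ≠ 0 ∧ s₀ + δ ∈ Icc a b}] 0))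
      (𝓝[>] 0) (𝓝 0)

/-- The extended variational cone at `y S`: the convex cone generated by the transported needle
variations `M(S, tᵢ) · (f(tᵢ, y(tᵢ), ωᵢ) - f(tᵢ, y(tᵢ), w(tᵢ)))`. -/
def extendedVariationalCone [TopologicalSpace M] [ChartedSpace (EuclideanSpace ℝ (Fin n)) M]
    (f : ℝ → (x : M) → W → TangentSpace (𝓡 n) x) (S : ℝ) (w : ℝ → W) (y : ℝ → M) {N : ℕ}
    (ω : Fin N → W) (t : Fin N → ℝ) : PointedCone ℝ (TangentSpace (𝓡 n) (y S)) :=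
  PointedCone.hull ℝ (Set.range fun i : Fin N =>
    flowDifferential (fun s x => f s x (w s)) y (t i) S
      (f (t i) (y (t i)) (ω i) - f (t i) (y (t i)) (w (t i))))

end Control

end Manifold

end

/-! For small `ε > 0`, let the control `wᵢ` equal `ωᵢ` on `(tᵢ - ε, tᵢ]` and the reference control
`w` elsewhere. The convexified trajectory with weights `γ` in the simplex then ends, in the chart at
`y(S)`, at the coordinates of `y(S)` plus `ε Σ γᵢ M(S, tᵢ)(f(tᵢ, y(tᵢ), ωᵢ) - f(tᵢ, y(tᵢ), w(tᵢ))) +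
o(ε)`, uniformly in `γ`. Abundance replaces these trajectories by trajectories of controls in `V`,
with an error at the end point that is as small as desired compared with `ε`, and with an end point
that still depends continuously on `γ`. Hence the reachable set contains a continuous image `Z(γ) =
ε L γ + o(ε)`, where `L` maps the nonnegative orthant onto the variational cone. Likewise the QDQ
hypothesis puts in the target the points `H(ζ) = L' ζ + o(ε)`, with `H` continuous on `ζ ∈ Γ`, `|ζ|
≤ ε`.

Since the two cones are complementary subspaces, every `x` can be written `L τ(x) - L' τ'(x)` with
`τ`, `τ'` continuous, cone-valued and zero at `0`. On a fixed small ball the map `x ↦ x - ε⁻¹ (Z(τ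
x) - H(ε τ' x))` is continuous and as small as desired, so Brouwer's theorem gives a fixed point,
that is `Z(τ x) = H(ε τ' x)`: a point of the target reached by a control in `V`. It lies in any
prescribed neighbourhood of `y(S)` once `ε` is small.

Three analytic ingredients support this. Brouwer's theorem comes from the absence of a `C¹`
retraction (`no_retraction`), proved by computing the volume of the ball. The flow is the inverse of
the identity minus the Picard operator on continuous functions; that operator is a differentiable
contraction on short intervals, which gives existence, uniqueness and differentiability
(`exists_flow`). Finally, the bounds on `f` and on its covariant derivative become bounds and
Lipschitz estimates in a fixed chart, because the Levi-Civita form does not depend on coordinates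
(`leviCivitaForm_pullback`, `exists_coordField_bound`).

The first order effect of one needle follows from the Scorza-Dragoni property (`needle_isLittleO`).
It is transported to time `S` by the differential of the flow, and the needles are added one at a
time (`needles_isLittleO`). -/

noncomputable section

set_option linter.unusedSectionVars false

/-! ### The radial retraction onto a ball -/

section BallRetract

variable {E : Type*} [NormedAddCommGroup E] [NormedSpace ℝ E]

/-- The radial retraction of a normed space onto the closed ball with centre `c` and radius `R`. -/
def ballRetract (c : E) (R : ℝ) (x : E) : E :=
  c + (R / max R ‖x - c‖) • (x - c)

theorem ballRetract_of_mem {c : E} {R : ℝ} (hR : 0 < R) {x : E} (hx : ‖x - c‖ ≤ R) :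
    ballRetract c R x = x := by
  rw [ballRetract, max_eq_left hx, div_self hR.ne', one_smul, add_sub_cancel]

theorem norm_ballRetract_sub_le {c : E} {R : ℝ} (hR : 0 < R) (x : E) :
    ‖ballRetract c R x - c‖ ≤ R := by
  have hm : 0 < max R ‖x - c‖ := lt_max_of_lt_left hR
  rw [ballRetract, add_sub_cancel_left, norm_smul, Real.norm_of_nonneg (by positivity),
    div_mul_eq_mul_div, div_le_iff₀ hm]
  exact mul_le_mul_of_nonneg_left (le_max_right _ _) hR.le

/-- Split the difference into the scalar factor at `x` times `x - y`, plus the variation of the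
factor times `y - c`. Each part costs one `‖x - y‖`, hence the constant `2`, valid in any normed
space. -/
theorem norm_ballRetract_sub_ballRetract_le {c : E} {R : ℝ} (hR : 0 < R) (x y : E) :
    ‖ballRetract c R x - ballRetract c R y‖ ≤ 2 * ‖x - y‖ := by
  set u := x - c with hu
  set v := y - c with hv
  have huv : x - y = u - v := by rw [hu, hv]; abel
  have hmu : 0 < max R ‖u‖ := lt_max_of_lt_left hR
  have hmv : 0 < max R ‖v‖ := lt_max_of_lt_left hR
  have e : ballRetract c R x - ballRetract c R y
      = (R / max R ‖u‖) • (u - v) + (R / max R ‖u‖ - R / max R ‖v‖) • v := by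
    simp only [ballRetract, ← hu, ← hv, smul_sub, sub_smul]; abel
  have h1 : R / max R ‖u‖ ≤ 1 := (div_le_one hmu).2 (le_max_left _ _)
  have h2 : |R / max R ‖u‖ - R / max R ‖v‖| * ‖v‖ ≤ ‖u - v‖ := by
    have : R / max R ‖u‖ - R / max R ‖v‖
        = (R / max R ‖u‖) * ((max R ‖v‖ - max R ‖u‖) / max R ‖v‖) := by
      field_simp
    rw [this, abs_mul, abs_of_pos (by positivity : 0 < R / max R ‖u‖), abs_div, abs_of_pos hmv]
    have h3 : |max R ‖v‖ - max R ‖u‖| ≤ ‖u - v‖ := by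
      refine (abs_max_sub_max_le_max _ _ _ _).trans ?_
      rw [sub_self, abs_zero, max_eq_right (abs_nonneg _), norm_sub_rev u v]
      exact abs_norm_sub_norm_le v u
    calc R / max R ‖u‖ * (|max R ‖v‖ - max R ‖u‖| / max R ‖v‖) * ‖v‖
        ≤ 1 * (|max R ‖v‖ - max R ‖u‖| / max R ‖v‖) * max R ‖v‖ := by
          gcongr
          exact le_max_right _ _
      _ = |max R ‖v‖ - max R ‖u‖| := by field_simp
      _ ≤ _ := h3
  rw [e, huv]
  calc _ ≤ ‖(R / max R ‖u‖) • (u - v)‖ + ‖(R / max R ‖u‖ - R / max R ‖v‖) • v‖ := norm_add_le _ _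
    _ ≤ 1 * ‖u - v‖ + ‖u - v‖ := by
        rw [norm_smul, norm_smul, Real.norm_eq_abs, Real.norm_eq_abs,
          abs_of_pos (by positivity : 0 < R / max R ‖u‖)]
        gcongr
    _ = _ := by ring

theorem lipschitzWith_ballRetract {c : E} {R : ℝ} (hR : 0 < R) :
    LipschitzWith 2 (ballRetract c R) :=
  LipschitzWith.of_dist_le_mul fun x y => by
    rw [dist_eq_norm, dist_eq_norm]; exact norm_ballRetract_sub_ballRetract_le hR x y

theorem continuous_ballRetract {c : E} {R : ℝ} (hR : 0 < R) : Continuous (ballRetract c R) :=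
  (lipschitzWith_ballRetract hR).continuous

end BallRetract

/-! ### Lipschitz perturbations of the identity -/

section IdSub

variable {E : Type*} [NormedAddCommGroup E] [NormedSpace ℝ E]

theorem approximatesLinearOn_id_sub {q : E → E} {K : ℝ≥0} (hq : LipschitzWith K q) :
    ApproximatesLinearOn (fun x => x - q x)
      ((ContinuousLinearEquiv.refl ℝ E : E ≃L[ℝ] E) : E →L[ℝ] E) univ K := by
  intro x _ y _
  have := hq.dist_le_mul y x
  rw [dist_eq_norm, dist_eq_norm] at this
  have e : (x - q x) - (y - q y) - (ContinuousLinearEquiv.refl ℝ E : E →L[ℝ] E) (x - y)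
      = q y - q x := by
    simp; abel
  rw [e, norm_sub_rev x y]
  exact this

/-- This is the smallness condition of the inverse function theorem around the identity. The trivial
space is set apart because its identity has norm `0`. -/
theorem idSub_const_lt {K : ℝ≥0} (hK : K < 1) :
    Subsingleton E ∨ K < ‖((ContinuousLinearEquiv.refl ℝ E).symm : E →L[ℝ] E)‖₊⁻¹ := by
  rcases subsingleton_or_nontrivial E with h | h
  · exact Or.inl h
  · right
    have : ‖((ContinuousLinearEquiv.refl ℝ E).symm : E →L[ℝ] E)‖₊ = 1 := by
      have : ((ContinuousLinearEquiv.refl ℝ E).symm : E →L[ℝ] E) = ContinuousLinearMap.id ℝ E := rfl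
      rw [this]
      exact ContinuousLinearMap.nnnorm_id
    rw [this, inv_one]; exact hK

/-- A contraction subtracted from the identity is a homeomorphism. -/
def idSubHomeomorph [CompleteSpace E] {q : E → E} {K : ℝ≥0} (hq : LipschitzWith K q) (hK : K < 1) :
    E ≃ₜ E :=
  (approximatesLinearOn_id_sub hq).toHomeomorph _ (idSub_const_lt hK)

end IdSub

/-! ### Brouwer's fixed point theorem -/

section Brouwer

variable {E : Type*} [NormedAddCommGroup E] [InnerProductSpace ℝ E] [FiniteDimensional ℝ E]

/-- The bound on the degree allows the value at `t = 1` to be recovered from finitely many small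
values of `t`. -/
theorem exists_polynomial_det_one_sub_smul (A : E →L[ℝ] E) :
    ∃ P : Polynomial ℝ, P.natDegree ≤ Module.finrank ℝ E ∧
      ∀ t : ℝ, P.eval t = (ContinuousLinearMap.id ℝ E - t • A).det := by
  classical
  let b := Module.finBasis ℝ E
  let B := LinearMap.toMatrix b b (A : E →ₗ[ℝ] E)
  refine ⟨((Polynomial.X : Polynomial ℝ) • (-B).map Polynomial.C
    + (1 : Matrix _ _ ℝ).map Polynomial.C).det, ?_, fun t => ?_⟩
  · exact (Polynomial.natDegree_det_X_add_C_le (-B) 1).trans (by simp)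
  · rw [ContinuousLinearMap.det, ← LinearMap.det_toMatrix b, ← Polynomial.coe_evalRingHom,
      RingHom.map_det]
    congr 1
    have : ((ContinuousLinearMap.id ℝ E - t • A : E →L[ℝ] E) : E →ₗ[ℝ] E)
        = LinearMap.id - t • (A : E →ₗ[ℝ] E) := rfl
    rw [this, map_sub, map_smul, LinearMap.toMatrix_id]
    ext i j
    by_cases hij : i = j <;> simp [B, hij] <;> ring

/-- The value of `det (1 - A)` is a combination of the values of `det (1 - tᵢ A)`, by Lagrange
interpolation. -/
theorem det_one_sub_eq_sum (t : Fin (Module.finrank ℝ E + 1) → ℝ) (ht : Function.Injective t) :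
    ∃ c : Fin (Module.finrank ℝ E + 1) → ℝ, ∑ i, c i = 1 ∧ ∀ A : E →L[ℝ] E,
      (ContinuousLinearMap.id ℝ E - A).det
        = ∑ i, c i * (ContinuousLinearMap.id ℝ E - t i • A).det := by
  classical
  refine ⟨fun i => (Lagrange.basis Finset.univ t i).eval 1, ?_, fun A => ?_⟩
  · rw [← Polynomial.eval_finsetSum,
      Lagrange.sum_basis ht.injOn Finset.univ_nonempty, Polynomial.eval_one]
  · obtain ⟨P, hP, hPe⟩ := exists_polynomial_det_one_sub_smul A
    have hdeg : P.degree < (Finset.univ : Finset (Fin (Module.finrank ℝ E + 1))).card := by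
      refine lt_of_le_of_lt Polynomial.degree_le_natDegree ?_
      simp only [Finset.card_univ, Fintype.card_fin]
      exact_mod_cast Nat.lt_succ_of_le hP
    have := congrArg (Polynomial.eval 1) (Lagrange.eq_interpolate (v := t) ht.injOn hdeg)
    rw [hPe, one_smul, Lagrange.interpolate_apply, Polynomial.eval_finsetSum] at this
    rw [this]
    refine Finset.sum_congr rfl fun i _ => ?_
    rw [Polynomial.eval_mul, Polynomial.eval_C, hPe, mul_comm]

/-- The range of `A` lies in the hyperplane orthogonal to `v`, so `A` is not surjective. -/
theorem det_eq_zero_of_inner_eq_zero {A : E →L[ℝ] E} {v : E} (hv : v ≠ 0)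
    (h : ∀ u, inner ℝ v (A u) = 0) : A.det = 0 := by
  by_contra hd
  have : IsUnit (LinearMap.det (A : E →ₗ[ℝ] E)) := isUnit_iff_ne_zero.2 hd
  have hs : Function.Surjective (A : E →ₗ[ℝ] E) :=
    ((Module.End.isUnit_iff _).1 ((LinearMap.isUnit_iff_isUnit_det _).2 this)).2
  obtain ⟨u, hu⟩ := hs v
  have := h u
  rw [show A u = v from hu] at this
  exact hv (inner_self_eq_zero.1 this)

/-- There is no `C¹` retraction of the closed unit ball onto the unit sphere. -/
theorem no_retraction [MeasurableSpace E] [BorelSpace E] (H : E → E)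
    (hH : ∀ x, ‖x‖ ≤ 1 → ContDiffAt ℝ 1 H x) (h1 : ∀ x, ‖x‖ ≤ 1 → ‖H x‖ = 1)
    (hs : ∀ x, ‖x‖ = 1 → H x = x) : False := by
  set B : Set E := Metric.closedBall 0 1
  set D : E → E →L[ℝ] E := fun x => ContinuousLinearMap.id ℝ E - fderiv ℝ H x with hD
  have hHd : ∀ x, ‖x‖ ≤ 1 → HasFDerivAt H (fderiv ℝ H x) x := fun x hx =>
    ((hH x hx).differentiableAt one_ne_zero).hasFDerivAt
  obtain ⟨K, hK⟩ : ∃ K, LipschitzOnWith K (fun x => x - H x) B := by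
    refine ContDiffOn.exists_lipschitzOnWith (n := 1) (fun x hx => ?_) one_ne_zero
      (convex_closedBall _ _) (isCompact_closedBall _ _)
    exact (contDiffAt_id.sub (hH x (by simpa [B] using hx))).contDiffWithinAt
  -- A Lipschitz extension of `x - H x` to the whole space. It vanishes outside the ball because `H`
  -- fixes the sphere, so `x - t • q x` is the identity there.
  set q : E → E := fun x => ballRetract 0 1 x - H (ballRetract 0 1 x) with hq
  have hqK : LipschitzWith (K * 2) q := by
    have := hK.comp (lipschitzWith_ballRetract (c := (0 : E)) one_pos).lipschitzOnWith
      (s := univ) (fun x _ => by simpa [B] using norm_ballRetract_sub_le (c := (0 : E)) one_pos x)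
    exact lipschitzOnWith_univ.1 this
  have hqin : ∀ x, ‖x‖ ≤ 1 → q x = x - H x := fun x hx => by
    simp only [hq]; rw [ballRetract_of_mem one_pos (by simpa using hx)]
  have hqout : ∀ x, 1 ≤ ‖x‖ → q x = 0 := fun x hx => by
    simp only [hq]
    rw [hs, sub_self]
    simp only [ballRetract, sub_zero, zero_add, max_eq_right hx, norm_smul]
    rw [Real.norm_of_nonneg (by positivity)]
    field_simp
  have hDc : ContinuousOn D B := fun x hx => by
    have h := (hH x (by simpa [B] using hx)).fderiv_right (m := 0) (by simp)
    exact (continuousAt_const.sub h.continuousAt).continuousWithinAt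
  obtain ⟨C, hC⟩ := (isCompact_closedBall (0 : E) 1).exists_bound_of_continuousOn hDc
  have hpos : ∀ᶠ A : E →L[ℝ] E in 𝓝 0, 0 < (ContinuousLinearMap.id ℝ E - A).det := by
    have hc : Continuous fun A : E →L[ℝ] E => (ContinuousLinearMap.id ℝ E - A).det :=
      ContinuousLinearMap.continuous_det.comp (continuous_const.sub continuous_id)
    refine hc.continuousAt.eventually (lt_mem_nhds ?_)
    simp [ContinuousLinearMap.det]
  obtain ⟨η, hη, hball⟩ := Metric.eventually_nhds_iff.1 hpos
  have hC' : 0 ≤ C := (norm_nonneg _).trans (hC 0 (by simp))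
  -- Below `t₀` the map `t • q` is a contraction and the Jacobian of `x - t • q x` is positive.
  obtain ⟨t₀, ht₀, ht₀K, ht₀C⟩ : ∃ t₀ : ℝ, 0 < t₀ ∧ t₀ * (K * 2) < 1 ∧ t₀ * C < η := by
    refine ⟨min (1 / (K * 2 + 1)) (η / (C + 1)), by positivity, ?_, ?_⟩
    · calc _ ≤ 1 / ((K : ℝ) * 2 + 1) * (K * 2) := by gcongr; exact min_le_left _ _
        _ < 1 := by rw [one_div, inv_mul_lt_iff₀ (by positivity)]; linarith
    · calc _ ≤ η / (C + 1) * C := by gcongr; exact min_le_right _ _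
        _ < η := by rw [div_mul_eq_mul_div, div_lt_iff₀ (by positivity)]; nlinarith
  set U : Set E := Metric.ball 0 1
  have hUB : U ⊆ B := Metric.ball_subset_closedBall
  -- For small `t` the map `x - t • q x` is a bijection of the space that fixes the complement of
  -- the ball pointwise, so it maps the ball onto itself. The change of variables formula then makes
  -- the integral of its Jacobian equal to the volume.
  have key : ∀ t : ℝ, 0 ≤ t → t ≤ t₀ →
      ∫ x in U, (ContinuousLinearMap.id ℝ E - t • D x).det = volume.real U := by
    intro t ht htt
    have hL : LipschitzWith (t.toNNReal * (K * 2)) (fun x => t • q x) := by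
      have := (lipschitzWith_smul t).comp hqK
      rwa [show ‖t‖₊ = t.toNNReal from by
        ext; simp [Real.coe_toNNReal t ht, abs_of_nonneg ht]] at this
    have hlt : t.toNNReal * (K * 2) < 1 := by
      rw [← NNReal.coe_lt_coe]; push_cast; rw [Real.coe_toNNReal t ht]
      refine lt_of_le_of_lt ?_ ht₀K
      gcongr
    set g := idSubHomeomorph hL hlt
    have hg : ∀ x, g x = x - t • q x := fun x => rfl
    have himg : g '' U = U := by
      have hc : g '' Uᶜ = Uᶜ := by
        have : EqOn g id Uᶜ := fun x hx => by
          rw [hg, hqout x (by simpa [U] using hx), smul_zero, sub_zero, id]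
        rw [this.image_eq, image_id]
      rw [image_compl_eq g.bijective] at hc
      exact compl_injective hc
    have hder : ∀ x ∈ U, HasFDerivWithinAt g (ContinuousLinearMap.id ℝ E - t • D x) U x := by
      intro x hx
      have hx1 : ‖x‖ ≤ 1 := by simpa [B] using hUB hx
      have : HasFDerivAt (fun x => x - t • (x - H x)) (ContinuousLinearMap.id ℝ E - t • D x) x :=
        (hasFDerivAt_id x).sub (((hasFDerivAt_id x).sub (hHd x hx1)).const_smul t)
      refine (this.hasFDerivWithinAt).congr (fun z hz => ?_) ?_
      · rw [hg, hqin z (by simpa [B] using hUB hz)]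
      · rw [hg, hqin x hx1]
    have := integral_image_eq_integral_abs_det_fderiv_smul volume
      (measurableSet_ball : MeasurableSet U) hder g.injective.injOn (fun _ => (1 : ℝ))
    rw [himg] at this
    simp only [integral_const, smul_eq_mul, mul_one, measureReal_restrict_apply_univ] at this
    rw [this]
    refine setIntegral_congr_fun measurableSet_ball fun x hx => ?_
    refine (abs_of_pos (hball ?_)).symm
    rw [dist_zero_right, norm_smul, Real.norm_of_nonneg ht]
    refine lt_of_le_of_lt ?_ ht₀C
    gcongr
    exact hC x (hUB hx)
  set d := Module.finrank ℝ E
  -- These `d + 1` distinct nodes lie in `[0, t₀]`, where `key` applies. They determine a polynomial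
  -- of degree at most `d`, and hence its value at `t = 1`.
  set τ : Fin (d + 1) → ℝ := fun i => t₀ * (((i : ℕ) : ℝ) / (d + 1)) with hτ
  have hτi : Function.Injective τ := by
    intro i j hij
    simp only [hτ] at hij
    have := mul_left_cancel₀ ht₀.ne' hij
    field_simp at this
    exact Fin.ext (by exact_mod_cast this)
  obtain ⟨c, hc1, hc⟩ := det_one_sub_eq_sum τ hτi
  have hint : ∀ i, IntegrableOn (fun x => (ContinuousLinearMap.id ℝ E - τ i • D x).det) U := by
    intro i
    refine IntegrableOn.mono_set (ContinuousOn.integrableOn_compact (isCompact_closedBall 0 1) ?_)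
      hUB
    exact ContinuousLinearMap.continuous_det.comp_continuousOn
      (continuousOn_const.sub (hDc.const_smul (τ i)))
  -- At `t = 1` the Jacobian is that of `H`. Differentiating `⟪H, H⟫ = 1` shows that the range of
  -- the derivative is orthogonal to `H x ≠ 0`.
  have h0 : ∫ x in U, (ContinuousLinearMap.id ℝ E - D x).det = 0 := by
    rw [setIntegral_congr_fun measurableSet_ball (g := fun _ => (0 : ℝ)), integral_zero]
    intro x hx
    have hx1 : ‖x‖ < 1 := by simpa [U] using hx
    simp only [hD, sub_sub_cancel]
    refine det_eq_zero_of_inner_eq_zero (v := H x) ?_ fun u => ?_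
    · intro h0; have := h1 x hx1.le; rw [h0, norm_zero] at this; exact zero_ne_one this
    · have h2 := (hHd x hx1.le).inner ℝ (hHd x hx1.le)
      have h3 : (fun y => inner ℝ (H y) (H y)) =ᶠ[𝓝 x] fun _ => (1 : ℝ) := by
        filter_upwards [Metric.isOpen_ball.mem_nhds hx] with y hy
        rw [real_inner_self_eq_norm_sq, h1 y (by simpa [B] using hUB hy), one_pow]
      have h4 := (h2.congr_of_eventuallyEq h3.symm).unique (hasFDerivAt_const (1 : ℝ) x)
      have h5 := congrArg (fun L : E →L[ℝ] ℝ => L u) h4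
      have h6 : inner ℝ (H x) (fderiv ℝ H x u) + inner ℝ (fderiv ℝ H x u) (H x) = 0 := h5
      rw [real_inner_comm (H x)] at h6
      linarith
  have h1' : ∫ x in U, (ContinuousLinearMap.id ℝ E - D x).det = volume.real U := by
    rw [integral_congr_ae (ae_of_all _ fun x => hc (D x)), integral_finsetSum _ fun i _ => (hint i).const_mul (c i)]
    simp_rw [integral_const_mul]
    have hkey : ∀ i, ∫ x in U, (ContinuousLinearMap.id ℝ E - τ i • D x).det = volume.real U := by
      intro i
      refine key (τ i) (by positivity) ?_
      have : ((i : ℕ) : ℝ) / (d + 1) ≤ 1 := by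
        rw [div_le_one (by positivity)]
        exact_mod_cast i.2.le
      calc τ i ≤ t₀ * 1 := by simp only [hτ]; gcongr
        _ = t₀ := mul_one _
    simp_rw [hkey]
    rw [← Finset.sum_mul, hc1, one_mul]
  rw [h0] at h1'
  have : 0 < volume.real U := by
    refine ENNReal.toReal_pos ?_ measure_ball_lt_top.ne
    exact (Metric.measure_ball_pos volume (0 : E) one_pos).ne'
  linarith

/-- Otherwise `x - (1 - ‖x‖²) R x` has no zero in the ball, and its normalization is a `C¹`
retraction onto the sphere. The factor `1 - ‖x‖²` vanishes on the sphere, so no condition on the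
range of `R` is needed. -/
theorem exists_eq_smul_of_contDiff [MeasurableSpace E] [BorelSpace E] {R : E → E}
    (hR : ContDiff ℝ 1 R) :
    ∃ x, ‖x‖ ≤ 1 ∧ x = (1 - ‖x‖ ^ 2) • R x := by
  by_contra! hne
  set G : E → E := fun x => x - (1 - ‖x‖ ^ 2) • R x with hG
  have hGd : ContDiff ℝ 1 G :=
    contDiff_id.sub ((contDiff_const.sub (contDiff_norm_sq ℝ)).smul hR)
  have hG0 : ∀ x, ‖x‖ ≤ 1 → G x ≠ 0 := fun x hx h => hne x hx (sub_eq_zero.1 h)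
  refine no_retraction (fun x => ‖G x‖⁻¹ • G x) (fun x hx => ?_) (fun x hx => ?_) fun x hx => ?_
  · have h := hG0 x hx
    exact ((hGd.contDiffAt.norm ℝ h).inv (norm_ne_zero_iff.2 h)).smul hGd.contDiffAt
  · rw [norm_smul, norm_inv, norm_norm, inv_mul_cancel₀ (norm_ne_zero_iff.2 (hG0 x hx))]
  · simp [hG, hx]

/-- Mollifying `R` gives smooth maps uniformly close to it. Their solutions solve the equation
approximately, and compactness of the ball gives an exact solution. -/
theorem exists_eq_smul_of_uniformContinuous [MeasurableSpace E] [BorelSpace E] {R : E → E}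
    (hR : UniformContinuous R) :
    ∃ x, ‖x‖ ≤ 1 ∧ x = (1 - ‖x‖ ^ 2) • R x := by
  have happ : ∀ k : ℕ, ∃ x : E, ‖x‖ ≤ 1 ∧ ‖x - (1 - ‖x‖ ^ 2) • R x‖ ≤ 1 / ((k : ℝ) + 1) := by
    intro k
    obtain ⟨δ, hδ, hδR⟩ := Metric.uniformContinuous_iff.1 hR (1 / ((k : ℝ) + 1)) (by positivity)
    let φ : ContDiffBump (0 : E) := ⟨δ / 2, δ, by positivity, by linarith⟩
    set R' : E → E := convolution (φ.normed volume) R (ContinuousLinearMap.lsmul ℝ ℝ) volume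
    have hR' : ContDiff ℝ 1 R' :=
      φ.hasCompactSupport_normed.contDiff_convolution_left (n := 1) _ φ.contDiff_normed
        hR.continuous.locallyIntegrable
    have hd : ∀ x, ‖R' x - R x‖ ≤ 1 / ((k : ℝ) + 1) := fun x => by
      rw [← dist_eq_norm]
      exact φ.dist_normed_convolution_le hR.continuous.aestronglyMeasurable fun y hy =>
        (hδR (by simpa [φ] using hy)).le
    obtain ⟨x, hx, hxe⟩ := exists_eq_smul_of_contDiff hR'
    refine ⟨x, hx, ?_⟩
    have hx2 : 0 ≤ 1 - ‖x‖ ^ 2 := by nlinarith [norm_nonneg x]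
    calc ‖x - (1 - ‖x‖ ^ 2) • R x‖ = ‖(1 - ‖x‖ ^ 2) • (R' x - R x)‖ := by
          rw [smul_sub, ← hxe]
      _ = (1 - ‖x‖ ^ 2) * ‖R' x - R x‖ := by rw [norm_smul, Real.norm_of_nonneg hx2]
      _ ≤ 1 * ‖R' x - R x‖ := by gcongr; nlinarith [norm_nonneg x]
      _ ≤ _ := by rw [one_mul]; exact hd x
  choose x hx hxe using happ
  obtain ⟨a, ha, ψ, hψ, hlim⟩ := (isCompact_closedBall (0 : E) 1).tendsto_subseq
    (x := x) (fun k => by simpa using hx k)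
  refine ⟨a, by simpa using ha, ?_⟩
  have hc : Continuous fun x : E => x - (1 - ‖x‖ ^ 2) • R x := by
    have := hR.continuous
    fun_prop
  have h1 := ((hc.tendsto a).comp hlim).norm
  have h2 : Tendsto (fun k : ℕ => 1 / ((ψ k : ℝ) + 1)) atTop (𝓝 0) := by
    refine Tendsto.div_atTop tendsto_const_nhds ?_
    exact tendsto_atTop_add_const_right _ _
      (tendsto_natCast_atTop_atTop.comp hψ.tendsto_atTop)
  have h3 := le_of_tendsto_of_tendsto' h1 h2 fun k => hxe (ψ k)
  exact sub_eq_zero.1 (norm_le_zero_iff.1 h3)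

/-- A form of Brouwer's fixed point theorem: a continuous map from a closed ball to a much smaller
concentric ball has a fixed point. -/
theorem exists_fixedPoint_of_continuousOn {R : E → E} {κ : ℝ} (hκ : 0 < κ)
    (hR : ContinuousOn R (Metric.closedBall 0 κ)) (hb : ∀ x, ‖x‖ ≤ κ → ‖R x‖ ≤ κ / 8) :
    ∃ x, ‖x‖ ≤ κ ∧ R x = x := by
  borelize E
  -- Retracting onto the half ball extends the map to a uniformly continuous one on the whole space,
  -- and keeps `1 - ‖x‖²` at least `3 / 4`.
  set P : E → E := ballRetract 0 (1 / 2)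
  have hP : ∀ x, ‖P x‖ ≤ 1 / 2 := fun x => by
    have := norm_ballRetract_sub_le (c := (0 : E)) (by norm_num : (0 : ℝ) < 1 / 2) x
    rwa [sub_zero] at this
  -- Chosen so that `x = (1 - ‖x‖²) g x` means that `κ • x` is fixed by `R`.
  set g : E → E := fun x => (1 - ‖x‖ ^ 2)⁻¹ • κ⁻¹ • R (κ • x)
  have hden : ∀ x : E, ‖x‖ ≤ 1 / 2 → 3 / 4 ≤ 1 - ‖x‖ ^ 2 := fun x hx => by
    nlinarith [norm_nonneg x]
  have hmaps : ∀ x : E, ‖x‖ ≤ 1 / 2 → ‖κ • x‖ ≤ κ := fun x hx => by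
    rw [norm_smul, Real.norm_of_nonneg hκ.le]; nlinarith
  have hg : ContinuousOn g (Metric.closedBall 0 (1 / 2)) := by
    refine ContinuousOn.smul (ContinuousOn.inv₀ (by fun_prop) fun x hx => ?_) ?_
    · have := hden x (by simpa using hx); linarith
    · exact ContinuousOn.const_smul (hR.comp (by fun_prop) fun x hx => by
        simpa using hmaps x (by simpa using hx)) _
  have hgu := (isCompact_closedBall (0 : E) (1 / 2)).uniformContinuousOn_of_continuous hg
  have hu : UniformContinuous fun x => g (P x) := by
    rw [Metric.uniformContinuousOn_iff] at hgu
    refine Metric.uniformContinuous_iff.2 fun ε hε => ?_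
    obtain ⟨δ, hδ, hδg⟩ := hgu ε hε
    obtain ⟨δ', hδ', hδP⟩ := Metric.uniformContinuous_iff.1
      (lipschitzWith_ballRetract (c := (0 : E)) (R := 1 / 2) (by norm_num)).uniformContinuous δ hδ
    exact ⟨δ', hδ', fun a b h => hδg (P a) (mem_closedBall_zero_iff.2 (hP a)) (P b)
      (mem_closedBall_zero_iff.2 (hP b)) (hδP h)⟩
  have hgb : ∀ x, ‖g (P x)‖ ≤ 1 / 4 := fun x => by
    have h1 := hden _ (hP x)
    have h2 := hb _ (hmaps _ (hP x))
    have h3 : ‖g (P x)‖ = (1 - ‖P x‖ ^ 2)⁻¹ * (κ⁻¹ * ‖R (κ • P x)‖) := by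
      rw [norm_smul, norm_smul, norm_inv, norm_inv, Real.norm_of_nonneg hκ.le,
        Real.norm_of_nonneg (by linarith : 0 ≤ 1 - ‖P x‖ ^ 2)]
    rw [h3]
    calc (1 - ‖P x‖ ^ 2)⁻¹ * (κ⁻¹ * ‖R (κ • P x)‖) ≤ (3 / 4)⁻¹ * (κ⁻¹ * (κ / 8)) := by gcongr
      _ ≤ 1 / 4 := by field_simp; norm_num
  obtain ⟨x, hx, hxe⟩ := exists_eq_smul_of_uniformContinuous hu
  have hx2 : 0 ≤ 1 - ‖x‖ ^ 2 := by nlinarith [norm_nonneg x]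
  -- The bound `1 / 4` on `g ∘ P` forces the solution into the half ball, where `P` is the identity.
  have hxs : ‖x‖ ≤ 1 / 2 := by
    rw [hxe, norm_smul, Real.norm_of_nonneg hx2]
    have := hgb x
    nlinarith [norm_nonneg (g (P x)), sq_nonneg ‖x‖]
  have hPx : P x = x := ballRetract_of_mem (by norm_num) (by simpa using hxs)
  refine ⟨κ • x, hmaps x hxs, ?_⟩
  have h1 := hden x hxs
  rw [hPx, smul_inv_smul₀ (by linarith : (1 : ℝ) - ‖x‖ ^ 2 ≠ 0)] at hxe
  rw [← inv_smul_eq_iff₀ hκ.ne']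
  exact hxe.symm

end Brouwer

/-! ### Carathéodory differential equations on a short interval -/

section Caratheodory

variable {E : Type*} [NormedAddCommGroup E] [NormedSpace ℝ E]

/-- The time-dependent field `X` is measurable along continuous curves, and is bounded by `k` and
`k`-Lipschitz in the space variable, for an integrable function `k` of time. -/
structure IsCaratheodoryField (X : ℝ → E → E) (k : ℝ → ℝ) (a b : ℝ) : Prop where
  integrable : IntegrableOn k (Icc a b)
  bound : ∀ᵐ s ∂(volume.restrict (Icc a b)), ∀ x, ‖X s x‖ ≤ k s
  lipschitz : ∀ᵐ s ∂(volume.restrict (Icc a b)), ∀ x y, ‖X s x - X s y‖ ≤ k s * ‖x - y‖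
  measurable : ∀ u : ℝ → E, Continuous u →
    AEStronglyMeasurable (fun s => X s (u s)) (volume.restrict (Icc a b))

variable {a b : ℝ}

theorem IntegrableOn.intervalIntegrable_of_mem {g : ℝ → E} (hg : IntegrableOn g (Icc a b))
    {s t : ℝ} (hs : s ∈ Icc a b) (ht : t ∈ Icc a b) : IntervalIntegrable g volume s t :=
  (hg.mono_set (uIcc_subset_Icc hs ht)).intervalIntegrable

/-- The primitive of an integrable function, as a continuous function. -/
def primitiveMap (g : ℝ → E) (hg : IntegrableOn g (Icc a b)) : C(Icc a b, E) where
  toFun s := ∫ τ in a..s, g τ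
  continuous_toFun := by
    have h := intervalIntegral.continuousOn_primitive_interval' (μ := volume) (f := g)
      (a := a) (b₁ := a) (b₂ := b)
    rcases le_or_gt a b with hab | hab
    · have h2 := h (IntegrableOn.intervalIntegrable_of_mem hg (left_mem_Icc.2 hab)
        (right_mem_Icc.2 hab)) left_mem_uIcc
      rw [uIcc_of_le hab] at h2
      exact continuousOn_iff_continuous_domRestrict.1 h2
    · have : IsEmpty (Icc a b) := by rw [Icc_eq_empty (not_le.2 hab)]; infer_instance
      exact continuous_of_discreteTopology

theorem primitiveMap_apply (g : ℝ → E) (hg : IntegrableOn g (Icc a b)) (s : Icc a b) :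
    primitiveMap g hg s = ∫ τ in a..s, g τ := rfl

theorem norm_primitiveMap_le {g : ℝ → E} (hg : IntegrableOn g (Icc a b)) :
    ‖primitiveMap g hg‖ ≤ ∫ s in Icc a b, ‖g s‖ := by
  refine (ContinuousMap.norm_le _ (integral_nonneg fun _ => norm_nonneg _)).2 fun s => ?_
  rw [primitiveMap_apply]
  refine (intervalIntegral.norm_integral_le_integral_norm s.2.1).trans ?_
  rw [intervalIntegral.integral_of_le s.2.1]
  refine setIntegral_mono_set hg.norm (ae_of_all _ fun _ => norm_nonneg _) (ae_of_all _ ?_)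
  exact fun τ hτ => ⟨hτ.1.le, hτ.2.trans s.2.2⟩

theorem primitiveMap_sub {g₁ g₂ : ℝ → E} (h₁ : IntegrableOn g₁ (Icc a b))
    (h₂ : IntegrableOn g₂ (Icc a b)) :
    primitiveMap g₁ h₁ - primitiveMap g₂ h₂ = primitiveMap (fun s => g₁ s - g₂ s) (h₁.sub h₂) := by
  ext s
  have hs : a ∈ Icc a b := ⟨le_rfl, s.2.1.trans s.2.2⟩
  simp only [ContinuousMap.sub_apply, primitiveMap_apply]
  rw [intervalIntegral.integral_sub (IntegrableOn.intervalIntegrable_of_mem h₁ hs s.2)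
    (IntegrableOn.intervalIntegrable_of_mem h₂ hs s.2)]

theorem norm_IccExtend_le (hab : a ≤ b) (u : C(Icc a b, E)) (s : ℝ) :
    ‖IccExtend hab u s‖ ≤ ‖u‖ := u.norm_coe_le_norm _

namespace IsCaratheodoryField

variable {X : ℝ → E → E} {k : ℝ → ℝ}

theorem integrableOn_comp (hX : IsCaratheodoryField X k a b) {u : ℝ → E} (hu : Continuous u) :
    IntegrableOn (fun s => X s (u s)) (Icc a b) := by
  refine Integrable.mono' hX.integrable (hX.measurable u hu) ?_
  filter_upwards [hX.bound] with s hs using hs _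

theorem mono (hX : IsCaratheodoryField X k a b) {a' b' : ℝ} (h : Icc a' b' ⊆ Icc a b) :
    IsCaratheodoryField X k a' b' where
  integrable := hX.integrable.mono_set h
  bound := ae_restrict_of_ae_restrict_of_subset h hX.bound
  lipschitz := ae_restrict_of_ae_restrict_of_subset h hX.lipschitz
  measurable u hu := (hX.measurable u hu).mono_set h

/-- The Picard operator. -/
def picard (hX : IsCaratheodoryField X k a b) (hab : a ≤ b) (u : C(Icc a b, E)) : C(Icc a b, E) :=
  primitiveMap (fun s => X s (IccExtend hab u s))
    (hX.integrableOn_comp (u.continuous.Icc_extend' (h := hab)))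

/-- On an interval where `∫ k ≤ 1 / 2` the supremum norm suffices for a contraction. -/
theorem lipschitzWith_picard (hX : IsCaratheodoryField X k a b) (hab : a ≤ b)
    (hk : ∫ s in Icc a b, k s ≤ 1 / 2) : LipschitzWith (1 / 2) (hX.picard hab) := by
  refine LipschitzWith.of_dist_le_mul fun u v => ?_
  rw [dist_eq_norm, dist_eq_norm, picard, picard, primitiveMap_sub]
  refine (norm_primitiveMap_le _).trans ?_
  calc _ ≤ ∫ s in Icc a b, k s * ‖u - v‖ := by
        refine integral_mono_ae ?_ (hX.integrable.mul_const _) ?_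
        · exact ((hX.integrableOn_comp (u.continuous.Icc_extend' (h := hab))).sub
            (hX.integrableOn_comp (v.continuous.Icc_extend' (h := hab)))).norm
        · filter_upwards [hX.lipschitz, hX.bound] with s hs hb
          have hks : 0 ≤ k s := (norm_nonneg _).trans (hb 0)
          refine (hs _ _).trans ?_
          gcongr
          exact (u - v).norm_coe_le_norm _
    _ = (∫ s in Icc a b, k s) * ‖u - v‖ := integral_mul_const _ _
    _ ≤ _ := by push_cast; gcongr

theorem norm_fderiv_apply_le (hX : IsCaratheodoryField X k a b) (hab : a ≤ b) (u : C(Icc a b, E)) :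
    ∀ᵐ s ∂(volume.restrict (Icc a b)), DifferentiableAt ℝ (X s) (IccExtend hab u s) →
      ∀ v : C(Icc a b, E),
        ‖fderiv ℝ (X s) (IccExtend hab u s) (IccExtend hab v s)‖ ≤ k s * ‖IccExtend hab v s‖ ∧
          k s * ‖IccExtend hab v s‖ ≤ k s * ‖v‖ := by
  filter_upwards [hX.lipschitz, hX.bound] with s hs hb hd v
  have hks : 0 ≤ k s := (norm_nonneg _).trans (hb 0)
  have h1 : ‖fderiv ℝ (X s) (IccExtend hab u s)‖ ≤ k s :=
    hd.hasFDerivAt.le_of_lip' hks (Eventually.of_forall fun x => hs _ _)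
  constructor
  · refine (ContinuousLinearMap.le_opNorm _ _).trans ?_
    gcongr
  · gcongr
    exact norm_IccExtend_le hab v s

theorem integrableOn_fderiv_apply (hX : IsCaratheodoryField X k a b) (hab : a ≤ b)
    (u : C(Icc a b, E))
    (hu : ∀ᵐ s ∂(volume.restrict (Icc a b)), DifferentiableAt ℝ (X s) (IccExtend hab u s))
    (v : C(Icc a b, E)) :
    IntegrableOn (fun s => fderiv ℝ (X s) (IccExtend hab u s) (IccExtend hab v s)) (Icc a b) := by
  refine Integrable.mono' (hX.integrable.mul_const ‖v‖) ?_ ?_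
  -- The directional derivative is the limit of the difference quotients with step `1 / m`, each
  -- measurable by the Carathéodory hypothesis.
  · refine aestronglyMeasurable_of_tendsto_ae atTop (f := fun (m : ℕ) s => (m : ℝ) •
      (X s (IccExtend hab u s + (m : ℝ)⁻¹ • IccExtend hab v s) - X s (IccExtend hab u s)))
      (fun m => ?_) ?_
    · have hu' := u.continuous.Icc_extend' (h := hab)
      have hv' := v.continuous.Icc_extend' (h := hab)
      exact ((hX.measurable _ (by fun_prop)).sub (hX.measurable _ hu')).const_smul _
    · filter_upwards [hu] with s hs
      refine hs.hasFDerivAt.lim _ (c := fun m : ℕ => (m : ℝ)) ?_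
      simpa using tendsto_natCast_atTop_atTop
  · filter_upwards [hX.norm_fderiv_apply_le hab u, hu] with s hs hd
    exact (hs hd v).1.trans (hs hd v).2

/-- The linearization of the Picard operator along `u`. -/
def picardDeriv (hX : IsCaratheodoryField X k a b) (hab : a ≤ b) (u : C(Icc a b, E))
    (hu : ∀ᵐ s ∂(volume.restrict (Icc a b)), DifferentiableAt ℝ (X s) (IccExtend hab u s)) :
    C(Icc a b, E) →L[ℝ] C(Icc a b, E) :=
  LinearMap.mkContinuous
    { toFun := fun v => primitiveMap _ (hX.integrableOn_fderiv_apply hab u hu v)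
      map_add' := fun v w => by
        ext s
        have hs : a ∈ Icc a b := ⟨le_rfl, hab⟩
        simp only [ContinuousMap.add_apply, primitiveMap_apply]
        rw [← intervalIntegral.integral_add
          (IntegrableOn.intervalIntegrable_of_mem (hX.integrableOn_fderiv_apply hab u hu v) hs s.2)
          (IntegrableOn.intervalIntegrable_of_mem (hX.integrableOn_fderiv_apply hab u hu w) hs s.2)]
        simp [IccExtend]
      map_smul' := fun c v => by
        ext s
        simp only [ContinuousMap.smul_apply, primitiveMap_apply, RingHom.id_apply]
        rw [← intervalIntegral.integral_smul]
        simp [IccExtend] }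
    (∫ s in Icc a b, k s) (fun v => by
      refine (norm_primitiveMap_le (hX.integrableOn_fderiv_apply hab u hu v)).trans ?_
      rw [← integral_mul_const]
      refine integral_mono_ae (hX.integrableOn_fderiv_apply hab u hu v).norm
        (hX.integrable.mul_const _) ?_
      filter_upwards [hX.norm_fderiv_apply_le hab u, hu] with s hs hd
      exact (hs hd v).1.trans (hs hd v).2)

theorem picardDeriv_apply (hX : IsCaratheodoryField X k a b) (hab : a ≤ b) (u : C(Icc a b, E))
    (hu : ∀ᵐ s ∂(volume.restrict (Icc a b)), DifferentiableAt ℝ (X s) (IccExtend hab u s))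
    (v : C(Icc a b, E)) :
    hX.picardDeriv hab u hu v = primitiveMap _ (hX.integrableOn_fderiv_apply hab u hu v) := rfl

theorem norm_picardDeriv_le (hX : IsCaratheodoryField X k a b) (hab : a ≤ b) (u : C(Icc a b, E))
    (hu : ∀ᵐ s ∂(volume.restrict (Icc a b)), DifferentiableAt ℝ (X s) (IccExtend hab u s))
    (hk : ∫ s in Icc a b, k s ≤ 1 / 2) : ‖hX.picardDeriv hab u hu‖ ≤ 1 / 2 := by
  have h0 : 0 ≤ ∫ s in Icc a b, k s := by
    refine integral_nonneg_of_ae ?_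
    filter_upwards [hX.bound] with s hb
    exact (norm_nonneg _).trans (hb 0)
  refine le_trans ?_ hk
  unfold picardDeriv
  exact LinearMap.mkContinuous_norm_le _ h0 _

/-- Dominated convergence: divided by `‖v - u‖`, the remainder under the integral is at most `2 k`
and tends to zero at almost every time. Differentiability along `u` at almost every time is enough;
continuity of the derivative plays no role. -/
theorem hasFDerivAt_picard (hX : IsCaratheodoryField X k a b) (hab : a ≤ b) (u : C(Icc a b, E))
    (hu : ∀ᵐ s ∂(volume.restrict (Icc a b)), DifferentiableAt ℝ (X s) (IccExtend hab u s)) :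
    HasFDerivAt (hX.picard hab) (hX.picardDeriv hab u hu) u := by
  rw [hasFDerivAt_iff_tendsto]
  set e : C(Icc a b, E) → ℝ → E := fun v s => X s (IccExtend hab v s) - X s (IccExtend hab u s)
    - fderiv ℝ (X s) (IccExtend hab u s) (IccExtend hab (⇑(v - u)) s) with he
  have hci : ∀ v : C(Icc a b, E), IntegrableOn (fun s => X s (IccExtend hab v s)) (Icc a b) :=
    fun v => hX.integrableOn_comp (v.continuous.Icc_extend' (h := hab))
  have hei : ∀ v, IntegrableOn (e v) (Icc a b) := fun v =>
    ((hci v).sub (hci u)).sub (hX.integrableOn_fderiv_apply hab u hu (v - u))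
  have heq : ∀ v, hX.picard hab v - hX.picard hab u - hX.picardDeriv hab u hu (v - u)
      = primitiveMap (e v) (hei v) := by
    intro v
    rw [picardDeriv_apply, picard, picard, primitiveMap_sub, primitiveMap_sub]
  have hlim : Tendsto (fun v => ∫ s in Icc a b, ‖v - u‖⁻¹ * ‖e v s‖) (𝓝 u)
      (𝓝 (∫ s in Icc a b, (0 : ℝ))) := by
    refine tendsto_integral_filter_of_dominated_convergence (fun s => 2 * k s) ?_ ?_
      (hX.integrable.const_mul 2) ?_
    · exact Eventually.of_forall fun v => ((hei v).norm.const_mul _).aestronglyMeasurable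
    · refine Eventually.of_forall fun v => ?_
      filter_upwards [hX.lipschitz, hX.bound, hu, hX.norm_fderiv_apply_le hab u] with s hs hb hd hn
      have hks : 0 ≤ k s := (norm_nonneg _).trans (hb 0)
      have h3 : IccExtend hab v s - IccExtend hab u s = IccExtend hab (⇑(v - u)) s := rfl
      obtain ⟨h1, h2⟩ := hn hd (v - u)
      have h4 : ‖e v s‖ ≤ 2 * k s * ‖v - u‖ := by
        have h5 := hs (IccExtend hab v s) (IccExtend hab u s)
        rw [h3] at h5
        have h6 := norm_sub_le (X s (IccExtend hab v s) - X s (IccExtend hab u s))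
          (fderiv ℝ (X s) (IccExtend hab u s) (IccExtend hab (⇑(v - u)) s))
        simp only [he]
        linarith
      rw [norm_mul, norm_inv, norm_norm, norm_norm]
      rcases eq_or_ne ‖v - u‖ 0 with h0 | h0
      · rw [h0]; simpa using hks
      · rw [inv_mul_le_iff₀ (lt_of_le_of_ne (norm_nonneg _) h0.symm)]
        linarith
    · filter_upwards [hu] with s hd
      have h1 := hasFDerivAt_iff_tendsto.1 hd.hasFDerivAt
      have h2 : Tendsto (fun v : C(Icc a b, E) => IccExtend hab v s) (𝓝 u)
          (𝓝 (IccExtend hab u s)) :=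
        (continuous_eval_const (projIcc a b hab s)).tendsto u
      have h3 := h1.comp h2
      refine squeeze_zero_norm' (Eventually.of_forall fun v => ?_) h3
      have h5 : IccExtend hab v s - IccExtend hab u s = IccExtend hab (⇑(v - u)) s := rfl
      have h4 : ‖IccExtend hab (⇑(v - u)) s‖ ≤ ‖v - u‖ := norm_IccExtend_le hab (v - u) s
      simp only [Function.comp_apply, h5]
      rw [norm_mul, norm_inv, norm_norm, norm_norm]
      -- The differentiability of `X s` controls the remainder divided by `‖(v - u) s‖`, which is at
      -- most `‖v - u‖`. When `(v - u) s = 0` the remainder itself vanishes.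
      rcases (norm_nonneg (IccExtend hab (⇑(v - u)) s)).eq_or_lt with h0 | h0
      · have h6 : IccExtend hab (⇑(v - u)) s = 0 := norm_eq_zero.1 h0.symm
        have h7 : IccExtend hab v s = IccExtend hab u s := sub_eq_zero.1 (h5.trans h6)
        have : e v s = 0 := by simp only [he, h6, h7, map_zero, sub_self]
        rw [this, norm_zero, mul_zero]
        positivity
      · exact mul_le_mul_of_nonneg_right (inv_anti₀ h0 h4) (norm_nonneg _)
  rw [integral_zero] at hlim
  refine squeeze_zero (fun v => by positivity) (fun v => ?_) hlim
  rw [heq, integral_const_mul]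
  exact mul_le_mul_of_nonneg_left (norm_primitiveMap_le _) (by positivity)

/-- Existence, uniqueness and differentiability of the flow of a Carathéodory field on a short
interval. -/
theorem exists_flow [CompleteSpace E] (hX : IsCaratheodoryField X k a b) (hab : a ≤ b)
    (hk : ∫ s in Icc a b, k s ≤ 1 / 2) :
    ∃ Φ : E → ℝ → E,
      (∀ x, Continuous (Φ x) ∧ ∀ s ∈ Icc a b, Φ x s = x + ∫ τ in a..s, X τ (Φ x τ)) ∧
      (∀ u : ℝ → E, ContinuousOn u (Icc a b) →
        (∀ s ∈ Icc a b, u s = u a + ∫ τ in a..s, X τ (u τ)) → EqOn u (Φ (u a)) (Icc a b)) ∧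
      ∀ x, (∀ᵐ s ∂(volume.restrict (Icc a b)), DifferentiableAt ℝ (X s) (Φ x s)) →
        DifferentiableAt ℝ (fun y => Φ y b) x := by
  have hL := hX.lipschitzWith_picard hab hk
  have hK : (1 / 2 : ℝ≥0) < 1 := by
    rw [← NNReal.coe_lt_coe]; push_cast; norm_num
  set h := idSubHomeomorph hL hK
  have hh : ∀ u, h u = u - hX.picard hab u := fun u => rfl
  set cst : E → C(Icc a b, E) := fun x => ContinuousMap.const _ x with hcst
  -- The integral equation with initial value `x` reads `u - picard u = const x`, and the left side
  -- is a homeomorphism in `u`.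
  set ψ : E → C(Icc a b, E) := fun x => h.symm (cst x) with hψ
  have hψe : ∀ x, ψ x - hX.picard hab (ψ x) = cst x := fun x => by
    rw [← hh]; exact h.apply_symm_apply _
  refine ⟨fun x => IccExtend hab (ψ x), fun x => ⟨(ψ x).continuous.Icc_extend' (h := hab), ?_⟩,
    fun u hu hue => ?_, fun x hx => ?_⟩
  · intro s hs
    have h1 := congrArg (fun v : C(Icc a b, E) => v ⟨s, hs⟩) (hψe x)
    beta_reduce
    rw [IccExtend_of_mem hab _ hs]
    exact (sub_eq_iff_eq_add.1 h1)
  · set v : C(Icc a b, E) := ⟨(Icc a b).domRestrict u, hu.domRestrict⟩ with hv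
    have hvu : EqOn (IccExtend hab v) u (Icc a b) := fun s hs => IccExtend_of_mem hab _ hs
    have h1 : h v = cst (u a) := by
      ext ⟨s, hs⟩
      rw [hh, ContinuousMap.sub_apply, picard, primitiveMap_apply]
      rw [intervalIntegral.integral_congr (g := fun τ => X τ (u τ))]
      · exact sub_eq_iff_eq_add.2 (hue s hs)
      · intro τ hτ
        rw [uIcc_of_le hs.1] at hτ
        exact congrArg (X τ) (hvu ⟨hτ.1, hτ.2.trans hs.2⟩)
    have h2 : v = ψ (u a) := by rw [hψ]; simp only; rw [← h1, h.symm_apply_apply]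
    intro s hs
    simp only [← h2]
    exact (hvu hs).symm
  · set A := hX.picardDeriv hab (ψ x) hx
    -- By the Neumann series `1 - A` is invertible, so the inverse homeomorphism is differentiable
    -- at `cst x`.
    have hA : ‖A‖ < 1 := (hX.norm_picardDeriv_le hab (ψ x) hx hk).trans_lt (by norm_num)
    let U : (C(Icc a b, E) →L[ℝ] C(Icc a b, E))ˣ := Units.oneSub A hA
    let e : C(Icc a b, E) ≃L[ℝ] C(Icc a b, E) := ContinuousLinearEquiv.ofUnit U
    have hder : HasFDerivAt h (e : C(Icc a b, E) →L[ℝ] C(Icc a b, E)) (h.symm (cst x)) :=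
      (hasFDerivAt_id _).sub (hX.hasFDerivAt_picard hab (ψ x) hx)
    have hinv : HasFDerivAt h.symm (e.symm : C(Icc a b, E) →L[ℝ] C(Icc a b, E)) (cst x) :=
      HasFDerivAt.of_local_left_inverse h.symm.continuous.continuousAt hder
        (Eventually.of_forall fun y => h.apply_symm_apply y)
    have hc : DifferentiableAt ℝ cst x :=
      (ContinuousLinearMap.const ℝ (Icc a b) : E →L[ℝ] C(Icc a b, E)).differentiableAt
    have hev : DifferentiableAt ℝ (fun v : C(Icc a b, E) => v ⟨b, right_mem_Icc.2 hab⟩) (ψ x) :=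
      (ContinuousMap.evalCLM (M := E) ℝ (⟨b, right_mem_Icc.2 hab⟩ : Icc a b)).differentiableAt
    have := hev.comp x (hinv.differentiableAt.comp x hc)
    refine this.congr_of_eventuallyEq (Eventually.of_forall fun y => ?_)
    exact IccExtend_of_mem hab _ (right_mem_Icc.2 hab)

end IsCaratheodoryField

end Caratheodory

/-! ### Covariance of the Levi-Civita form under a change of coordinates -/

section LeviCivita

variable {E : Type*} [NormedAddCommGroup E] [InnerProductSpace ℝ E]

/-- The form `⟨∇_u X, v⟩` at the point `x` for the metric `g`, in coordinates. -/
def leviCivitaForm (g : E → E → E → ℝ) (X : E → E) (x u v : E) : ℝ :=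
  g x (fderiv ℝ X x u) v + (1 / 2 : ℝ) * (fderiv ℝ (fun y => g y (X x) v) x u
    + fderiv ℝ (fun y => g y u v) x (X x) - fderiv ℝ (fun y => g y u (X x)) x v)

theorem hasFDerivAt_inner_clm {G : E → E →L[ℝ] E} {G' : E →L[ℝ] E →L[ℝ] E} {p q : E → E}
    {p' q' : E →L[ℝ] E} {x : E} (hG : HasFDerivAt G G' x) (hp : HasFDerivAt p p' x)
    (hq : HasFDerivAt q q' x) (u : E) :
    fderiv ℝ (fun y => inner ℝ (G y (p y)) (q y)) x u
      = inner ℝ (G' u (p x)) (q x) + inner ℝ (G x (p' u)) (q x) + inner ℝ (G x (p x)) (q' u) := by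
  have h := (hG.clm_apply hp).inner ℝ hq
  rw [h.fderiv]
  simp [inner_add_left]
  ring

/-- The product rule; the two terms with the second derivative of `ψ` are those that have to cancel
in the Levi-Civita form. -/
theorem fderiv_pullback_form {G : E → E →L[ℝ] E} {ψ : E → E} {x : E}
    (hψ : ContDiffAt ℝ 2 ψ x) (hG : DifferentiableAt ℝ G (ψ x)) (u a b : E) :
    fderiv ℝ (fun y => inner ℝ (G (ψ y) (fderiv ℝ ψ y a)) (fderiv ℝ ψ y b)) x u
      = fderiv ℝ (fun z => inner ℝ (G z (fderiv ℝ ψ x a)) (fderiv ℝ ψ x b)) (ψ x) (fderiv ℝ ψ x u)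
        + inner ℝ (G (ψ x) (fderiv ℝ (fderiv ℝ ψ) x u a)) (fderiv ℝ ψ x b)
        + inner ℝ (G (ψ x) (fderiv ℝ ψ x a)) (fderiv ℝ (fderiv ℝ ψ) x u b) := by
  have hψ1 : HasFDerivAt ψ (fderiv ℝ ψ x) x := (hψ.differentiableAt (by simp)).hasFDerivAt
  have hψ2 : HasFDerivAt (fderiv ℝ ψ) (fderiv ℝ (fderiv ℝ ψ) x) x :=
    ((hψ.fderiv_right (m := 1) (by norm_num)).differentiableAt (by simp)).hasFDerivAt
  have hJ : ∀ c, HasFDerivAt (fun y => fderiv ℝ ψ y c)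
      ((fderiv ℝ (fderiv ℝ ψ) x).flip c) x := fun c => by
    simpa using hψ2.clm_apply (hasFDerivAt_const c x)
  have hGψ : HasFDerivAt (fun y => G (ψ y)) _ x := hG.hasFDerivAt.comp x hψ1
  rw [hasFDerivAt_inner_clm hGψ (hJ a) (hJ b),
    hasFDerivAt_inner_clm hG.hasFDerivAt (hasFDerivAt_const _ _) (hasFDerivAt_const _ _)]
  simp

/-- Write `B` for the second derivative of `ψ`. Differentiating `Y ∘ ψ = Dψ X` replaces `Dψ DX u` by
`DY Dψ u - B(u, X)`. In the Christoffel combination, the symmetry of `B` and of `G` reduces the six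
second derivative terms to `G(B(u, X), Dψ v)`, which cancels this correction. -/
theorem leviCivitaForm_pullback {G : E → E →L[ℝ] E} {g : E → E → E → ℝ} {X Y ψ : E → E}
    {x : E} (hψ : ContDiffAt ℝ 2 ψ x) (hG : DifferentiableAt ℝ G (ψ x))
    (hsymm : ∀ u v, inner ℝ (G (ψ x) u) v = inner ℝ (G (ψ x) v) u)
    (hg : ∀ᶠ y in 𝓝 x, ∀ u v, g y u v = inner ℝ (G (ψ y) (fderiv ℝ ψ y u)) (fderiv ℝ ψ y v))
    (hX : DifferentiableAt ℝ X x) (hY : DifferentiableAt ℝ Y (ψ x))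
    (hXY : ∀ᶠ y in 𝓝 x, Y (ψ y) = fderiv ℝ ψ y (X y)) (u v : E) :
    leviCivitaForm g X x u v
      = leviCivitaForm (fun z a b => inner ℝ (G z a) b) Y (ψ x) (fderiv ℝ ψ x u) (fderiv ℝ ψ x v) := by
  have hψ1 : HasFDerivAt ψ (fderiv ℝ ψ x) x := (hψ.differentiableAt (by simp)).hasFDerivAt
  have hψ2 : HasFDerivAt (fderiv ℝ ψ) (fderiv ℝ (fderiv ℝ ψ) x) x :=
    ((hψ.fderiv_right (m := 1) (by norm_num)).differentiableAt (by simp)).hasFDerivAt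
  have hB : ∀ a b, fderiv ℝ (fderiv ℝ ψ) x a b = fderiv ℝ (fderiv ℝ ψ) x b a := fun a b =>
    (hψ.isSymmSndFDerivAt (by simp)).eq a b
  have hDX : fderiv ℝ ψ x (fderiv ℝ X x u)
      = fderiv ℝ Y (ψ x) (fderiv ℝ ψ x u) - fderiv ℝ (fderiv ℝ ψ) x u (X x) := by
    have h1 : HasFDerivAt (fun y => Y (ψ y)) _ x := hY.hasFDerivAt.comp x hψ1
    have h2 := (hψ2.clm_apply hX.hasFDerivAt).congr_of_eventuallyEq hXY
    have := congrArg (fun L : E →L[ℝ] E => L u) (h1.unique h2)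
    simp at this
    rw [this]; abel
  have hd : ∀ a b c, fderiv ℝ (fun y => g y a b) x c
      = fderiv ℝ (fun y => inner ℝ (G (ψ y) (fderiv ℝ ψ y a)) (fderiv ℝ ψ y b)) x c := fun a b c => by
    rw [Filter.EventuallyEq.fderiv_eq (hg.mono fun y hy => hy a b)]
  simp only [leviCivitaForm]
  rw [hg.self_of_nhds, hXY.self_of_nhds, hd, hd, hd, fderiv_pullback_form hψ hG,
    fderiv_pullback_form hψ hG, fderiv_pullback_form hψ hG, hDX, map_sub,
    inner_sub_left, hB v u, hB (X x) u, hB v (X x),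
    hsymm (fderiv ℝ ψ x u) (fderiv ℝ (fderiv ℝ ψ) x (X x) v),
    hsymm (fderiv ℝ (fderiv ℝ ψ) x u v) (fderiv ℝ ψ x (X x))]
  ring

/-- A bound on the Levi-Civita form of a bounded field gives a bound on its derivative. -/
theorem norm_fderiv_le_of_leviCivitaForm {G : E → E →L[ℝ] E} {X : E → E} {x : E}
    {l L c : ℝ} (hl : 0 < l) (hc : 0 ≤ c) (hG : DifferentiableAt ℝ G x)
    (hGl : ∀ u, l * ‖u‖ ^ 2 ≤ inner ℝ (G x u) u) (hGL : ‖G x‖ ≤ L) (hDG : ‖fderiv ℝ G x‖ ≤ L)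
    (hX : ‖X x‖ ≤ c) {D : ℝ} (hD : 0 ≤ D)
    (h : ∀ u v, |leviCivitaForm (fun z a b => inner ℝ (G z a) b) X x u v| ≤ D * ‖u‖ * ‖v‖) :
    ‖fderiv ℝ X x‖ ≤ (D + 3 / 2 * L * c) / l := by
  have hL : 0 ≤ L := (norm_nonneg _).trans hGL
  refine ContinuousLinearMap.opNorm_le_bound _ (by positivity) fun u => ?_
  -- Testing the form with `v = DX u` produces `l ‖v‖²` on the left. Each of the three Christoffel
  -- terms is at most `L c ‖u‖ ‖v‖` and carries a factor `1 / 2`, whence `3 / 2 * L * c`.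
  set v := fderiv ℝ X x u with hv
  have hd : ∀ a b e, |fderiv ℝ (fun y => inner ℝ (G y a) b) x e| ≤ L * ‖e‖ * ‖a‖ * ‖b‖ := by
    intro a b e
    rw [hasFDerivAt_inner_clm hG.hasFDerivAt (hasFDerivAt_const a x) (hasFDerivAt_const b x)]
    simp only [zero_apply, map_zero, inner_zero_left, inner_zero_right, add_zero]
    refine (abs_real_inner_le_norm _ _).trans ?_
    gcongr
    refine (ContinuousLinearMap.le_opNorm₂ _ _ _).trans ?_
    gcongr
  have h1 := h u v
  have h2 := hd (X x) v u
  have h3 := hd u v (X x)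
  have h4 := hd u (X x) v
  have h5 := hGl v
  have e1 : L * ‖u‖ * ‖X x‖ * ‖v‖ ≤ L * c * ‖u‖ * ‖v‖ := by
    calc _ ≤ L * ‖u‖ * c * ‖v‖ := by gcongr
      _ = _ := by ring
  have e2 : L * ‖X x‖ * ‖u‖ * ‖v‖ ≤ L * c * ‖u‖ * ‖v‖ := by gcongr
  have e3 : L * ‖v‖ * ‖u‖ * ‖X x‖ ≤ L * c * ‖u‖ * ‖v‖ := by
    calc _ ≤ L * ‖v‖ * ‖u‖ * c := by gcongr
      _ = _ := by ring
  simp only [leviCivitaForm, ← hv] at h1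
  rw [abs_le] at h1 h2 h3 h4
  have key : l * ‖v‖ ^ 2 ≤ (D + 3 / 2 * L * c) * ‖u‖ * ‖v‖ := by
    nlinarith [h1.2, h2.1, h3.1, h4.2]
  rw [div_mul_eq_mul_div, le_div_iff₀ hl]
  rcases (norm_nonneg v).eq_or_lt with h0 | h0
  · rw [← h0, zero_mul]; positivity
  · refine le_of_mul_le_mul_right ?_ h0
    calc _ = l * ‖v‖ ^ 2 := by ring
      _ ≤ _ := key

end LeviCivita

/-! ### Vector fields and the metric in a chart -/

section Charts

variable {n : ℕ} {M : Type*} [TopologicalSpace M] [ChartedSpace (EuclideanSpace ℝ (Fin n)) M]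

theorem extChartAt_target_mem {p : M} {x : EuclideanSpace ℝ (Fin n)}
    (hx : x ∈ (extChartAt (𝓡 n) p).target) : (extChartAt (𝓡 n) p).target ∈ 𝓝 x :=
  (isOpen_extChartAt_target p).mem_nhds hx

/-! ### Derivatives of charts and trivializations of the tangent bundle. -/

section C1

variable [IsManifold (𝓡 n) 1 M]

theorem mfderiv_extChartAt_mfderiv_symm {p : M} {x : EuclideanSpace ℝ (Fin n)}
    (hx : x ∈ (extChartAt (𝓡 n) p).target) (v : EuclideanSpace ℝ (Fin n)) :
    mfderiv (𝓡 n) 𝓘(ℝ, EuclideanSpace ℝ (Fin n)) (extChartAt (𝓡 n) p) ((extChartAt (𝓡 n) p).symm x)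
      (mfderiv 𝓘(ℝ, EuclideanSpace ℝ (Fin n)) (𝓡 n) (extChartAt (𝓡 n) p).symm x v) = v := by
  have h := mfderiv_extChartAt_comp_mfderivWithin_extChartAt_symm hx
  rw [ModelWithCorners.range_eq_univ, mfderivWithin_univ] at h
  exact congrArg (fun L : EuclideanSpace ℝ (Fin n) →L[ℝ] EuclideanSpace ℝ (Fin n) => L v) h

theorem mfderiv_symm_mfderiv_extChartAt {p : M} {x : EuclideanSpace ℝ (Fin n)}
    (hx : x ∈ (extChartAt (𝓡 n) p).target)
    (v : TangentSpace (𝓡 n) ((extChartAt (𝓡 n) p).symm x)) :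
    mfderiv 𝓘(ℝ, EuclideanSpace ℝ (Fin n)) (𝓡 n) (extChartAt (𝓡 n) p).symm x
      (mfderiv (𝓡 n) 𝓘(ℝ, EuclideanSpace ℝ (Fin n)) (extChartAt (𝓡 n) p)
        ((extChartAt (𝓡 n) p).symm x) v) = v := by
  have h := mfderivWithin_extChartAt_symm_comp_mfderiv_extChartAt hx
  rw [ModelWithCorners.range_eq_univ, mfderivWithin_univ] at h
  exact congrArg (fun L : TangentSpace (𝓡 n) ((extChartAt (𝓡 n) p).symm x) →L[ℝ]
    TangentSpace (𝓡 n) ((extChartAt (𝓡 n) p).symm x) => L v) h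

/-- This identification transfers the regularity of sections of the tangent bundle to their
coordinate representations. -/
theorem mfderiv_extChartAt_eq_trivializationAt {p m : M}
    (hm : m ∈ (chartAt (EuclideanSpace ℝ (Fin n)) p).source) (v : TangentSpace (𝓡 n) m) :
    mfderiv (𝓡 n) 𝓘(ℝ, EuclideanSpace ℝ (Fin n)) (extChartAt (𝓡 n) p) m v
      = (trivializationAt (EuclideanSpace ℝ (Fin n)) (TangentSpace (𝓡 n)) p
        (⟨m, v⟩ : TangentBundle (𝓡 n) M)).2 := by
  have h1 : (trivializationAt (EuclideanSpace ℝ (Fin n)) (TangentSpace (𝓡 n)) p).continuousLinearMapAt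
      ℝ m v = (trivializationAt (EuclideanSpace ℝ (Fin n)) (TangentSpace (𝓡 n)) p
        (⟨m, v⟩ : TangentBundle (𝓡 n) M)).2 := by
    rw [Trivialization.continuousLinearMapAt_apply, Trivialization.linearMapAt_apply, if_pos]
    simpa using hm
  have h2 := TangentBundle.continuousLinearMapAt_trivializationAt (I := 𝓡 n) hm
  exact (congrArg (fun L : TangentSpace (𝓡 n) m →L[ℝ] EuclideanSpace ℝ (Fin n) => L v)
    h2).symm.trans h1

theorem symm_mem_chartAt_source {p : M} {x : EuclideanSpace ℝ (Fin n)}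
    (hx : x ∈ (extChartAt (𝓡 n) p).target) :
    (extChartAt (𝓡 n) p).symm x ∈ (chartAt (EuclideanSpace ℝ (Fin n)) p).source := by
  rw [← extChartAt_source (𝓡 n)]
  exact (extChartAt (𝓡 n) p).map_target hx

theorem coordField_eq_trivializationAt (X : (x : M) → TangentSpace (𝓡 n) x) {p : M}
    {x : EuclideanSpace ℝ (Fin n)} (hx : x ∈ (extChartAt (𝓡 n) p).target) :
    coordField X p x = (trivializationAt (EuclideanSpace ℝ (Fin n)) (TangentSpace (𝓡 n)) p
      (⟨(extChartAt (𝓡 n) p).symm x, X ((extChartAt (𝓡 n) p).symm x)⟩ :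
        TangentBundle (𝓡 n) M)).2 :=
  mfderiv_extChartAt_eq_trivializationAt (symm_mem_chartAt_source hx) _

theorem coordField_extChartAt (X : (x : M) → TangentSpace (𝓡 n) x) {p m : M}
    (hm : m ∈ (extChartAt (𝓡 n) p).source) :
    coordField X p (extChartAt (𝓡 n) p m)
      = mfderiv (𝓡 n) 𝓘(ℝ, EuclideanSpace ℝ (Fin n)) (extChartAt (𝓡 n) p) m (X m) := by
  rw [coordField, (extChartAt (𝓡 n) p).left_inv hm]

theorem continuousOn_coordField_prod {W : Type*} [TopologicalSpace W]
    {f : (x : M) → W → TangentSpace (𝓡 n) x}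
    (hf : Continuous (fun p : M × W => (⟨p.1, f p.1 p.2⟩ : TangentBundle (𝓡 n) M))) (p : M) :
    ContinuousOn (fun q : EuclideanSpace ℝ (Fin n) × W => coordField (fun x => f x q.2) p q.1)
      ((extChartAt (𝓡 n) p).target ×ˢ univ) := by
  have h1 : ContinuousOn (fun q : EuclideanSpace ℝ (Fin n) × W =>
      (⟨(extChartAt (𝓡 n) p).symm q.1, f ((extChartAt (𝓡 n) p).symm q.1) q.2⟩ :
        TangentBundle (𝓡 n) M)) ((extChartAt (𝓡 n) p).target ×ˢ univ) := by
    refine hf.comp_continuousOn (ContinuousOn.prodMk ?_ continuousOn_snd)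
    exact (continuousOn_extChartAt_symm p).comp continuousOn_fst fun q hq => hq.1
  set e := trivializationAt (EuclideanSpace ℝ (Fin n)) (TangentSpace (𝓡 n) : M → Type _) p
  have h2 := continuousOn_snd.comp (t := univ) (e.continuousOn.comp h1 fun q hq => ?_)
    (mapsTo_univ _ _)
  · refine h2.congr fun q hq => coordField_eq_trivializationAt _ hq.1
  · rw [e.mem_source]
    have := (extChartAt (𝓡 n) p).map_target hq.1
    rw [extChartAt_source] at this
    simpa [e] using this

/-- The tangent space at `p` is identified with the model space through the chart at `p` itself. -/
theorem mfderiv_extChartAt_apply_self {p : M} (v : TangentSpace (𝓡 n) p) :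
    mfderiv (𝓡 n) 𝓘(ℝ, EuclideanSpace ℝ (Fin n)) (extChartAt (𝓡 n) p) p v = v := by
  rw [mfderiv_extChartAt_self]; rfl

end C1

/-! ### Regularity of coordinate representations and changes of chart. -/

section C2

variable [IsManifold (𝓡 n) 2 M]

/-- On a `C²` manifold the tangent bundle is `C¹`, so composing a `C¹` section with a local
trivialization loses nothing. -/
theorem contDiffOn_coordField {X : (x : M) → TangentSpace (𝓡 n) x}
    (hX : ContMDiff (𝓡 n) (𝓡 n).tangent 1 (fun x => (⟨x, X x⟩ : TangentBundle (𝓡 n) M))) (p : M) :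
    ContDiffOn ℝ 1 (coordField X p) (extChartAt (𝓡 n) p).target := by
  have : IsManifold (𝓡 n) 1 M := IsManifold.of_le (n := 2) (by norm_num)
  have : IsManifold (𝓡 n) (1 + 1) M := by
    rw [one_add_one_eq_two]; infer_instance
  set e := trivializationAt (EuclideanSpace ℝ (Fin n)) (TangentSpace (𝓡 n) : M → Type _) p
  rw [← contMDiffOn_iff_contDiffOn]
  have h1 : ContMDiffOn 𝓘(ℝ, EuclideanSpace ℝ (Fin n)) (𝓡 n).tangent 1
      (fun x => (⟨(extChartAt (𝓡 n) p).symm x, X ((extChartAt (𝓡 n) p).symm x)⟩ :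
        TangentBundle (𝓡 n) M)) (extChartAt (𝓡 n) p).target :=
    hX.comp_contMDiffOn (contMDiffOn_extChartAt_symm p)
  have h2 := (Trivialization.contMDiffOn_iff (IB := 𝓡 n) (e := e) (n := 1) ?_).1 h1
  · exact h2.2.congr fun x hx => coordField_eq_trivializationAt _ hx
  · intro x hx
    rw [e.mem_source]
    have := (extChartAt (𝓡 n) p).map_target hx
    rw [extChartAt_source] at this
    simpa [e] using this

/-- A coordinate frame field is constant in the trivialization of its own chart. -/
theorem contMDiffOn_mfderiv_extChartAt_symm (p : M) (u : EuclideanSpace ℝ (Fin n)) :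
    ContMDiffOn 𝓘(ℝ, EuclideanSpace ℝ (Fin n)) (𝓡 n).tangent 1
      (fun x => (⟨(extChartAt (𝓡 n) p).symm x,
        mfderiv 𝓘(ℝ, EuclideanSpace ℝ (Fin n)) (𝓡 n) (extChartAt (𝓡 n) p).symm x u⟩ :
        TangentBundle (𝓡 n) M)) (extChartAt (𝓡 n) p).target := by
  have : IsManifold (𝓡 n) 1 M := IsManifold.of_le (n := 2) (by norm_num)
  have : IsManifold (𝓡 n) (1 + 1) M := by
    rw [one_add_one_eq_two]; infer_instance
  set e := trivializationAt (EuclideanSpace ℝ (Fin n)) (TangentSpace (𝓡 n) : M → Type _) p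
  refine (Trivialization.contMDiffOn_iff (IB := 𝓡 n) (e := e) (n := 1) ?_).2
    ⟨contMDiffOn_extChartAt_symm p, ?_⟩
  · intro x hx
    rw [e.mem_source]
    have := (extChartAt (𝓡 n) p).map_target hx
    rw [extChartAt_source] at this
    simpa [e] using this
  · refine contMDiffOn_const (c := u) |>.congr fun x hx => ?_
    exact (mfderiv_extChartAt_eq_trivializationAt (symm_mem_chartAt_source hx) _).symm.trans
      (mfderiv_extChartAt_mfderiv_symm hx u)

/-- The derivative of a coordinate change, in terms of the derivatives of the charts. -/
theorem fderiv_coordChange_apply {p q : M} {x : EuclideanSpace ℝ (Fin n)}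
    (hx : x ∈ (extChartAt (𝓡 n) q).target)
    (hp : (extChartAt (𝓡 n) q).symm x ∈ (extChartAt (𝓡 n) p).source)
    (u : EuclideanSpace ℝ (Fin n)) :
    fderiv ℝ (fun z => extChartAt (𝓡 n) p ((extChartAt (𝓡 n) q).symm z)) x u
      = mfderiv (𝓡 n) 𝓘(ℝ, EuclideanSpace ℝ (Fin n)) (extChartAt (𝓡 n) p)
          ((extChartAt (𝓡 n) q).symm x)
        (mfderiv 𝓘(ℝ, EuclideanSpace ℝ (Fin n)) (𝓡 n) (extChartAt (𝓡 n) q).symm x u) := by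
  have : IsManifold (𝓡 n) 1 M := IsManifold.of_le (n := 2) (by norm_num)
  have hg : MDifferentiableAt (𝓡 n) 𝓘(ℝ, EuclideanSpace ℝ (Fin n)) (extChartAt (𝓡 n) p)
      ((extChartAt (𝓡 n) q).symm x) :=
    mdifferentiableAt_extChartAt (by rwa [← extChartAt_source (𝓡 n)])
  have hf : MDifferentiableAt 𝓘(ℝ, EuclideanSpace ℝ (Fin n)) (𝓡 n) (extChartAt (𝓡 n) q).symm x :=
    (mdifferentiableOn_extChartAt_symm (I := 𝓡 n) x hx).mdifferentiableAt (extChartAt_target_mem hx)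
  have h := mfderiv_comp x hg hf
  rw [mfderiv_eq_fderiv] at h
  exact congrArg (fun L : EuclideanSpace ℝ (Fin n) →L[ℝ] EuclideanSpace ℝ (Fin n) => L u) h

theorem contDiffAt_coordChange {p q : M} {x : EuclideanSpace ℝ (Fin n)}
    (hx : x ∈ (extChartAt (𝓡 n) q).target)
    (hp : (extChartAt (𝓡 n) q).symm x ∈ (extChartAt (𝓡 n) p).source) :
    ContDiffAt ℝ 2 (fun z => extChartAt (𝓡 n) p ((extChartAt (𝓡 n) q).symm z)) x := by
  rw [← contMDiffAt_iff_contDiffAt]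
  refine ContMDiffAt.comp x (I' := 𝓡 n) ?_ ?_
  · exact contMDiffAt_extChartAt' (by rwa [← extChartAt_source (𝓡 n)])
  · exact (contMDiffOn_extChartAt_symm q).contMDiffAt (extChartAt_target_mem hx)

theorem fderiv_coordChange_coordField (X : (x : M) → TangentSpace (𝓡 n) x) {p q : M}
    {x : EuclideanSpace ℝ (Fin n)} (hx : x ∈ (extChartAt (𝓡 n) q).target)
    (hp : (extChartAt (𝓡 n) q).symm x ∈ (extChartAt (𝓡 n) p).source) :
    coordField X p (extChartAt (𝓡 n) p ((extChartAt (𝓡 n) q).symm x))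
      = fderiv ℝ (fun z => extChartAt (𝓡 n) p ((extChartAt (𝓡 n) q).symm z)) x
        (coordField X q x) := by
  have : IsManifold (𝓡 n) 1 M := IsManifold.of_le (n := 2) (by norm_num)
  rw [fderiv_coordChange_apply hx hp, coordField_extChartAt _ hp]
  exact (congrArg (mfderiv (𝓡 n) 𝓘(ℝ, EuclideanSpace ℝ (Fin n)) (extChartAt (𝓡 n) p)
    ((extChartAt (𝓡 n) q).symm x)) (mfderiv_symm_mfderiv_extChartAt hx _)).symm

/-! ### The Riemannian metric in coordinates. -/

section Metric

variable [RiemannianBundle (fun x : M => TangentSpace (𝓡 n) x)]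

theorem coordMetric_extChartAt {p m : M} (hm : m ∈ (extChartAt (𝓡 n) p).source)
    (v w : TangentSpace (𝓡 n) m) :
    coordMetric p (extChartAt (𝓡 n) p m)
      (mfderiv (𝓡 n) 𝓘(ℝ, EuclideanSpace ℝ (Fin n)) (extChartAt (𝓡 n) p) m v)
      (mfderiv (𝓡 n) 𝓘(ℝ, EuclideanSpace ℝ (Fin n)) (extChartAt (𝓡 n) p) m w) = inner ℝ v w := by
  have : IsManifold (𝓡 n) 1 M := IsManifold.of_le (n := 2) (by norm_num)
  obtain ⟨x, hx, rfl⟩ : ∃ x ∈ (extChartAt (𝓡 n) p).target, (extChartAt (𝓡 n) p).symm x = m :=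
    ⟨_, (extChartAt (𝓡 n) p).map_source hm, (extChartAt (𝓡 n) p).left_inv hm⟩
  rw [(extChartAt (𝓡 n) p).right_inv hx]
  exact congrArg₂ (inner ℝ) (mfderiv_symm_mfderiv_extChartAt hx v)
    (mfderiv_symm_mfderiv_extChartAt hx w)

theorem coordMetric_coordChange {p q : M}
    {x : EuclideanSpace ℝ (Fin n)} (hx : x ∈ (extChartAt (𝓡 n) q).target)
    (hp : (extChartAt (𝓡 n) q).symm x ∈ (extChartAt (𝓡 n) p).source)
    (u v : EuclideanSpace ℝ (Fin n)) :
    coordMetric q x u v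
      = coordMetric p (extChartAt (𝓡 n) p ((extChartAt (𝓡 n) q).symm x))
        (fderiv ℝ (fun z => extChartAt (𝓡 n) p ((extChartAt (𝓡 n) q).symm z)) x u)
        (fderiv ℝ (fun z => extChartAt (𝓡 n) p ((extChartAt (𝓡 n) q).symm z)) x v) := by
  rw [fderiv_coordChange_apply hx hp, fderiv_coordChange_apply hx hp]
  exact (coordMetric_extChartAt hp _ _).symm

theorem coordMetric_comm (p : M) (x u v : EuclideanSpace ℝ (Fin n)) :
    coordMetric p x u v = coordMetric p x v u := real_inner_comm _ _

theorem coordMetric_add_left (p : M) (x u u' v : EuclideanSpace ℝ (Fin n)) :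
    coordMetric p x (u + u') v = coordMetric p x u v + coordMetric p x u' v :=
  (congrArg (fun z => inner ℝ z (mfderiv 𝓘(ℝ, EuclideanSpace ℝ (Fin n)) (𝓡 n)
    (extChartAt (𝓡 n) p).symm x v : TangentSpace (𝓡 n) ((extChartAt (𝓡 n) p).symm x)))
    (ContinuousLinearMap.map_add _ u u')).trans (inner_add_left _ _ _)

theorem coordMetric_smul_left (p : M) (c : ℝ) (x u v : EuclideanSpace ℝ (Fin n)) :
    coordMetric p x (c • u) v = c * coordMetric p x u v :=
  (congrArg (fun z => inner ℝ z (mfderiv 𝓘(ℝ, EuclideanSpace ℝ (Fin n)) (𝓡 n)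
    (extChartAt (𝓡 n) p).symm x v : TangentSpace (𝓡 n) ((extChartAt (𝓡 n) p).symm x)))
    (ContinuousLinearMap.map_smul _ c u)).trans (real_inner_smul_left _ _ _)

/-- The Riemannian metric in a chart, as a bilinear form. -/
def coordMetricForm (p : M) (x : EuclideanSpace ℝ (Fin n)) :
    LinearMap.BilinForm ℝ (EuclideanSpace ℝ (Fin n)) :=
  LinearMap.mk₂ ℝ (coordMetric p x) (coordMetric_add_left p x)
    (fun c u v => coordMetric_smul_left p c x u v)
    (fun u v v' => by
      rw [coordMetric_comm, coordMetric_add_left, coordMetric_comm p x v, coordMetric_comm p x v'])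
    (fun c u v => by
      rw [coordMetric_comm, coordMetric_smul_left, coordMetric_comm, smul_eq_mul])

/-- The Riemannian metric in a chart, as a field of operators. -/
def metricOperator (p : M) (x : EuclideanSpace ℝ (Fin n)) :
    EuclideanSpace ℝ (Fin n) →L[ℝ] EuclideanSpace ℝ (Fin n) :=
  LinearMap.toContinuousLinearMap
    (∑ i, ((coordMetricForm p x).flip (EuclideanSpace.basisFun (Fin n) ℝ i)).smulRight
      (EuclideanSpace.basisFun (Fin n) ℝ i))

theorem metricOperator_apply (p : M) (x u : EuclideanSpace ℝ (Fin n)) :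
    metricOperator p x u = ∑ i, coordMetric p x u (EuclideanSpace.basisFun (Fin n) ℝ i) •
      EuclideanSpace.basisFun (Fin n) ℝ i := by
  simp only [metricOperator, LinearMap.coe_toContinuousLinearMap', LinearMap.sum_apply,
    LinearMap.smulRight_apply]
  rfl

theorem inner_metricOperator (p : M) (x u v : EuclideanSpace ℝ (Fin n)) :
    inner ℝ (metricOperator p x u) v = coordMetric p x u v := by
  have h : coordMetric p x u v = coordMetricForm p x u v := rfl
  rw [h]
  conv_rhs => rw [← (EuclideanSpace.basisFun (Fin n) ℝ).sum_repr v]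
  rw [metricOperator_apply, sum_inner, map_sum]
  refine Finset.sum_congr rfl fun i _ => ?_
  rw [map_smul, real_inner_smul_left, smul_eq_mul, mul_comm]
  congr 1
  simp [EuclideanSpace.inner_single_left]

theorem coordMetric_self_nonneg (p : M) (x u : EuclideanSpace ℝ (Fin n)) :
    0 ≤ coordMetric p x u u := real_inner_self_nonneg

theorem coordMetric_self_pos {p : M} {x : EuclideanSpace ℝ (Fin n)}
    (hx : x ∈ (extChartAt (𝓡 n) p).target) {u : EuclideanSpace ℝ (Fin n)} (hu : u ≠ 0) :
    0 < coordMetric p x u u := by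
  have : IsManifold (𝓡 n) 1 M := IsManifold.of_le (n := 2) (by norm_num)
  refine lt_of_le_of_ne (coordMetric_self_nonneg p x u) fun h => hu ?_
  have h0 : mfderiv 𝓘(ℝ, EuclideanSpace ℝ (Fin n)) (𝓡 n) (extChartAt (𝓡 n) p).symm x u = 0 :=
    inner_self_eq_zero.1 h.symm
  refine (mfderiv_extChartAt_mfderiv_symm hx u).symm.trans ?_
  exact (congrArg _ h0).trans (ContinuousLinearMap.map_zero _)

variable [IsContMDiffRiemannianBundle (𝓡 n) 1 (EuclideanSpace ℝ (Fin n))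
  (fun x : M => TangentSpace (𝓡 n) x)]

/-- The matrix entries are inner products of `C¹` coordinate frame fields for a `C¹` metric. -/
theorem contDiffOn_metricOperator (p : M) :
    ContDiffOn ℝ 1 (metricOperator (n := n) p) (extChartAt (𝓡 n) p).target := by
  rw [contDiffOn_clm_apply]
  intro u
  simp only [metricOperator_apply]
  refine ContDiffOn.sum fun i _ => ?_
  have h : ContDiffOn ℝ 1 (fun x => coordMetric p x u (EuclideanSpace.basisFun (Fin n) ℝ i))
      (extChartAt (𝓡 n) p).target := by
    rw [← contMDiffOn_iff_contDiffOn]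
    exact ContMDiffOn.inner_bundle (contMDiffOn_mfderiv_extChartAt_symm p u)
      (contMDiffOn_mfderiv_extChartAt_symm p _)
  exact h.smul contDiffOn_const

/-- `covDerivForm` is computed at `q` in the chart centred at `q`, a chart that moves with the
point. Estimates on a neighbourhood need one fixed chart, and covariance under the coordinate change
provides it. -/
theorem covDerivForm_eq_leviCivitaForm {X : (x : M) → TangentSpace (𝓡 n) x}
    (hX : ContMDiff (𝓡 n) (𝓡 n).tangent 1 (fun x => (⟨x, X x⟩ : TangentBundle (𝓡 n) M)))
    {p q : M} (hq : q ∈ (extChartAt (𝓡 n) p).source) (u v : EuclideanSpace ℝ (Fin n)) :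
    covDerivForm X q u v
      = leviCivitaForm (fun z a b => inner ℝ (metricOperator p z a) b) (coordField X p)
        (extChartAt (𝓡 n) p q)
        (fderiv ℝ (fun z => extChartAt (𝓡 n) p ((extChartAt (𝓡 n) q).symm z))
          (extChartAt (𝓡 n) q q) u)
        (fderiv ℝ (fun z => extChartAt (𝓡 n) p ((extChartAt (𝓡 n) q).symm z))
          (extChartAt (𝓡 n) q q) v) := by
  have hxq : extChartAt (𝓡 n) q q ∈ (extChartAt (𝓡 n) q).target := mem_extChartAt_target q
  have hqq : (extChartAt (𝓡 n) q).symm (extChartAt (𝓡 n) q q) = q := extChartAt_to_inv q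
  have hev : ∀ᶠ x in 𝓝 (extChartAt (𝓡 n) q q), x ∈ (extChartAt (𝓡 n) q).target ∧
      (extChartAt (𝓡 n) q).symm x ∈ (extChartAt (𝓡 n) p).source := by
    refine (Filter.eventually_of_mem (extChartAt_target_mem hxq) fun x hx => hx).and ?_
    have hc := (continuousOn_extChartAt_symm (I := 𝓡 n) q).continuousAt (extChartAt_target_mem hxq)
    refine hc.eventually ?_
    rw [hqq]
    exact (isOpen_extChartAt_source p).mem_nhds hq
  have hpq : extChartAt (𝓡 n) p ((extChartAt (𝓡 n) q).symm (extChartAt (𝓡 n) q q))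
      = extChartAt (𝓡 n) p q := by rw [hqq]
  have hpt := (extChartAt (𝓡 n) p).map_source hq
  have h := leviCivitaForm_pullback (G := metricOperator p) (g := coordMetric q)
    (X := coordField X q) (Y := coordField X p)
    (contDiffAt_coordChange (p := p) hxq (by rwa [hqq])) ?_ ?_ ?_ ?_ ?_ ?_ u v
  · rw [hpq] at h
    exact h
  · rw [hpq]
    exact ((contDiffOn_metricOperator p).contDiffAt (extChartAt_target_mem hpt)).differentiableAt
      one_ne_zero
  · intro u v
    rw [inner_metricOperator, inner_metricOperator, coordMetric_comm]
  · filter_upwards [hev] with x hx u v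
    rw [inner_metricOperator, coordMetric_coordChange hx.1 hx.2]
  · exact ((contDiffOn_coordField hX q).contDiffAt (extChartAt_target_mem hxq)).differentiableAt
      one_ne_zero
  · rw [hpq]
    exact ((contDiffOn_coordField hX p).contDiffAt (extChartAt_target_mem hpt)).differentiableAt
      one_ne_zero
  · filter_upwards [hev] with x hx
    exact fderiv_coordChange_coordField X hx.1 hx.2

/-- In a chart, a bound on the metric and its derivatives near the base point. -/
theorem exists_metric_bound (p : M) : ∃ R > 0, ∃ l > 0, ∃ L > 0,
    Metric.closedBall (extChartAt (𝓡 n) p p) R ⊆ (extChartAt (𝓡 n) p).target ∧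
    ∀ x ∈ Metric.closedBall (extChartAt (𝓡 n) p p) R,
      (∀ u, l * ‖u‖ ^ 2 ≤ inner ℝ (metricOperator p x u) u) ∧ ‖metricOperator p x‖ ≤ L ∧
        ‖fderiv ℝ (metricOperator (n := n) p) x‖ ≤ L := by
  set x₀ := extChartAt (𝓡 n) p p with hx₀
  have hx₀t : x₀ ∈ (extChartAt (𝓡 n) p).target := mem_extChartAt_target p
  have hC := contDiffOn_metricOperator (n := n) p
  have hC0 := hC.contDiffAt (extChartAt_target_mem hx₀t)
  -- `l` is the minimum of the positive definite form on the unit sphere; in dimension zero the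
  -- sphere is empty and any constant will do.
  obtain ⟨l, hl, hlu⟩ : ∃ l > 0, ∀ u, l * ‖u‖ ^ 2 ≤ inner ℝ (metricOperator p x₀ u) u := by
    have hcont : ContinuousOn (fun u => inner ℝ (metricOperator p x₀ u) u)
        (Metric.sphere (0 : EuclideanSpace ℝ (Fin n)) 1) := by fun_prop
    rcases (Metric.sphere (0 : EuclideanSpace ℝ (Fin n)) 1).eq_empty_or_nonempty with he | hne
    · refine ⟨1, one_pos, fun u => ?_⟩
      by_cases hu : u = 0
      · simp [hu]
      · exfalso
        have : ‖u‖⁻¹ • u ∈ Metric.sphere (0 : EuclideanSpace ℝ (Fin n)) 1 := by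
          simp [norm_smul, hu]
        rw [he] at this
        exact this
    · obtain ⟨w, hw, hmin⟩ := (isCompact_sphere _ _).exists_isMinOn hne hcont
      have hw0 : w ≠ 0 := by
        rintro rfl
        simp at hw
      refine ⟨_, (inner_metricOperator p x₀ w w).symm ▸ coordMetric_self_pos hx₀t hw0, fun u => ?_⟩
      by_cases hu : u = 0
      · simp [hu]
      · have hun : ‖u‖ ≠ 0 := norm_ne_zero_iff.2 hu
        have hus : ‖u‖⁻¹ • u ∈ Metric.sphere (0 : EuclideanSpace ℝ (Fin n)) 1 := by
          simp [norm_smul, hu]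
        have h1 := isMinOn_iff.1 hmin _ hus
        rw [map_smul, real_inner_smul_left, real_inner_smul_right] at h1
        have h2 := mul_le_mul_of_nonneg_right h1 (sq_nonneg ‖u‖)
        refine h2.trans (le_of_eq ?_)
        field_simp
  have hcont : ContinuousAt (metricOperator (n := n) p) x₀ := hC0.continuousAt
  -- A `C¹` map is locally Lipschitz, and the Lipschitz constant bounds the derivative nearby.
  obtain ⟨K, t, ht, hK⟩ := hC0.exists_lipschitzOnWith
  have e1 : ∀ᶠ x in 𝓝 x₀, ‖metricOperator p x - metricOperator p x₀‖ < l / 2 := by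
    have := Metric.continuousAt_iff'.1 hcont (l / 2) (by positivity)
    simpa [dist_eq_norm] using this
  have e2 : ∀ᶠ x in 𝓝 x₀, ‖metricOperator p x‖ < ‖metricOperator p x₀‖ + 1 :=
    hcont.norm.eventually (gt_mem_nhds (lt_add_one _))
  have e3 : ∀ᶠ x in 𝓝 x₀, ‖fderiv ℝ (metricOperator (n := n) p) x‖ ≤ K := by
    filter_upwards [eventually_mem_nhds_iff.2 ht] with x hx
    exact norm_fderiv_le_of_lipschitzOn ℝ hx hK
  obtain ⟨R, hR, hRs⟩ := Metric.nhds_basis_closedBall.mem_iff.1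
    ((e1.and (e2.and e3)).and (extChartAt_target_mem hx₀t))
  refine ⟨R, hR, l / 2, by positivity,
    max (‖metricOperator p x₀‖ + 1) K,
    lt_max_of_lt_left (by positivity), fun x hx => (hRs hx).2, fun x hx => ⟨fun u => ?_, ?_, ?_⟩⟩
  · have h1 := hlu u
    have h2 : |inner ℝ ((metricOperator p x - metricOperator p x₀) u) u| ≤ l / 2 * ‖u‖ ^ 2 := by
      refine (abs_real_inner_le_norm _ _).trans ?_
      rw [pow_two, ← mul_assoc]
      gcongr
      refine (ContinuousLinearMap.le_opNorm _ _).trans ?_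
      gcongr
      exact (hRs hx).1.1.le
    rw [sub_apply, inner_sub_left, abs_le] at h2
    linarith [h2.1]
  · exact (hRs hx).1.2.1.le.trans (le_max_left _ _)
  · exact (hRs hx).1.2.2.trans (le_max_right _ _)

/-- In a chart, the coordinates of a vector field and of its derivative are controlled by the
Riemannian norms of the field and of its covariant derivative. -/
theorem exists_coordField_bound (p : M) : ∃ R > 0, ∃ K > 0,
    Metric.closedBall (extChartAt (𝓡 n) p p) R ⊆ (extChartAt (𝓡 n) p).target ∧
    ∀ (X : (x : M) → TangentSpace (𝓡 n) x) (c : ℝ),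
      ContMDiff (𝓡 n) (𝓡 n).tangent 1 (fun x => (⟨x, X x⟩ : TangentBundle (𝓡 n) M)) →
      (∀ x, ‖X x‖ ≤ c) → (∀ x, CovDerivNormLE X x c) →
      ∀ x ∈ Metric.closedBall (extChartAt (𝓡 n) p p) R,
        ‖coordField X p x‖ ≤ K * c ∧ ‖fderiv ℝ (coordField X p) x‖ ≤ K * c := by
  have : IsManifold (𝓡 n) 1 M := IsManifold.of_le (n := 2) (by norm_num)
  obtain ⟨R, hR, l, hl, L, hL, hsub, hB⟩ := exists_metric_bound (n := n) p
  -- From `l ‖X‖² ≤ g(X, X) ≤ c²` the coordinates of the field are at most `A c`.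
  set A : ℝ := (√l)⁻¹ with hA
  have hA0 : 0 < A := by positivity
  refine ⟨R, hR, A + (L + 3 / 2 * L * A) / l, by positivity, hsub, fun X c hX hXc hDX x hx => ?_⟩
  obtain ⟨hBl, hBL, hBD⟩ := hB x hx
  have hc : 0 ≤ c := (norm_nonneg _).trans (hXc p)
  have hxt := hsub hx
  set q := (extChartAt (𝓡 n) p).symm x with hq
  have hqs : q ∈ (extChartAt (𝓡 n) p).source := (extChartAt (𝓡 n) p).map_target hxt
  have hqx : extChartAt (𝓡 n) p q = x := (extChartAt (𝓡 n) p).right_inv hxt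
  have h1 : ‖coordField X p x‖ ≤ A * c := by
    have h2 := hBl (coordField X p x)
    rw [inner_metricOperator] at h2
    have h3 : coordMetric p x (coordField X p x) (coordField X p x) = ‖X q‖ ^ 2 := by
      have := coordMetric_extChartAt hqs (X q) (X q)
      rw [hqx, ← real_inner_self_eq_norm_sq] at *
      exact this
    rw [h3] at h2
    have h4 : l * ‖coordField X p x‖ ^ 2 ≤ c ^ 2 :=
      h2.trans (pow_le_pow_left₀ (norm_nonneg _) (hXc q) 2)
    have h5 : √l * ‖coordField X p x‖ ≤ c := by
      refine abs_le_of_sq_le_sq' ?_ hc |>.2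
      rw [mul_pow, Real.sq_sqrt hl.le]
      exact h4
    rw [hA, ← div_eq_inv_mul, le_div_iff₀ (by positivity)]
    linarith
  have hG : DifferentiableAt ℝ (metricOperator (n := n) p) x :=
    ((contDiffOn_metricOperator p).contDiffAt (extChartAt_target_mem hxt)).differentiableAt
      one_ne_zero
  have h2 : ‖fderiv ℝ (coordField X p) x‖ ≤ (L * c + 3 / 2 * L * (A * c)) / l := by
    refine norm_fderiv_le_of_leviCivitaForm hl (by positivity) hG hBl hBL hBD h1 (by positivity) ?_
    intro u v
    have hxq : extChartAt (𝓡 n) q q ∈ (extChartAt (𝓡 n) q).target := mem_extChartAt_target q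
    have hqq : (extChartAt (𝓡 n) q).symm (extChartAt (𝓡 n) q q) = q := extChartAt_to_inv q
    -- The two coordinate changes are inverse to each other near `x`, so every coordinate vector in
    -- the fixed chart comes from the chart centred at `q`.
    have hsurj : ∀ u, ∃ u', fderiv ℝ (fun z => extChartAt (𝓡 n) p ((extChartAt (𝓡 n) q).symm z))
          (extChartAt (𝓡 n) q q) u' = u := by
      intro u
      have hψ' := (contDiffAt_coordChange (n := n) (p := q) (q := p) hxt
        (mem_extChartAt_source q)).differentiableAt (by simp)
      have hψ := (contDiffAt_coordChange (n := n) (p := p) (q := q) hxq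
        (by rwa [hqq])).differentiableAt (by simp)
      have hcomp : HasFDerivAt (fun z => extChartAt (𝓡 n) p ((extChartAt (𝓡 n) q).symm
          (extChartAt (𝓡 n) q ((extChartAt (𝓡 n) p).symm z)))) _ x :=
        HasFDerivAt.comp (g := fun z => extChartAt (𝓡 n) p ((extChartAt (𝓡 n) q).symm z))
          (f := fun z => extChartAt (𝓡 n) q ((extChartAt (𝓡 n) p).symm z)) x
          hψ.hasFDerivAt hψ'.hasFDerivAt
      have hid : (fun z => extChartAt (𝓡 n) p ((extChartAt (𝓡 n) q).symm
          (extChartAt (𝓡 n) q ((extChartAt (𝓡 n) p).symm z)))) =ᶠ[𝓝 x] id := by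
        have hc := (continuousOn_extChartAt_symm (I := 𝓡 n) p).continuousAt
          (extChartAt_target_mem hxt)
        filter_upwards [extChartAt_target_mem hxt,
          hc.eventually ((isOpen_extChartAt_source (I := 𝓡 n) q).mem_nhds
            (mem_extChartAt_source (I := 𝓡 n) q))]
          with z hz hzq
        rw [(extChartAt (𝓡 n) q).left_inv hzq, (extChartAt (𝓡 n) p).right_inv hz, id]
      have h := hcomp.unique ((hasFDerivAt_id x).congr_of_eventuallyEq hid)
      exact ⟨_, congrArg (fun A : EuclideanSpace ℝ (Fin n) →L[ℝ] EuclideanSpace ℝ (Fin n) => A u) h⟩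
    have hnorm : ∀ u u', fderiv ℝ (fun z => extChartAt (𝓡 n) p ((extChartAt (𝓡 n) q).symm z))
          (extChartAt (𝓡 n) q q) u' = u →
          √(coordMetric q (extChartAt (𝓡 n) q q) u' u') ≤ √L * ‖u‖ := by
      rintro u u' rfl
      rw [coordMetric_coordChange hxq (by rwa [hqq])]
      rw [show extChartAt (𝓡 n) p ((extChartAt (𝓡 n) q).symm (extChartAt (𝓡 n) q q)) = x by
        rw [hqq, hqx]]
      rw [← inner_metricOperator]
      refine Real.sqrt_le_iff.2 ⟨by positivity, ?_⟩
      rw [mul_pow, Real.sq_sqrt hL.le]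
      refine (real_inner_le_norm _ _).trans ?_
      rw [pow_two, ← mul_assoc]
      gcongr
      refine (ContinuousLinearMap.le_opNorm _ _).trans ?_
      gcongr
    obtain ⟨u', hu'⟩ := hsurj u
    obtain ⟨v', hv'⟩ := hsurj v
    have h6 := hDX q u' v'
    rw [covDerivForm_eq_leviCivitaForm hX hqs, hu', hv', hqx] at h6
    refine h6.trans ?_
    have h7 := hnorm u u' hu'
    have h8 := hnorm v v' hv'
    calc _ ≤ c * (√L * ‖u‖) * (√L * ‖v‖) := by gcongr
      _ = (√L * √L) * c * ‖u‖ * ‖v‖ := by ring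
      _ = _ := by rw [Real.mul_self_sqrt hL.le]
  have e1 : 0 ≤ (L + 3 / 2 * L * A) / l * c := by positivity
  have e2 : 0 ≤ A * c := by positivity
  constructor
  · rw [add_mul]; linarith
  · refine h2.trans ?_
    rw [add_mul]
    have : (L * c + 3 / 2 * L * (A * c)) / l = (L + 3 / 2 * L * A) / l * c := by ring
    linarith

end Metric

end C2

end Charts

/-! ### Absolutely continuous functions and primitives -/

section Primitive

/-- An additive property of intervals that holds locally holds on the whole interval. -/
theorem Icc_additive_induction {P : ℝ → ℝ → Prop} {a b : ℝ} (hab : a ≤ b)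
    (hadd : ∀ c d e, a ≤ c → c ≤ d → d ≤ e → e ≤ b → P c d → P d e → P c e)
    (hloc : ∀ s ∈ Icc a b, ∃ r > 0, ∀ c d, c ≤ d → c ∈ Icc a b → d ∈ Icc a b →
      |c - s| < r → |d - s| < r → P c d) : P a b := by
  choose! r hr hP using hloc
  let c : Icc a b → Set (Icc a b) := fun s => {τ | |(τ : ℝ) - s| < r s}
  have hc : ∀ i, IsOpen (c i) := fun i =>
    isOpen_lt (continuous_abs.comp (continuous_subtype_val.sub continuous_const)) continuous_const
  -- By compactness a finite subdivision has each of its steps inside one of the neighbourhoods of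
  -- `hloc`.
  obtain ⟨τ, h0, hmono, ⟨m, hm⟩, hcov⟩ := exists_monotone_Icc_subset_open_cover_Icc hab hc
    (fun s _ => mem_iUnion.2 ⟨s, by simp [c, hr s s.2]⟩)
  have hstep : ∀ k, P (τ k) (τ (k + 1)) := fun k => by
    obtain ⟨i, hi⟩ := hcov k
    exact hP i i.2 _ _ (hmono k.le_succ) (τ k).2 (τ (k + 1)).2
      (hi ⟨le_rfl, hmono k.le_succ⟩) (hi ⟨hmono k.le_succ, le_rfl⟩)
  have hall : ∀ k, P (τ 0) (τ (k + 1)) := fun k => by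
    induction k with
    | zero => exact hstep 0
    | succ k ih =>
      exact hadd _ _ _ (τ 0).2.1 (hmono (Nat.zero_le _)) (hmono (Nat.le_succ _)) (τ _).2.2 ih
        (hstep _)
  have := hall m
  rwa [h0, hm (m + 1) (Nat.le_succ m)] at this

/-- Serves both to change charts, which are locally Lipschitz related, and to compare a function
with the primitive of a norm. -/
theorem AbsolutelyContinuousOnInterval.of_dist_le {X Y : Type*} [PseudoMetricSpace X]
    [PseudoMetricSpace Y] {f : ℝ → X} {g : ℝ → Y} {a b K : ℝ}
    (hg : AbsolutelyContinuousOnInterval g a b)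
    (h : ∀ x ∈ uIcc a b, ∀ y ∈ uIcc a b, dist (f x) (f y) ≤ K * dist (g x) (g y)) :
    AbsolutelyContinuousOnInterval f a b := by
  have h1 := Tendsto.const_mul K hg
  rw [mul_zero] at h1
  refine squeeze_zero' (Eventually.of_forall fun E => Finset.sum_nonneg fun _ _ => dist_nonneg)
    ?_ h1
  filter_upwards [mem_inf_of_right (mem_principal_self _)] with E hE
  rw [Finset.mul_sum]
  exact Finset.sum_le_sum fun i hi => h _ (hE.1 i hi).1 _ (hE.1 i hi).2

variable {E : Type*} [NormedAddCommGroup E] [NormedSpace ℝ E] {a b c : ℝ} {u g : ℝ → E}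

/-- `u` is a primitive of `g` on `[a, b]`, in the sense of Lebesgue. -/
structure IsPrimitiveOn (u g : ℝ → E) (a b : ℝ) : Prop where
  integrable : IntegrableOn g (Icc a b)
  eq : ∀ s ∈ Icc a b, u s = u a + ∫ τ in a..s, g τ

namespace IsPrimitiveOn

theorem intervalIntegrable (h : IsPrimitiveOn u g a b) {c d : ℝ} (hc : c ∈ Icc a b)
    (hd : d ∈ Icc a b) : IntervalIntegrable g volume c d :=
  IntegrableOn.intervalIntegrable_of_mem h.integrable hc hd

theorem sub_eq (h : IsPrimitiveOn u g a b) {c d : ℝ} (hc : c ∈ Icc a b) (hd : d ∈ Icc a b) :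
    u d - u c = ∫ τ in c..d, g τ := by
  have ha : a ∈ Icc a b := ⟨le_rfl, hc.1.trans hc.2⟩
  rw [h.eq d hd, h.eq c hc,
    ← intervalIntegral.integral_add_adjacent_intervals (h.intervalIntegrable ha hc)
    (h.intervalIntegrable hc hd)]
  abel

theorem trans (h : IsPrimitiveOn u g a b) (h' : IsPrimitiveOn u g b c) (hab : a ≤ b)
    (hbc : b ≤ c) : IsPrimitiveOn u g a c := by
  have hi : IntegrableOn g (Icc a c) := by
    rw [← Icc_union_Icc_eq_Icc hab hbc]; exact h.integrable.union h'.integrable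
  refine ⟨hi, fun s hs => ?_⟩
  rcases le_total s b with hsb | hsb
  · exact h.eq s ⟨hs.1, hsb⟩
  · rw [← intervalIntegral.integral_add_adjacent_intervals
      (h.intervalIntegrable ⟨le_rfl, hab⟩ ⟨hab, le_rfl⟩)
      (h'.intervalIntegrable ⟨le_rfl, hbc⟩ ⟨hsb, hs.2⟩), ← add_assoc, ← h.eq b ⟨hab, le_rfl⟩]
    exact h'.eq s ⟨hsb, hs.2⟩

theorem absolutelyContinuousOnInterval (h : IsPrimitiveOn u g a b) (hab : a ≤ b) :
    AbsolutelyContinuousOnInterval u a b := by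
  have hn := h.intervalIntegrable (left_mem_Icc.2 hab) (right_mem_Icc.2 hab)
  have h1 := hn.norm.absolutelyContinuousOnInterval_intervalIntegral (c := a) left_mem_uIcc
  refine h1.of_dist_le (K := 1) fun x hx y hy => ?_
  rw [uIcc_of_le hab] at hx hy
  have ha : a ∈ Icc a b := left_mem_Icc.2 hab
  rw [one_mul, dist_comm, dist_eq_norm, h.sub_eq hx hy, dist_comm, Real.dist_eq,
    intervalIntegral.integral_interval_sub_left (h.intervalIntegrable ha hy).norm
      (h.intervalIntegrable ha hx).norm]
  exact intervalIntegral.norm_integral_le_abs_integral_norm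

theorem continuousOn (h : IsPrimitiveOn u g a b) : ContinuousOn u (Icc a b) := by
  rcases le_or_gt a b with hab | hab
  · have := (h.absolutelyContinuousOnInterval hab).continuousOn
    rwa [uIcc_of_le hab] at this
  · rw [Icc_eq_empty hab.not_ge]; exact continuousOn_empty _

theorem congr (h : IsPrimitiveOn u g a b) {v g' : ℝ → E} (hv : EqOn v u (Icc a b))
    (hg : ∀ᵐ s ∂(volume.restrict (Icc a b)), g' s = g s) : IsPrimitiveOn v g' a b := by
  refine ⟨h.integrable.congr (hg.mono fun s hs => hs.symm), fun s hs => ?_⟩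
  rw [hv hs, hv ⟨le_rfl, hs.1.trans hs.2⟩, h.eq s hs]
  congr 1
  refine intervalIntegral.integral_congr_ae ?_
  rw [ae_restrict_iff' measurableSet_Icc] at hg
  filter_upwards [hg] with τ hτ h1
  rw [uIoc_of_le hs.1] at h1
  exact (hτ ⟨h1.1.le, h1.2.trans hs.2⟩).symm

theorem ae_hasDerivAt [CompleteSpace E] (h : IsPrimitiveOn u g a b) (hab : a ≤ b) :
    ∀ᵐ s ∂(volume.restrict (Icc a b)), HasDerivAt u (g s) s := by
  have h1 := (h.intervalIntegrable (left_mem_Icc.2 hab)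
    (right_mem_Icc.2 hab)).ae_hasDerivAt_integral
  rw [ae_restrict_iff' measurableSet_Icc, ← uIcc_of_le hab]
  have h2 : ∀ᵐ s : ℝ, s ≠ a := by simp [ae_iff]
  have h3 : ∀ᵐ s : ℝ, s ≠ b := by simp [ae_iff]
  filter_upwards [h1, h2, h3] with s hs hsa hsb hm
  have h4 := (hs hm a left_mem_uIcc).const_add (u a)
  refine h4.congr_of_eventuallyEq ?_
  rw [uIcc_of_le hab] at hm
  filter_upwards [Icc_mem_nhds (lt_of_le_of_ne hm.1 hsa.symm) (lt_of_le_of_ne hm.2 hsb)] with τ hτ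
  exact h.eq τ hτ

/-- The scalar fundamental theorem of calculus applied to each coordinate; the integrability of `g`
is part of the conclusion. -/
theorem of_absolutelyContinuous {ι : Type*} [Fintype ι] {u g : ℝ → EuclideanSpace ℝ ι}
    (hab : a ≤ b) (hu : AbsolutelyContinuousOnInterval u a b)
    (hd : ∀ᵐ s ∂(volume.restrict (Icc a b)), HasDerivAt u (g s) s) : IsPrimitiveOn u g a b := by
  have hi : ∀ i, AbsolutelyContinuousOnInterval (fun s => u s i) a b := fun i =>
    hu.of_dist_le (K := 1) fun x _ y _ => by
      rw [one_mul, dist_eq_norm, dist_eq_norm]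
      exact PiLp.norm_apply_le (u x - u y) i
  have hdi : ∀ i, ∀ᵐ s ∂(volume.restrict (Icc a b)), deriv (fun s => u s i) s = g s i := fun i => by
    filter_upwards [hd] with s hs
    exact ((EuclideanSpace.proj (𝕜 := ℝ) i).hasFDerivAt.comp_hasDerivAt s hs).deriv
  have hgi : ∀ i, IntegrableOn (fun s => g s i) (Icc a b) := fun i => by
    have h1 := (hi i).intervalIntegrable_deriv
    rw [intervalIntegrable_iff_integrableOn_Icc_of_le hab] at h1
    exact h1.congr (hdi i)
  have hg : IntegrableOn g (Icc a b) := Integrable.of_eval_piLp hgi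
  refine ⟨hg, fun s hs => ?_⟩
  rw [← sub_eq_iff_eq_add']
  ext i
  have h2 := ((hi i).mono (c := a) (d := s) (by
    rw [uIcc_of_le hab, uIcc_of_le hs.1]; exact Icc_subset_Icc_right hs.2)).integral_deriv_eq_sub
  rw [intervalIntegral.integral_of_le hs.1, eval_integral_piLp
    (fun i => (hgi i).mono_set (Ioc_subset_Icc_self.trans (Icc_subset_Icc_right hs.2)))]
  rw [intervalIntegral.integral_of_le hs.1] at h2
  have h3 : u s i - u a i = (u s - u a) i := rfl
  rw [← h3, ← h2]
  refine integral_congr_ae ?_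
  exact ae_restrict_of_ae_restrict_of_subset
    (Ioc_subset_Icc_self.trans (Icc_subset_Icc_right hs.2)) (hdi i)

end IsPrimitiveOn

end Primitive

/-! ### Solutions in charts -/

section Solutions

variable {n : ℕ} {M : Type*} [TopologicalSpace M] [ChartedSpace (EuclideanSpace ℝ (Fin n)) M]
  {X X' : ℝ → (x : M) → TangentSpace (𝓡 n) x} {a b c : ℝ} {y z : ℝ → M} {p : M}

theorem IsAbsContCurve.mono (h : IsAbsContCurve n a b y) {c d : ℝ} (hc : a ≤ c) (hd : d ≤ b)
    (hcd : c ≤ d) : IsAbsContCurve n c d y := by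
  refine ⟨h.1.mono (Icc_subset_Icc hc hd), fun s hs => ?_⟩
  obtain ⟨r, hr, h1⟩ := h.2 s (Icc_subset_Icc hc hd hs)
  refine ⟨r, hr, h1.mono ?_⟩
  have h2 : max c (s - r) ≤ min d (s + r) := by
    simp only [le_min_iff, max_le_iff]; exact ⟨⟨hcd, by linarith [hs.2]⟩, by linarith [hs.1], by linarith⟩
  have h3 : max a (s - r) ≤ max c (s - r) := max_le_max hc le_rfl
  have h4 : min d (s + r) ≤ min b (s + r) := min_le_min hd le_rfl
  rw [uIcc_of_le h2, uIcc_of_le (h3.trans (h2.trans h4))]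
  exact Icc_subset_Icc h3 h4

theorem IsSolution.mono (h : IsSolution X a b y) {c d : ℝ} (hc : a ≤ c) (hd : d ≤ b)
    (hcd : c ≤ d) : IsSolution X c d y :=
  ⟨h.1.mono hc hd hcd, ae_restrict_of_ae_restrict_of_subset (Icc_subset_Icc hc hd) h.2⟩

theorem IsSolution.continuousOn (h : IsSolution X a b y) : ContinuousOn y (Icc a b) := h.1.1

/-- Only the values of the field along the curve matter. -/
theorem IsSolution.congr_field (h : IsSolution X a b y)
    (hX : ∀ᵐ s ∂(volume.restrict (Icc a b)), X' s (y s) = X s (y s)) : IsSolution X' a b y := by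
  refine ⟨h.1, ?_⟩
  filter_upwards [h.2, hX] with s hs h1
  rw [h1]; exact hs

variable [IsManifold (𝓡 n) 2 M]

/-- A change of chart is `C¹`, hence locally Lipschitz; this carries absolute continuity from one
chart to another. -/
theorem exists_dist_extChartAt_le {p q m : M} (hp : m ∈ (extChartAt (𝓡 n) p).source)
    (hq : m ∈ (extChartAt (𝓡 n) q).source) :
    ∃ K : ℝ, ∃ t ∈ 𝓝 m, t ⊆ (extChartAt (𝓡 n) q).source ∧ ∀ x ∈ t, ∀ y ∈ t,
      dist (extChartAt (𝓡 n) p x) (extChartAt (𝓡 n) p y)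
        ≤ K * dist (extChartAt (𝓡 n) q x) (extChartAt (𝓡 n) q y) := by
  have h1 := contDiffAt_coordChange (n := n) (p := p) (q := q) (x := extChartAt (𝓡 n) q m)
    ((extChartAt (𝓡 n) q).map_source hq) (by rwa [(extChartAt (𝓡 n) q).left_inv hq])
  obtain ⟨K, t, ht, hK⟩ := (h1.of_le (m := 1) (by norm_num)).exists_lipschitzOnWith
  refine ⟨K, extChartAt (𝓡 n) q ⁻¹' t ∩ (extChartAt (𝓡 n) q).source,
    inter_mem ((continuousAt_extChartAt' hq).preimage_mem_nhds ht)
      ((isOpen_extChartAt_source q).mem_nhds hq), inter_subset_right, fun x hx y hy => ?_⟩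
  have := hK.dist_le_mul _ hx.1 _ hy.1
  rwa [(extChartAt (𝓡 n) q).left_inv hx.2, (extChartAt (𝓡 n) q).left_inv hy.2] at this

theorem HasMFDerivAt.hasDerivAt_extChartAt {s : ℝ} {v : TangentSpace (𝓡 n) (y s)}
    (h : HasMFDerivAt 𝓘(ℝ, ℝ) (𝓡 n) y s ((1 : ℝ →L[ℝ] ℝ).smulRight v))
    (hp : y s ∈ (extChartAt (𝓡 n) p).source) :
    HasDerivAt (fun s => extChartAt (𝓡 n) p (y s))
      (mfderiv (𝓡 n) 𝓘(ℝ, EuclideanSpace ℝ (Fin n)) (extChartAt (𝓡 n) p) (y s) v) s := by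
  have : IsManifold (𝓡 n) 1 M := IsManifold.of_le (n := 2) (by norm_num)
  have hg : MDifferentiableAt (𝓡 n) 𝓘(ℝ, EuclideanSpace ℝ (Fin n)) (extChartAt (𝓡 n) p) (y s) :=
    mdifferentiableAt_extChartAt (by rwa [← extChartAt_source (𝓡 n)])
  obtain ⟨A, hA⟩ : ∃ A : EuclideanSpace ℝ (Fin n) →L[ℝ] EuclideanSpace ℝ (Fin n),
    A = mfderiv (𝓡 n) 𝓘(ℝ, EuclideanSpace ℝ (Fin n)) (extChartAt (𝓡 n) p) (y s) := ⟨_, rfl⟩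
  obtain ⟨v', hv⟩ : ∃ v' : EuclideanSpace ℝ (Fin n), v' = v := ⟨_, rfl⟩
  have h1 : HasFDerivAt (fun s => extChartAt (𝓡 n) p (y s))
      (A.comp ((1 : ℝ →L[ℝ] ℝ).smulRight v')) s := by
    subst hA hv
    exact (hg.hasMFDerivAt.comp s h).hasFDerivAt
  have h2 : HasDerivAt (fun s => extChartAt (𝓡 n) p (y s)) (A v') s := by
    simpa using h1.hasDerivAt
  subst hA hv
  exact h2

/-- A solution satisfies an integral equation in every chart. -/
theorem IsSolution.isPrimitiveOn (h : IsSolution X a b y) (hab : a ≤ b)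
    (hm : MapsTo y (Icc a b) (extChartAt (𝓡 n) p).source) :
    IsPrimitiveOn (fun s => extChartAt (𝓡 n) p (y s))
      (fun s => coordField (X s) p (extChartAt (𝓡 n) p (y s))) a b := by
  have : IsManifold (𝓡 n) 1 M := IsManifold.of_le (n := 2) (by norm_num)
  -- Absolute continuity is given near each instant in the chart centred at the current point. It is
  -- moved locally to the chart at `p`, and the integral identities are then added up.
  refine Icc_additive_induction (P := fun c d => IsPrimitiveOn (fun s => extChartAt (𝓡 n) p (y s))
      (fun s => coordField (X s) p (extChartAt (𝓡 n) p (y s))) c d) hab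
    (fun c d e _ hcd hde _ h1 h2 => h1.trans h2 hcd hde) fun s hs => ?_
  obtain ⟨r, hr, hac⟩ := h.1.2 s hs
  obtain ⟨K, t, ht, -, hK⟩ := exists_dist_extChartAt_le (hm hs) (mem_extChartAt_source (I := 𝓡 n) (y s))
  obtain ⟨r', hr', ht'⟩ := Metric.mem_nhdsWithin_iff.1 (h.continuousOn s hs ht)
  refine ⟨min r r', lt_min hr hr', fun c d hcd hc hd hcs hds => ?_⟩
  have hcs' := abs_lt.1 (lt_min_iff.1 hcs).1
  have hds' := abs_lt.1 (lt_min_iff.1 hds).1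
  have hsub : ∀ τ ∈ Icc c d, y τ ∈ t := fun τ hτ => by
    refine ht' ⟨?_, hc.1.trans hτ.1, hτ.2.trans hd.2⟩
    rw [Metric.mem_ball, Real.dist_eq]
    have h3 := abs_lt.1 (lt_min_iff.1 hcs).2
    have h4 := abs_lt.1 (lt_min_iff.1 hds).2
    exact abs_lt.2 ⟨by linarith [hτ.1], by linarith [hτ.2]⟩
  refine IsPrimitiveOn.of_absolutelyContinuous hcd ?_ ?_
  · have h5 : max a (s - r) ≤ c := max_le hc.1 (by linarith)
    have h6 : d ≤ min b (s + r) := le_min hd.2 (by linarith)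
    refine (hac.mono (c := c) (d := d) ?_).of_dist_le (K := K) fun x hx x' hx' => ?_
    · rw [uIcc_of_le hcd, uIcc_of_le (h5.trans (hcd.trans h6))]
      exact Icc_subset_Icc h5 h6
    · rw [uIcc_of_le hcd] at hx hx'
      exact hK _ (hsub x hx) _ (hsub x' hx')
  · have hsub' : Icc c d ⊆ Icc a b := Icc_subset_Icc hc.1 hd.2
    filter_upwards [ae_restrict_of_ae_restrict_of_subset hsub' h.2,
      ae_restrict_mem measurableSet_Icc] with τ hτ hτm
    rw [coordField_extChartAt _ (hm (hsub' hτm))]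
    exact hτ.hasDerivAt_extChartAt (hm (hsub' hτm))

/-- A continuous curve that satisfies the integral equation in a chart is a solution. -/
theorem IsPrimitiveOn.isSolution (hab : a ≤ b) (hc : ContinuousOn y (Icc a b))
    (hm : MapsTo y (Icc a b) (extChartAt (𝓡 n) p).source)
    (h : IsPrimitiveOn (fun s => extChartAt (𝓡 n) p (y s))
      (fun s => coordField (X s) p (extChartAt (𝓡 n) p (y s))) a b) : IsSolution X a b y := by
  have : IsManifold (𝓡 n) 1 M := IsManifold.of_le (n := 2) (by norm_num)
  refine ⟨⟨hc, fun s hs => ?_⟩, ?_⟩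
  · obtain ⟨K, t, ht, -, hK⟩ := exists_dist_extChartAt_le (mem_extChartAt_source (I := 𝓡 n) (y s)) (hm hs)
    obtain ⟨r', hr', ht'⟩ := Metric.mem_nhdsWithin_iff.1 (hc s hs ht)
    refine ⟨r' / 2, half_pos hr', ?_⟩
    have hle : max a (s - r' / 2) ≤ min b (s + r' / 2) := by
      simp only [le_min_iff, max_le_iff]
      exact ⟨⟨hab, by linarith [hs.2]⟩, by linarith [hs.1], by linarith⟩
    have hsub : ∀ τ ∈ uIcc (max a (s - r' / 2)) (min b (s + r' / 2)), y τ ∈ t := fun τ hτ => by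
      rw [uIcc_of_le hle, mem_Icc, max_le_iff, le_min_iff] at hτ
      refine ht' ⟨?_, hτ.1.1, hτ.2.1⟩
      rw [Metric.mem_ball, Real.dist_eq]
      exact abs_lt.2 ⟨by linarith [hτ.1.2], by linarith [hτ.2.2]⟩
    refine ((h.absolutelyContinuousOnInterval hab).mono ?_).of_dist_le (K := K)
      fun x hx x' hx' => hK _ (hsub x hx) _ (hsub x' hx')
    rw [uIcc_of_le hle, uIcc_of_le hab]
    exact Icc_subset_Icc (le_max_left _ _) (min_le_left _ _)
  · have h2 : ∀ᵐ s ∂(volume.restrict (Icc a b)), s ≠ a :=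
      ae_restrict_of_ae (by simp [ae_iff])
    have h3 : ∀ᵐ s ∂(volume.restrict (Icc a b)), s ≠ b :=
      ae_restrict_of_ae (by simp [ae_iff])
    filter_upwards [h.ae_hasDerivAt hab, h2, h3, ae_restrict_mem measurableSet_Icc]
      with s hs hsa hsb hsm
    have hx : extChartAt (𝓡 n) p (y s) ∈ (extChartAt (𝓡 n) p).target :=
      (extChartAt (𝓡 n) p).map_source (hm hsm)
    have hd : MDifferentiableAt 𝓘(ℝ, EuclideanSpace ℝ (Fin n)) (𝓡 n) (extChartAt (𝓡 n) p).symm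
        (extChartAt (𝓡 n) p (y s)) :=
      (mdifferentiableOn_extChartAt_symm (I := 𝓡 n) _ hx).mdifferentiableAt
        (extChartAt_target_mem hx)
    have h4 := hd.hasMFDerivAt.comp s hs.hasFDerivAt.hasMFDerivAt
    have hev : y =ᶠ[𝓝 s] (extChartAt (𝓡 n) p).symm ∘ fun s => extChartAt (𝓡 n) p (y s) := by
      filter_upwards [Icc_mem_nhds (lt_of_le_of_ne hsm.1 hsa.symm)
        (lt_of_le_of_ne hsm.2 hsb)] with τ hτ
      exact ((extChartAt (𝓡 n) p).left_inv (hm hτ)).symm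
    have h5 := h4.congr_of_eventuallyEq hev
    have h6 : (mfderiv 𝓘(ℝ, EuclideanSpace ℝ (Fin n)) (𝓡 n) (extChartAt (𝓡 n) p).symm
        (extChartAt (𝓡 n) p (y s)) : EuclideanSpace ℝ (Fin n) →L[ℝ] EuclideanSpace ℝ (Fin n))
        (coordField (X s) p (extChartAt (𝓡 n) p (y s))) =
        (X s (y s) : EuclideanSpace ℝ (Fin n)) := by
      have h7 := mfderiv_symm_mfderiv_extChartAt hx
        (X s ((extChartAt (𝓡 n) p).symm (extChartAt (𝓡 n) p (y s))))
      refine h7.trans ?_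
      rw [(extChartAt (𝓡 n) p).left_inv (hm hsm)]
    refine h5.congr_mfderiv ?_
    refine ContinuousLinearMap.ext fun (r : ℝ) => ?_
    refine Eq.trans ?_ (congrArg (fun v : EuclideanSpace ℝ (Fin n) => r • v) h6)
    exact (mfderiv 𝓘(ℝ, EuclideanSpace ℝ (Fin n)) (𝓡 n) (extChartAt (𝓡 n) p).symm
        (extChartAt (𝓡 n) p (y s)) : EuclideanSpace ℝ (Fin n) →L[ℝ] EuclideanSpace ℝ (Fin n)).map_smul
        r _

/-- The curves agree on `[a, b]` only, so two-sided derivatives are transferred away from the two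
end points, a null set. -/
theorem IsSolution.congr (h : IsSolution X a b y) (hz : EqOn z y (Icc a b)) :
    IsSolution X a b z := by
  refine ⟨⟨h.continuousOn.congr hz, fun s hs => ?_⟩, ?_⟩
  · obtain ⟨r, hr, hac⟩ := h.1.2 s hs
    refine ⟨r, hr, hac.of_dist_le (K := 1) fun x hx x' hx' => ?_⟩
    have hle : max a (s - r) ≤ min b (s + r) := by
      simp only [le_min_iff, max_le_iff]
      exact ⟨⟨hs.1.trans hs.2, by linarith [hs.2]⟩, by linarith [hs.1], by linarith⟩
    have hsub : uIcc (max a (s - r)) (min b (s + r)) ⊆ Icc a b := by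
      rw [uIcc_of_le hle]; exact Icc_subset_Icc (le_max_left _ _) (min_le_left _ _)
    rw [hz hs, hz (hsub hx), hz (hsub hx'), one_mul]
  · have h2 : ∀ᵐ s ∂(volume.restrict (Icc a b)), s ≠ a :=
      ae_restrict_of_ae (by simp [ae_iff])
    have h3 : ∀ᵐ s ∂(volume.restrict (Icc a b)), s ≠ b :=
      ae_restrict_of_ae (by simp [ae_iff])
    filter_upwards [h.2, h2, h3, ae_restrict_mem measurableSet_Icc] with s hs hsa hsb hsm
    have hev : z =ᶠ[𝓝 s] y := by
      filter_upwards [Icc_mem_nhds (lt_of_le_of_ne hsm.1 hsa.symm)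
        (lt_of_le_of_ne hsm.2 hsb)] with τ hτ using hz hτ
    have h4 := hs.congr_of_eventuallyEq hev
    rw [← hz hsm] at h4
    exact h4

/-- Solutions on adjacent intervals can be glued. -/
theorem IsSolution.trans (h : IsSolution X a b y) (h' : IsSolution X b c y) (hab : a ≤ b)
    (hbc : b ≤ c) : IsSolution X a c y := by
  have hU : Icc a b ∪ Icc b c = Icc a c := Icc_union_Icc_eq_Icc hab hbc
  have hcont : ContinuousOn y (Icc a c) := by
    rw [← hU]; exact h.continuousOn.union_of_isClosed h'.continuousOn isClosed_Icc isClosed_Icc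
  refine ⟨⟨hcont, fun s hs => ?_⟩, ?_⟩
  · rcases lt_trichotomy s b with hsb | hsb | hsb
    · obtain ⟨r, hr, hac⟩ := h.1.2 s ⟨hs.1, hsb.le⟩
      refine ⟨min r (b - s), lt_min hr (by linarith), hac.mono ?_⟩
      have h1 : min r (b - s) ≤ r := min_le_left _ _
      have h2 : min r (b - s) ≤ b - s := min_le_right _ _
      have h3 : 0 < min r (b - s) := lt_min hr (by linarith)
      have h4 : max a (s - min r (b - s)) ≤ min c (s + min r (b - s)) := by
        simp only [le_min_iff, max_le_iff]
        exact ⟨⟨hab.trans hbc, by linarith [hs.2]⟩, by linarith [hs.1], by linarith⟩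
      have h5 : max a (s - r) ≤ max a (s - min r (b - s)) := max_le_max le_rfl (by linarith)
      have h6 : min c (s + min r (b - s)) ≤ min b (s + r) :=
        le_min ((min_le_right _ _).trans (by linarith)) ((min_le_right _ _).trans (by linarith))
      rw [uIcc_of_le h4, uIcc_of_le (h5.trans (h4.trans h6))]
      exact Icc_subset_Icc h5 h6
    -- At the junction the two integral equations in the chart at `y b` are concatenated; their sum
    -- gives absolute continuity across it.
    · subst hsb
      have hn := hcont s hs ((isOpen_extChartAt_source (I := 𝓡 n) (y s)).mem_nhds
        (mem_extChartAt_source (I := 𝓡 n) (y s)))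
      obtain ⟨r, hr, ht⟩ := Metric.mem_nhdsWithin_iff.1 hn
      refine ⟨r / 2, half_pos hr, ?_⟩
      have h1 : max a (s - r / 2) ≤ s := max_le hab (by linarith)
      have h2 : s ≤ min c (s + r / 2) := le_min hbc (by linarith)
      have hm : ∀ τ ∈ Icc (max a (s - r / 2)) (min c (s + r / 2)),
          y τ ∈ (extChartAt (𝓡 n) (y s)).source := fun τ hτ => by
        rw [mem_Icc, max_le_iff, le_min_iff] at hτ
        refine ht ⟨?_, hτ.1.1, hτ.2.1⟩
        rw [Metric.mem_ball, Real.dist_eq]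
        exact abs_lt.2 ⟨by linarith [hτ.1.2], by linarith [hτ.2.2]⟩
      exact (((h.mono (le_max_left _ _) le_rfl h1).isPrimitiveOn h1
        fun τ hτ => hm τ ⟨hτ.1, hτ.2.trans h2⟩).trans
        ((h'.mono le_rfl (min_le_left _ _) h2).isPrimitiveOn h2
        fun τ hτ => hm τ ⟨h1.trans hτ.1, hτ.2⟩) h1 h2).absolutelyContinuousOnInterval (h1.trans h2)
    · obtain ⟨r, hr, hac⟩ := h'.1.2 s ⟨hsb.le, hs.2⟩
      refine ⟨min r (s - b), lt_min hr (by linarith), hac.mono ?_⟩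
      have h1 : min r (s - b) ≤ r := min_le_left _ _
      have h2 : min r (s - b) ≤ s - b := min_le_right _ _
      have h3 : 0 < min r (s - b) := lt_min hr (by linarith)
      have h4 : max a (s - min r (s - b)) ≤ min c (s + min r (s - b)) := by
        simp only [le_min_iff, max_le_iff]
        exact ⟨⟨hab.trans hbc, by linarith [hs.2]⟩, by linarith [hs.1], by linarith⟩
      have h5 : max b (s - r) ≤ max a (s - min r (s - b)) :=
        max_le ((by linarith : b ≤ _).trans (le_max_right _ _))
          ((by linarith : s - r ≤ _).trans (le_max_right _ _))
      have h6 : min c (s + min r (s - b)) ≤ min c (s + r) := min_le_min le_rfl (by linarith)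
      rw [uIcc_of_le h4, uIcc_of_le (h5.trans (h4.trans h6))]
      exact Icc_subset_Icc h5 h6
  · rw [← hU]
    exact ae_restrict_union_iff (μ := volume) _ _ _ |>.2 ⟨h.2, h'.2⟩

end Solutions

/-! ### Uniqueness and differentiability of the flow -/

section Flow

/-- Continuity of the primitive of `k` provides intervals that are short enough for the contraction
argument. -/
theorem exists_integral_Icc_le {k : ℝ → ℝ} {a b : ℝ} (hk : IntegrableOn k (Icc a b)) {s₀ ε : ℝ}
    (hs₀ : s₀ ∈ Icc a b) (hε : 0 < ε) : ∃ r > 0, ∀ c d, c ≤ d → c ∈ Icc a b → d ∈ Icc a b →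
      |c - s₀| < r → |d - s₀| < r → ∫ s in Icc c d, k s ≤ ε := by
  have hab : a ≤ b := hs₀.1.trans hs₀.2
  have hi : IntervalIntegrable k volume a b := (intervalIntegrable_iff_integrableOn_Icc_of_le hab).2 hk
  have hcont : ContinuousOn (fun x => ∫ t in a..x, k t) (Icc a b) := by
    have := intervalIntegral.continuousOn_primitive_interval' (a := a) hi left_mem_uIcc
    rwa [uIcc_of_le hab] at this
  obtain ⟨r, hr, h⟩ := Metric.continuousOn_iff.1 hcont s₀ hs₀ (ε / 2) (half_pos hε)
  refine ⟨r, hr, fun c d hcd hc hd hcs hds => ?_⟩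
  have h1 := abs_lt.1 (h c hc hcs)
  have h2 := abs_lt.1 (h d hd hds)
  have ha : a ∈ Icc a b := left_mem_Icc.2 hab
  have h3 := intervalIntegral.integral_interval_sub_left
    (IntegrableOn.intervalIntegrable_of_mem hk ha hd)
    (IntegrableOn.intervalIntegrable_of_mem hk ha hc)
  rw [intervalIntegral.integral_of_le hcd, ← integral_Icc_eq_integral_Ioc] at h3
  rw [← h3]
  linarith [h1.1, h2.2]

variable {n : ℕ} {M : Type*} [TopologicalSpace M] [ChartedSpace (EuclideanSpace ℝ (Fin n)) M]
  [IsManifold (𝓡 n) 2 M]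

/-- Time-dependent vector fields that are `C¹` at each time and satisfy the Carathéodory
conditions, with Lipschitz bounds, in charts. -/
structure IsRegularField (X : ℝ → (x : M) → TangentSpace (𝓡 n) x) (a b : ℝ) : Prop where
  contMDiff : ∀ s ∈ Icc a b,
    ContMDiff (𝓡 n) (𝓡 n).tangent 1 (fun x => (⟨x, X s x⟩ : TangentBundle (𝓡 n) M))
  isCaratheodoryField : ∀ p : M, ∃ R > 0, ∃ k : ℝ → ℝ,
    Metric.closedBall (extChartAt (𝓡 n) p p) R ⊆ (extChartAt (𝓡 n) p).target ∧
    IsCaratheodoryField (fun s z => coordField (X s) p (ballRetract (extChartAt (𝓡 n) p p) R z)) k a b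

variable {X : ℝ → (x : M) → TangentSpace (𝓡 n) x} {a b c : ℝ} {y z : ℝ → M} {p : M}

namespace IsRegularField

theorem mono (hX : IsRegularField X a b) {c d : ℝ} (hc : a ≤ c) (hd : d ≤ b) :
    IsRegularField X c d := by
  refine ⟨fun s hs => hX.contMDiff s (Icc_subset_Icc hc hd hs), fun p => ?_⟩
  obtain ⟨R, hR, k, h1, h2⟩ := hX.isCaratheodoryField p
  exact ⟨R, hR, k, h1, h2.mono (Icc_subset_Icc hc hd)⟩

end IsRegularField

/-- A curve of the manifold that starts in a chart ball stays there for a short time. -/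
theorem ContinuousOn.exists_extChartAt_mem_ball (hy : ContinuousOn y (Icc a b)) {s₀ : ℝ}
    (hs₀ : s₀ ∈ Icc a b) (hp : y s₀ = p) {R : ℝ} (hR : 0 < R) :
    ∃ r > 0, ∀ s ∈ Icc a b, |s - s₀| < r → y s ∈ (extChartAt (𝓡 n) p).source ∧
      ‖extChartAt (𝓡 n) p (y s) - extChartAt (𝓡 n) p p‖ < R := by
  subst hp
  have hn : (extChartAt (𝓡 n) (y s₀)).source ∩
      extChartAt (𝓡 n) (y s₀) ⁻¹' Metric.ball (extChartAt (𝓡 n) (y s₀) (y s₀)) R ∈ 𝓝 (y s₀) :=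
    inter_mem (extChartAt_source_mem_nhds (I := 𝓡 n) (y s₀))
      ((continuousAt_extChartAt (I := 𝓡 n) (y s₀)).preimage_mem_nhds (Metric.ball_mem_nhds _ hR))
  obtain ⟨r, hr, ht⟩ := Metric.mem_nhdsWithin_iff.1 (hy s₀ hs₀ hn)
  refine ⟨r, hr, fun s hs hsr => ?_⟩
  have := ht ⟨by rwa [Metric.mem_ball, Real.dist_eq], hs⟩
  exact ⟨this.1, by simpa [dist_eq_norm] using this.2⟩

/-- The coincidence set is closed because the manifold is Hausdorff. Local uniqueness in the chart
at the current point extends it to the right of each of its points. -/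
theorem IsSolution.eqOn [T2Space M] (hX : IsRegularField X a b) (hy : IsSolution X a b y)
    (hz : IsSolution X a b z) (h : y a = z a) : EqOn y z (Icc a b) := by
  rcases lt_or_ge b a with hba | hab
  · rw [Icc_eq_empty hba.not_ge]; exact fun _ h => h.elim
  have hcl : IsClosed ({s | y s = z s} ∩ Icc a b) := by
    have h1 := (hy.continuousOn.prodMk hz.continuousOn).preimage_isClosed_of_isClosed
      isClosed_Icc (isClosed_diagonal (X := M))
    rw [inter_comm]
    exact h1
  refine hcl.Icc_subset_of_forall_mem_nhdsWithin h fun s₀ hs₀ => ?_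
  have hs₀' : s₀ ∈ Icc a b := Ico_subset_Icc_self hs₀.2
  obtain ⟨R, hR, k, hRt, hk⟩ := hX.isCaratheodoryField (y s₀)
  obtain ⟨r₁, hr₁, h1⟩ := exists_integral_Icc_le hk.integrable hs₀' (half_pos one_pos)
  obtain ⟨r₂, hr₂, h2⟩ := hy.continuousOn.exists_extChartAt_mem_ball (n := n) hs₀' rfl hR
  obtain ⟨r₃, hr₃, h3⟩ := hz.continuousOn.exists_extChartAt_mem_ball (n := n) hs₀' hs₀.1.symm hR
  set r := min (min r₁ (min r₂ r₃)) (b - s₀)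
  have hr : 0 < r := lt_min (lt_min hr₁ (lt_min hr₂ hr₃)) (by linarith [hs₀.2.2])
  have hr1 : r ≤ r₁ := (min_le_left _ _).trans (min_le_left _ _)
  have hr2 : r ≤ r₂ := (min_le_left _ _).trans ((min_le_right _ _).trans (min_le_left _ _))
  have hr3 : r ≤ r₃ := (min_le_left _ _).trans ((min_le_right _ _).trans (min_le_right _ _))
  have hrb : r ≤ b - s₀ := min_le_right _ _
  have hd : s₀ ≤ s₀ + r / 2 := by linarith
  have hdb : s₀ + r / 2 ≤ b := by linarith
  have hsub : Icc s₀ (s₀ + r / 2) ⊆ Icc a b := Icc_subset_Icc hs₀'.1 hdb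
  have habs : ∀ s ∈ Icc s₀ (s₀ + r / 2), |s - s₀| < r := fun s hs => by
    rw [abs_of_nonneg (by linarith [hs.1])]; linarith [hs.2]
  have hk' := hk.mono hsub
  obtain ⟨Φ, -, hΦ, -⟩ := hk'.exists_flow hd
    (h1 _ _ hd hs₀' (hsub (right_mem_Icc.2 hd)) (by simpa using hr₁)
      ((habs _ (right_mem_Icc.2 hd)).trans_le hr1))
  have key : ∀ u : ℝ → M, IsSolution X a b u → u s₀ = y s₀ →
      (∀ s ∈ Icc a b, |s - s₀| < r → u s ∈ (extChartAt (𝓡 n) (y s₀)).source ∧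
      ‖extChartAt (𝓡 n) (y s₀) (u s) - extChartAt (𝓡 n) (y s₀) (y s₀)‖ < R) →
      EqOn (fun s => extChartAt (𝓡 n) (y s₀) (u s)) (Φ (extChartAt (𝓡 n) (y s₀) (y s₀)))
        (Icc s₀ (s₀ + r / 2)) := fun u hu hu0 hur => by
    have h4 := (hu.mono hs₀'.1 hdb hd).isPrimitiveOn (p := y s₀) hd
      (fun s hs => (hur s (hsub hs) (habs s hs)).1)
    have h5 := hΦ _ h4.continuousOn (fun s hs => by
      rw [h4.eq s hs]
      congr 1
      refine intervalIntegral.integral_congr fun τ hτ => ?_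
      rw [uIcc_of_le hs.1] at hτ
      have hτ' : τ ∈ Icc s₀ (s₀ + r / 2) := ⟨hτ.1, hτ.2.trans hs.2⟩
      rw [ballRetract_of_mem hR (hur τ (hsub hτ') (habs τ hτ')).2.le])
    simpa only [hu0] using h5
  have hy' := key y hy rfl fun s hs hr => h2 s hs (hr.trans_le hr2)
  have hz' := key z hz hs₀.1.symm fun s hs hr => h3 s hs (hr.trans_le hr3)
  filter_upwards [Icc_mem_nhdsGT (by linarith : s₀ < s₀ + r / 2)] with s hs
  exact (extChartAt (𝓡 n) (y s₀)).injOn (h2 s (hsub hs) ((habs s hs).trans_le hr2)).1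
    (h3 s (hsub hs) ((habs s hs).trans_le hr3)).1 ((hy' hs).trans (hz' hs).symm)

/-- Uniqueness makes the arbitrary choice in the definition of the flow irrelevant. -/
theorem flowMap_eq [T2Space M] (hX : IsRegularField X a b) (hab : a ≤ b)
    (hy : IsSolution X a b y) : flowMap X a b (y a) = y b := by
  have h : ∃ z : ℝ → M, IsSolution X a b z ∧ z a = y a := ⟨y, hy, rfl⟩
  rw [flowMap, dif_pos h]
  exact h.choose_spec.1.eqOn hX hy h.choose_spec.2 (right_mem_Icc.2 hab)

/-- The flow is defined near `y a`, and differentiable there. -/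
def IsFlowDifferentiable (X : ℝ → (x : M) → TangentSpace (𝓡 n) x) (y : ℝ → M) (a b : ℝ) : Prop :=
  (∀ᶠ x in 𝓝 (y a), ∃ z : ℝ → M, IsSolution X a b z ∧ z a = x) ∧
    MDifferentiableAt (𝓡 n) (𝓡 n) (flowMap X a b) (y a)

/-- Nearby solutions on the two intervals are glued at `b`, so near `y a` the flow is the
composition of two differentiable flows. -/
theorem isFlowDifferentiable_trans [T2Space M] (hX : IsRegularField X a c)
    (hy : IsSolution X a c y) (hab : a ≤ b) (hbc : b ≤ c) (h : IsFlowDifferentiable X y a b)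
    (h' : IsFlowDifferentiable X y b c) : IsFlowDifferentiable X y a c := by
  have hXab := hX.mono le_rfl hbc
  have hXbc := hX.mono hab le_rfl
  have hyb : flowMap X a b (y a) = y b := flowMap_eq hXab hab (hy.mono le_rfl hbc hab)
  have hcont : Tendsto (flowMap X a b) (𝓝 (y a)) (𝓝 (y b)) := by
    have := h.2.continuousAt.tendsto; rwa [hyb] at this
  have hev : ∀ᶠ x in 𝓝 (y a), ∃ z : ℝ → M, IsSolution X a c z ∧ z a = x ∧
      z c = flowMap X b c (flowMap X a b x) := by
    filter_upwards [h.1, hcont.eventually h'.1] with x ⟨z₁, h1, hx1⟩ ⟨z₂, h2, hx2⟩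
    have hm : z₂ b = z₁ b := by rw [hx2, ← hx1, flowMap_eq hXab hab h1]
    have e1 : EqOn (fun s => if s ≤ b then z₁ s else z₂ s) z₁ (Icc a b) := fun s hs => if_pos hs.2
    have e2 : EqOn (fun s => if s ≤ b then z₁ s else z₂ s) z₂ (Icc b c) := fun s hs => by
      simp only
      split_ifs with h
      · rw [le_antisymm h hs.1, hm]
      · rfl
    refine ⟨fun s => if s ≤ b then z₁ s else z₂ s, (h1.congr e1).trans (h2.congr e2) hab hbc,
      (e1 (left_mem_Icc.2 hab)).trans hx1, ?_⟩
    rw [e2 (right_mem_Icc.2 hbc), ← flowMap_eq hXbc hbc h2, hx2]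
  refine ⟨hev.mono fun x ⟨z, h1, h2, _⟩ => ⟨z, h1, h2⟩, ?_⟩
  have h3 : MDifferentiableAt (𝓡 n) (𝓡 n) (flowMap X b c ∘ flowMap X a b) (y a) :=
    MDifferentiableAt.comp (y a) (by rw [hyb]; exact h'.2) h.2
  refine h3.congr_of_eventuallyEq ?_
  filter_upwards [hev] with x ⟨z, h1, h2, h4⟩
  rw [← h2, flowMap_eq hX (hab.trans hbc) h1, h4, h2]
  rfl

/-- On a short interval everything takes place inside one chart ball, where the flow is the one of
`exists_flow`. -/
theorem exists_isFlowDifferentiable_of_abs_lt [T2Space M] (hX : IsRegularField X a b)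
    (hy : IsSolution X a b y) {s₀ : ℝ} (hs₀ : s₀ ∈ Icc a b) :
    ∃ r > 0, ∀ c d, c ≤ d → c ∈ Icc a b → d ∈ Icc a b →
      |c - s₀| < r → |d - s₀| < r → IsFlowDifferentiable X y c d := by
  have : IsManifold (𝓡 n) 1 M := IsManifold.of_le (n := 2) (by norm_num)
  obtain ⟨p, hp⟩ : ∃ p, y s₀ = p := ⟨_, rfl⟩
  obtain ⟨R, hR, k, hRt, hk⟩ := hX.isCaratheodoryField p
  -- The bound `1 / 2` makes the Picard operator a contraction. The bound `R / 4` keeps solutions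
  -- that start within `R / 2` of the centre inside the ball of radius `R`.
  obtain ⟨r₁, hr₁, h1⟩ := exists_integral_Icc_le hk.integrable hs₀
    (lt_min (half_pos one_pos) (by positivity : 0 < R / 4))
  obtain ⟨r₂, hr₂, h2⟩ := hy.continuousOn.exists_extChartAt_mem_ball (n := n) hs₀ hp (half_pos hR)
  refine ⟨min r₁ r₂, lt_min hr₁ hr₂, fun c d hcd hc hd hcs hds => ?_⟩
  have hsub : Icc c d ⊆ Icc a b := Icc_subset_Icc hc.1 hd.2
  have hk' := hk.mono hsub
  have hint := h1 c d hcd hc hd (hcs.trans_le (min_le_left _ _)) (hds.trans_le (min_le_left _ _))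
  obtain ⟨hyc, hyc'⟩ := h2 c hc (hcs.trans_le (min_le_right _ _))
  obtain ⟨Φ, hΦ, -, hΦd⟩ := hk'.exists_flow hcd (hint.trans (min_le_left _ _))
  have hball : ∀ x, ‖x - extChartAt (𝓡 n) p p‖ < R / 2 → ∀ s ∈ Icc c d,
      ‖Φ x s - extChartAt (𝓡 n) p p‖ < R := fun x hx s hs => by
    have h3 : ‖Φ x s - x‖ ≤ R / 4 := by
      rw [(hΦ x).2 s hs, add_sub_cancel_left, intervalIntegral.integral_of_le hs.1,
        ← integral_Icc_eq_integral_Ioc]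
      have hsub' : Icc c s ⊆ Icc c d := Icc_subset_Icc_right hs.2
      refine (norm_integral_le_of_norm_le (hk'.integrable.mono_set hsub') ?_).trans
        ((setIntegral_mono_set hk'.integrable ?_ (Eventually.of_forall hsub')).trans
        (hint.trans (min_le_right _ _)))
      · filter_upwards [ae_restrict_of_ae_restrict_of_subset hsub' hk'.bound] with τ hτ using hτ _
      · filter_upwards [hk'.bound] with τ hτ using (norm_nonneg _).trans (hτ 0)
    have h4 : Φ x s - extChartAt (𝓡 n) p p = (Φ x s - x) + (x - extChartAt (𝓡 n) p p) := by abel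
    rw [h4]
    exact (norm_add_le _ _).trans_lt (by linarith)
  have htar : ∀ x, ‖x - extChartAt (𝓡 n) p p‖ < R / 2 → ∀ s ∈ Icc c d,
      Φ x s ∈ (extChartAt (𝓡 n) p).target := fun x hx s hs =>
    hRt (by rw [Metric.mem_closedBall, dist_eq_norm]; exact (hball x hx s hs).le)
  have hinit : ∀ x, Φ x c = x := fun x => by
    rw [(hΦ x).2 c (left_mem_Icc.2 hcd), intervalIntegral.integral_same, add_zero]
  have hsol : ∀ x, ‖x - extChartAt (𝓡 n) p p‖ < R / 2 →
      IsSolution X c d (fun s => (extChartAt (𝓡 n) p).symm (Φ x s)) := fun x hx => by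
    have hprim : IsPrimitiveOn (Φ x)
        (fun s => coordField (X s) p (ballRetract (extChartAt (𝓡 n) p p) R (Φ x s))) c d := by
      refine ⟨hk'.integrableOn_comp (hΦ x).1, fun s hs => ?_⟩
      rw [hinit]; exact (hΦ x).2 s hs
    refine IsPrimitiveOn.isSolution (p := p) hcd ?_ ?_ (hprim.congr ?_ ?_)
    · exact (continuousOn_extChartAt_symm p).comp (hΦ x).1.continuousOn (htar x hx)
    · exact fun s hs => (extChartAt (𝓡 n) p).map_target (htar x hx s hs)
    · exact fun s hs => (extChartAt (𝓡 n) p).right_inv (htar x hx s hs)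
    · filter_upwards [ae_restrict_mem measurableSet_Icc] with s hs
      rw [(extChartAt (𝓡 n) p).right_inv (htar x hx s hs), ballRetract_of_mem hR (hball x hx s hs).le]
  have hnear : ∀ᶠ m in 𝓝 (y c), m ∈ (extChartAt (𝓡 n) p).source ∧
      ‖extChartAt (𝓡 n) p m - extChartAt (𝓡 n) p p‖ < R / 2 := by
    refine Filter.Eventually.and ((isOpen_extChartAt_source (I := 𝓡 n) p).mem_nhds hyc) ?_
    exact ((continuousAt_extChartAt' (I := 𝓡 n) hyc).sub continuousAt_const).norm.eventually
      (gt_mem_nhds hyc')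
  have hXcd := hX.mono hc.1 hd.2
  refine ⟨hnear.mono fun m hm => ⟨_, hsol _ hm.2, ?_⟩, ?_⟩
  · rw [hinit, (extChartAt (𝓡 n) p).left_inv hm.1]
  · have heq : flowMap X c d =ᶠ[𝓝 (y c)] (extChartAt (𝓡 n) p).symm ∘
        (fun x => Φ x d) ∘ extChartAt (𝓡 n) p := by
      filter_upwards [hnear] with m hm
      have h3 := flowMap_eq hXcd hcd (hsol _ hm.2)
      rwa [hinit, (extChartAt (𝓡 n) p).left_inv hm.1] at h3
    refine MDifferentiableAt.congr_of_eventuallyEq ?_ heq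
    have hd1 : MDifferentiableAt (𝓡 n) 𝓘(ℝ, EuclideanSpace ℝ (Fin n)) (extChartAt (𝓡 n) p) (y c) :=
      mdifferentiableAt_extChartAt (by rwa [← extChartAt_source (𝓡 n)])
    have hd2 : MDifferentiableAt 𝓘(ℝ, EuclideanSpace ℝ (Fin n)) 𝓘(ℝ, EuclideanSpace ℝ (Fin n))
        (fun x => Φ x d) (extChartAt (𝓡 n) p (y c)) := by
      refine (hΦd _ ?_).mdifferentiableAt
      filter_upwards [ae_restrict_mem measurableSet_Icc] with s hs
      have h3 := hball _ hyc' s hs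
      have h4 : DifferentiableAt ℝ (coordField (X s) p) (Φ (extChartAt (𝓡 n) p (y c)) s) :=
        ((contDiffOn_coordField (hX.contMDiff s (hsub hs)) p).contDiffAt
          (extChartAt_target_mem (htar _ hyc' s hs))).differentiableAt (by norm_num)
      refine h4.congr_of_eventuallyEq ?_
      -- The point is strictly inside the ball, so the retraction is the identity near it and does
      -- not spoil differentiability.
      have h5 : Metric.ball (extChartAt (𝓡 n) p p) R ∈ 𝓝 (Φ (extChartAt (𝓡 n) p (y c)) s) :=
        Metric.isOpen_ball.mem_nhds (by rwa [Metric.mem_ball, dist_eq_norm])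
      filter_upwards [h5] with x hx
      rw [ballRetract_of_mem hR (by rw [Metric.mem_ball, dist_eq_norm] at hx; exact hx.le)]
    have ht := htar _ hyc' d (right_mem_Icc.2 hcd)
    have hd3 : MDifferentiableAt 𝓘(ℝ, EuclideanSpace ℝ (Fin n)) (𝓡 n) (extChartAt (𝓡 n) p).symm
        (Φ (extChartAt (𝓡 n) p (y c)) d) :=
      (mdifferentiableOn_extChartAt_symm (I := 𝓡 n) _ ht).mdifferentiableAt
        (extChartAt_target_mem ht)
    exact MDifferentiableAt.comp (y c) hd3 (MDifferentiableAt.comp (y c) hd2 hd1)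

/-- The flow of a regular field is defined near a reference solution and differentiable there. -/
theorem IsSolution.isFlowDifferentiable [T2Space M] (hX : IsRegularField X a b)
    (hy : IsSolution X a b y) {c d : ℝ} (hc : a ≤ c) (hcd : c ≤ d) (hd : d ≤ b) :
    IsFlowDifferentiable X y c d := by
  have hX' := hX.mono hc hd
  have hy' := hy.mono hc hd hcd
  exact Icc_additive_induction (P := IsFlowDifferentiable X y) hcd
    (fun a' b' c' ha' hab' hbc' hc' h1 h2 => isFlowDifferentiable_trans (hX'.mono ha' hc')
      (hy'.mono ha' hc' (hab'.trans hbc')) hab' hbc' h1 h2)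
    fun s hs => exists_isFlowDifferentiable_of_abs_lt hX' hy' hs

end Flow

/-! ### The control system in charts -/

section ControlSystem

/-- Substituting a measurable function in a Carathéodory function. -/
theorem aestronglyMeasurable_comp_of_continuous {α Z E : Type*} [MeasurableSpace α]
    [TopologicalSpace Z] [NormedAddCommGroup E] {μ : Measure α} {g : α → Z → E}
    (hc : ∀ᵐ s ∂μ, Continuous (g s)) (hm : ∀ z, AEStronglyMeasurable (fun s => g s z) μ)
    {z : α → Z} (hz : AEStronglyMeasurable z μ) :
    AEStronglyMeasurable (fun s => g s (z s)) μ := by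
  obtain ⟨z', hz', hzz'⟩ := hz
  -- For a simple approximation of `z` the composition is a finite sum of indicators; continuity in
  -- the second variable then passes to the limit.
  have h1 : ∀ k, AEStronglyMeasurable (fun s => g s (hz'.approx k s)) μ := fun k => by
    have h2 : (fun s => g s (hz'.approx k s)) = fun s => ∑ v ∈ (hz'.approx k).range,
        ((hz'.approx k) ⁻¹' {v}).indicator (fun s => g s v) s := by
      funext s
      rw [Finset.sum_eq_single (hz'.approx k s)]
      · rw [indicator_of_mem (by simp)]
      · intro v _ hv
        exact indicator_of_notMem (fun h => hv h.symm) _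
      · exact fun h => (h (SimpleFunc.mem_range_self _ _)).elim
    rw [h2]
    exact Finset.aestronglyMeasurable_fun_sum _ fun v _ =>
      (hm v).indicator ((hz'.approx k).measurableSet_preimage _)
  have h3 : AEStronglyMeasurable (fun s => g s (z' s)) μ := by
    refine aestronglyMeasurable_of_tendsto_ae atTop h1 ?_
    filter_upwards [hc] with s hs
    exact (hs.tendsto _).comp (hz'.tendsto_approx s)
  exact h3.congr (hzz'.mono fun s hs => by simp only [hs])

variable {n : ℕ} {M : Type*} [TopologicalSpace M] [ChartedSpace (EuclideanSpace ℝ (Fin n)) M]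
  [IsManifold (𝓡 n) 2 M]

/-! ### First order expansion of the flow. -/

section FlowDerivative

variable {X : ℝ → (x : M) → TangentSpace (𝓡 n) x} {a b : ℝ} {y : ℝ → M}

/-- The differential of the flow, as an operator on the model space. -/
def coordFlowDifferential (X : ℝ → (x : M) → TangentSpace (𝓡 n) x) (y : ℝ → M) (a b : ℝ) :
    EuclideanSpace ℝ (Fin n) →L[ℝ] EuclideanSpace ℝ (Fin n) :=
  flowDifferential X y a b

/-- The expansion at first order of the flow, in charts. -/
theorem flowMap_isLittleO [T2Space M] (hX : IsRegularField X a b) (hab : a ≤ b)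
    (hy : IsSolution X a b y) {α : Type*} {l : Filter α} {m : α → M} (hm : Tendsto m l (𝓝 (y a))) :
    (fun i => extChartAt (𝓡 n) (y b) (flowMap X a b (m i)) - extChartAt (𝓡 n) (y b) (y b)
      - coordFlowDifferential X y a b
        (extChartAt (𝓡 n) (y a) (m i) - extChartAt (𝓡 n) (y a) (y a))) =o[l]
      (fun i => extChartAt (𝓡 n) (y a) (m i) - extChartAt (𝓡 n) (y a) (y a)) := by
  have hyb : flowMap X a b (y a) = y b := flowMap_eq hX hab hy
  have h := (hy.isFlowDifferentiable hX le_rfl hab le_rfl).2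
  have h1 : HasFDerivWithinAt (writtenInExtChartAt (𝓡 n) (𝓡 n) (y a) (flowMap X a b))
      (coordFlowDifferential X y a b) (range (𝓡 n)) (extChartAt (𝓡 n) (y a) (y a)) :=
    h.hasMFDerivAt.2
  rw [ModelWithCorners.range_eq_univ, hasFDerivWithinAt_univ] at h1
  have h2 : HasFDerivAt (fun x => extChartAt (𝓡 n) (y b) (flowMap X a b
      ((extChartAt (𝓡 n) (y a)).symm x)))
      (coordFlowDifferential X y a b) (extChartAt (𝓡 n) (y a) (y a)) :=
    h1.congr_of_eventuallyEq (Eventually.of_forall fun x => by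
      simp only [writtenInExtChartAt, hyb, Function.comp_apply])
  have hc : Tendsto (fun i => extChartAt (𝓡 n) (y a) (m i)) l (𝓝 (extChartAt (𝓡 n) (y a) (y a))) :=
    (continuousAt_extChartAt (I := 𝓡 n) (y a)).tendsto.comp hm
  refine (h2.isLittleO.comp_tendsto hc).congr' ?_ EventuallyEq.rfl
  filter_upwards [hm.eventually (extChartAt_source_mem_nhds (I := 𝓡 n) (y a))] with i hi
  simp only [Function.comp_apply]
  rw [(extChartAt (𝓡 n) (y a)).left_inv hi, (extChartAt (𝓡 n) (y a)).left_inv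
    (mem_extChartAt_source (I := 𝓡 n) (y a)), hyb]

end FlowDerivative

variable [RiemannianBundle (fun x : M => TangentSpace (𝓡 n) x)]
  [IsContMDiffRiemannianBundle (𝓡 n) 1 (EuclideanSpace ℝ (Fin n))
      (fun x : M => TangentSpace (𝓡 n) x)]
  {W : Type*} [MetricSpace W] {f : ℝ → (x : M) → W → TangentSpace (𝓡 n) x} {S : ℝ}

namespace HypothesisSH

/-- The coordinate bound on the derivative becomes a Lipschitz bound by the mean value inequality on
the ball, which is convex. All controls share the same `k`. -/
theorem exists_chart_bound (hf : HypothesisSH f S) (p : M) : ∃ R > 0, ∃ k : ℝ → ℝ,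
    Metric.closedBall (extChartAt (𝓡 n) p p) R ⊆ (extChartAt (𝓡 n) p).target ∧
    IntegrableOn k (Icc 0 S) ∧ ∀ᵐ s ∂(volume.restrict (Icc 0 S)), 0 ≤ k s ∧ ∀ ω : W,
      (∀ x ∈ Metric.closedBall (extChartAt (𝓡 n) p p) R,
        ‖coordField (fun x => f s x ω) p x‖ ≤ k s) ∧
      ∀ x ∈ Metric.closedBall (extChartAt (𝓡 n) p p) R,
        ∀ x' ∈ Metric.closedBall (extChartAt (𝓡 n) p p) R,
        ‖coordField (fun x => f s x ω) p x - coordField (fun x => f s x ω) p x'‖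
          ≤ k s * ‖x - x'‖ := by
  obtain ⟨c, hc, hb⟩ := hf.bound
  obtain ⟨R, hR, K, hK, hsub, hKR⟩ := exists_coordField_bound (n := n) p
  refine ⟨R, hR, fun s => |K * c s|, hsub, (hc.const_mul K).abs, ?_⟩
  filter_upwards [hb, ae_restrict_mem measurableSet_Icc] with s hs hsm
  have h1 : ∀ ω, ∀ x ∈ Metric.closedBall (extChartAt (𝓡 n) p p) R,
      ‖coordField (fun x => f s x ω) p x‖ ≤ K * c s ∧
      ‖fderiv ℝ (coordField (fun x => f s x ω) p) x‖ ≤ K * c s := fun ω =>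
    hKR _ (c s) (hf.contMDiff s hsm ω) (fun x => (hs x ω).1) (fun x => (hs x ω).2)
  refine ⟨abs_nonneg _, fun ω => ⟨fun x hx => (h1 ω x hx).1.trans (le_abs_self _),
    fun x hx x' hx' => ?_⟩⟩
  · refine (convex_closedBall _ _).norm_image_sub_le_of_norm_fderiv_le (𝕜 := ℝ) (fun z hz => ?_)
      (fun z hz => (h1 ω z hz).2.trans (le_abs_self _)) hx' hx
    exact ((contDiffOn_coordField (hf.contMDiff s hsm ω) p).contDiffAt
      (extChartAt_target_mem (hsub hz))).differentiableAt (by norm_num)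

theorem aestronglyMeasurable_coordField_const (hf : HypothesisSH f S) (p : M)
    (z : EuclideanSpace ℝ (Fin n)) (ω : W) :
    AEStronglyMeasurable (fun s => coordField (fun x => f s x ω) p z)
      (volume.restrict (Icc 0 S)) := by
  unfold coordField
  generalize (extChartAt (𝓡 n) p).symm z = m
  obtain ⟨A, hA⟩ : ∃ A : EuclideanSpace ℝ (Fin n) →L[ℝ] EuclideanSpace ℝ (Fin n),
    A = mfderiv (𝓡 n) 𝓘(ℝ, EuclideanSpace ℝ (Fin n)) (extChartAt (𝓡 n) p) m := ⟨_, rfl⟩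
  have h3 : AEStronglyMeasurable (fun s => (f s m ω : EuclideanSpace ℝ (Fin n)))
    (volume.restrict (Icc 0 S)) := hf.measurable m ω
  have h4 : AEStronglyMeasurable (fun s => A (f s m ω)) (volume.restrict (Icc 0 S)) :=
    A.continuous.comp_aestronglyMeasurable h3
  rw [hA] at h4
  exact h4

/-- The state and the control are substituted together, using joint continuity in both; the
retraction makes the coordinate field defined for every state. -/
theorem aestronglyMeasurable_coordField (hf : HypothesisSH f S) {p : M} {R : ℝ} (hR : 0 < R)
    (hsub : Metric.closedBall (extChartAt (𝓡 n) p p) R ⊆ (extChartAt (𝓡 n) p).target)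
    {u : ℝ → EuclideanSpace ℝ (Fin n)} (hu : AEStronglyMeasurable u (volume.restrict (Icc 0 S)))
    {w : ℝ → W} (hw : AEStronglyMeasurable w (volume.restrict (Icc 0 S))) :
    AEStronglyMeasurable (fun s => coordField (fun x => f s x (w s)) p
      (ballRetract (extChartAt (𝓡 n) p p) R (u s))) (volume.restrict (Icc 0 S)) := by
  have : IsManifold (𝓡 n) 1 M := IsManifold.of_le (n := 2) (by norm_num)
  have hmem : ∀ z, ballRetract (extChartAt (𝓡 n) p p) R z ∈ (extChartAt (𝓡 n) p).target :=
    fun z => hsub (by rw [Metric.mem_closedBall, dist_eq_norm]; exact norm_ballRetract_sub_le hR z)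
  obtain ⟨g, hg⟩ : ∃ g : ℝ → EuclideanSpace ℝ (Fin n) × W → EuclideanSpace ℝ (Fin n),
      ∀ s, g s = fun q => coordField (fun x => f s x q.2) p
        (ballRetract (extChartAt (𝓡 n) p p) R q.1) := ⟨_, fun _ => rfl⟩
  have h1 : ∀ᵐ s ∂(volume.restrict (Icc 0 S)), Continuous (g s) := by
    filter_upwards [ae_restrict_mem measurableSet_Icc] with s hs
    have h2 : Continuous fun q : EuclideanSpace ℝ (Fin n) × W =>
        (ballRetract (extChartAt (𝓡 n) p p) R q.1, q.2) :=
      ((continuous_ballRetract hR).comp continuous_fst).prodMk continuous_snd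
    rw [hg]
    exact (continuousOn_coordField_prod (hf.continuous s hs) p).comp_continuous h2
      fun q => ⟨hmem _, mem_univ _⟩
  have h3 : ∀ q, AEStronglyMeasurable (fun s => g s q) (volume.restrict (Icc 0 S)) := fun q => by
    simp only [hg]
    exact hf.aestronglyMeasurable_coordField_const p _ q.2
  have h4 := aestronglyMeasurable_comp_of_continuous h1 h3 (hu.prodMk hw)
  simpa only [hg] using h4

theorem isRegularField (hf : HypothesisSH f S) {w : ℝ → W}
    (hw : AEStronglyMeasurable w (volume.restrict (Icc 0 S))) :
    IsRegularField (fun s x => f s x (w s)) 0 S := by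
  refine ⟨fun s hs => hf.contMDiff s hs (w s), fun p => ?_⟩
  obtain ⟨R, hR, k, hsub, hk, hb⟩ := hf.exists_chart_bound p
  have hmem : ∀ z, ballRetract (extChartAt (𝓡 n) p p) R z ∈
      Metric.closedBall (extChartAt (𝓡 n) p p) R :=
    fun z => by rw [Metric.mem_closedBall, dist_eq_norm]; exact norm_ballRetract_sub_le hR z
  -- The factor `2` is the Lipschitz constant of the retraction.
  refine ⟨R, hR, fun s => 2 * k s, hsub, hk.const_mul 2, ?_, ?_, fun u hu =>
    hf.aestronglyMeasurable_coordField hR hsub hu.aestronglyMeasurable hw⟩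
  · filter_upwards [hb] with s hs z
    have h1 := (hs.2 (w s)).1 _ (hmem z)
    linarith [hs.1]
  · filter_upwards [hb] with s hs z z'
    refine ((hs.2 (w s)).2 _ (hmem z) _ (hmem z')).trans ?_
    rw [mul_comm 2, mul_assoc]
    exact mul_le_mul_of_nonneg_left (norm_ballRetract_sub_ballRetract_le hR z z') hs.1

end HypothesisSH

end ControlSystem

/-! ### Needle variations -/

section Needle

variable {n : ℕ} {M : Type*}

/-! ### Curves confined to a chart ball. -/

section Exit

variable [TopologicalSpace M] [ChartedSpace (EuclideanSpace ℝ (Fin n)) M] [T2Space M]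

/-- A continuation argument: as long as the curve is in the ball of radius `R` it moves by at most
`ρ₂`, so it is in fact within `ρ₁ + ρ₂ < R` and cannot reach the boundary. -/
theorem forall_mem_extChartAt_closedBall_of_left {y : ℝ → M} {a b : ℝ} {p : M} {R ρ₁ ρ₂ : ℝ}
    (hy : ContinuousOn y (Icc a b))
    (hR : Metric.closedBall (extChartAt (𝓡 n) p p) R ⊆ (extChartAt (𝓡 n) p).target)
    (hρ : ρ₁ + ρ₂ < R) (hρ₂ : 0 ≤ ρ₂)
    (ha : y a ∈ (extChartAt (𝓡 n) p).source)
    (ha' : ‖extChartAt (𝓡 n) p (y a) - extChartAt (𝓡 n) p p‖ ≤ ρ₁)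
    (h : ∀ c d, a ≤ c → c ≤ d → d ≤ b → (∀ s ∈ Icc c d, y s ∈ (extChartAt (𝓡 n) p).source ∧
      ‖extChartAt (𝓡 n) p (y s) - extChartAt (𝓡 n) p p‖ ≤ R) →
      ‖extChartAt (𝓡 n) p (y d) - extChartAt (𝓡 n) p (y c)‖ ≤ ρ₂) :
    ∀ s ∈ Icc a b, y s ∈ (extChartAt (𝓡 n) p).source ∧
      ‖extChartAt (𝓡 n) p (y s) - extChartAt (𝓡 n) p p‖ ≤ ρ₁ + ρ₂ := by
  set K : Set M := {m | m ∈ (extChartAt (𝓡 n) p).source ∧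
    ‖extChartAt (𝓡 n) p m - extChartAt (𝓡 n) p p‖ ≤ ρ₁ + ρ₂} with hK
  -- `K` is the image of a compact ball, hence closed in the whole Hausdorff manifold and not merely
  -- in the chart domain.
  have hKim : K = (extChartAt (𝓡 n) p).symm '' Metric.closedBall (extChartAt (𝓡 n) p p) (ρ₁ + ρ₂) := by
    ext m
    constructor
    · rintro ⟨h1, h2⟩
      exact ⟨extChartAt (𝓡 n) p m, by rwa [Metric.mem_closedBall, dist_eq_norm],
        (extChartAt (𝓡 n) p).left_inv h1⟩
    · rintro ⟨x, hx, rfl⟩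
      have hxt := hR (Metric.closedBall_subset_closedBall hρ.le hx)
      refine ⟨(extChartAt (𝓡 n) p).map_target hxt, ?_⟩
      rwa [(extChartAt (𝓡 n) p).right_inv hxt, ← dist_eq_norm, ← Metric.mem_closedBall]
  have hKc : IsClosed K := by
    rw [hKim]
    exact ((isCompact_closedBall _ _).image_of_continuousOn ((continuousOn_extChartAt_symm p).mono
      ((Metric.closedBall_subset_closedBall hρ.le).trans hR))).isClosed
  have hcl : IsClosed (y ⁻¹' K ∩ Icc a b) := by
    rw [inter_comm]; exact hy.preimage_isClosed_of_isClosed isClosed_Icc hKc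
  have hmain : Icc a b ⊆ y ⁻¹' K := by
    refine hcl.Icc_subset_of_forall_mem_nhdsGT_of_Icc_subset ⟨ha, by linarith⟩ fun t ht hsub => ?_
    have htK : y t ∈ K := hsub (right_mem_Icc.2 ht.1)
    have hU : ∀ᶠ m in 𝓝 (y t), m ∈ (extChartAt (𝓡 n) p).source ∧
        ‖extChartAt (𝓡 n) p m - extChartAt (𝓡 n) p p‖ < R :=
      Filter.Eventually.and ((isOpen_extChartAt_source (I := 𝓡 n) p).mem_nhds htK.1)
        (((continuousAt_extChartAt' (I := 𝓡 n) htK.1).sub continuousAt_const).norm.eventually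
          (gt_mem_nhds (htK.2.trans_lt hρ)))
    obtain ⟨r, hr, hball⟩ := Metric.mem_nhdsWithin_iff.1 (hy t (Ico_subset_Icc_self ht) hU)
    have hlt : t < min b (t + r) := lt_min ht.2 (by linarith)
    filter_upwards [Ioo_mem_nhdsGT hlt] with s hs
    have hsb : s ≤ b := hs.2.le.trans (min_le_left _ _)
    have hsr : s < t + r := hs.2.trans_le (min_le_right _ _)
    have hin : ∀ τ ∈ Icc a s, y τ ∈ (extChartAt (𝓡 n) p).source ∧
        ‖extChartAt (𝓡 n) p (y τ) - extChartAt (𝓡 n) p p‖ < R := fun τ hτ => by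
      rcases le_total τ t with h1 | h1
      · have h2 := hsub ⟨hτ.1, h1⟩
        exact ⟨h2.1, h2.2.trans_lt hρ⟩
      · refine hball ⟨?_, hτ.1, hτ.2.trans hsb⟩
        rw [Metric.mem_ball, Real.dist_eq, abs_of_nonneg (by linarith)]
        linarith [hτ.2]
    have has : a ≤ s := ht.1.trans hs.1.le
    have h3 := h a s le_rfl has hsb fun τ hτ => ⟨(hin τ hτ).1, (hin τ hτ).2.le⟩
    refine ⟨(hin s (right_mem_Icc.2 has)).1, ?_⟩
    have h4 := norm_add_le (extChartAt (𝓡 n) p (y s) - extChartAt (𝓡 n) p (y a))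
      (extChartAt (𝓡 n) p (y a) - extChartAt (𝓡 n) p p)
    rw [sub_add_sub_cancel] at h4
    linarith
  exact fun s hs => hmain hs

/-- The previous statement after reversing time. -/
theorem forall_mem_extChartAt_closedBall_of_right {y : ℝ → M} {a b : ℝ} {p : M} {R ρ₁ ρ₂ : ℝ}
    (hy : ContinuousOn y (Icc a b))
    (hR : Metric.closedBall (extChartAt (𝓡 n) p p) R ⊆ (extChartAt (𝓡 n) p).target)
    (hρ : ρ₁ + ρ₂ < R) (hρ₂ : 0 ≤ ρ₂)
    (hb : y b ∈ (extChartAt (𝓡 n) p).source)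
    (hb' : ‖extChartAt (𝓡 n) p (y b) - extChartAt (𝓡 n) p p‖ ≤ ρ₁)
    (h : ∀ c d, a ≤ c → c ≤ d → d ≤ b → (∀ s ∈ Icc c d, y s ∈ (extChartAt (𝓡 n) p).source ∧
      ‖extChartAt (𝓡 n) p (y s) - extChartAt (𝓡 n) p p‖ ≤ R) →
      ‖extChartAt (𝓡 n) p (y d) - extChartAt (𝓡 n) p (y c)‖ ≤ ρ₂) :
    ∀ s ∈ Icc a b, y s ∈ (extChartAt (𝓡 n) p).source ∧
      ‖extChartAt (𝓡 n) p (y s) - extChartAt (𝓡 n) p p‖ ≤ ρ₁ + ρ₂ := by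
  have hz : ContinuousOn (fun s => y (-s)) (Icc (-b) (-a)) :=
    hy.comp continuous_neg.continuousOn fun s hs => ⟨by linarith [hs.2], by linarith [hs.1]⟩
  have := forall_mem_extChartAt_closedBall_of_left hz hR hρ hρ₂ (by simpa using hb)
    (by simpa using hb') fun c d hc hcd hd hin => by
      rw [norm_sub_rev]
      refine h (-d) (-c) (by linarith) (by linarith) (by linarith) fun s hs => ?_
      simpa using hin (-s) ⟨by linarith [hs.2], by linarith [hs.1]⟩
  intro s hs
  simpa using this (-s) ⟨by linarith [hs.2], by linarith [hs.1]⟩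

end Exit

section CoordFieldAlgebra

variable [TopologicalSpace M] [ChartedSpace (EuclideanSpace ℝ (Fin n)) M]

theorem coordField_add_smul_sub (X Y : (x : M) → TangentSpace (𝓡 n) x) (r : ℝ) (p : M)
    (z : EuclideanSpace ℝ (Fin n)) :
    coordField (fun x => X x + r • (Y x - X x)) p z
      = coordField X p z + r • (coordField Y p z - coordField X p z) := by
  simp only [coordField, map_add, map_smul, map_sub]
  rfl

theorem coordField_self [IsManifold (𝓡 n) 1 M] (X : (x : M) → TangentSpace (𝓡 n) x) (p : M) :
    coordField X p (extChartAt (𝓡 n) p p) = X p := by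
  rw [coordField_extChartAt X (mem_extChartAt_source (I := 𝓡 n) p)]
  exact mfderiv_extChartAt_apply_self _

end CoordFieldAlgebra

/-! ### Integral estimates at Scorza-Dragoni points. -/

section ScorzaDragoni

variable [EMetricSpace M] [ChartedSpace (EuclideanSpace ℝ (Fin n)) M]

/-- Negative increments are used, because a needle occupies the interval just before `s`; this also
covers `s = b`. -/
theorem IsScorzaDragoniPoint.exists_lintegral_le {φ : ℝ → (x : M) → TangentSpace (𝓡 n) x}
    {a b s : ℝ} (h : IsScorzaDragoniPoint φ a b s) (has : a < s) (p : M) {η : ℝ} (hη : 0 < η) :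
    ∃ r > 0, ∀ᶠ ε : ℝ in 𝓝[>] 0,
      ∫⁻ τ in Ioc (s - ε) s, scorzaDragoniOsc φ s p r τ ≤ ENNReal.ofReal (η * ε) := by
  have h1 := (h.2 p).eventually (gt_mem_nhds (ENNReal.ofReal_pos.2 hη))
  obtain ⟨r, hr, hr0⟩ := (h1.and self_mem_nhdsWithin).exists
  refine ⟨r, hr0, ?_⟩
  have h2 := eventually_lt_of_limsup_lt hr
  have h3 : Tendsto (fun ε : ℝ => -ε) (𝓝[>] 0) (𝓝[{δ : ℝ | δ ≠ 0 ∧ s + δ ∈ Icc a b}] 0) := by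
    refine tendsto_nhdsWithin_iff.2 ⟨?_, ?_⟩
    · exact tendsto_nhdsWithin_of_tendsto_nhds (by simpa using (continuous_neg (G := ℝ)).tendsto 0)
    · filter_upwards [Ioo_mem_nhdsGT (sub_pos.2 has)] with ε hε
      exact ⟨neg_ne_zero.2 hε.1.ne', by linarith [hε.2], by linarith [hε.1, h.1.2]⟩
  filter_upwards [h3.eventually h2, self_mem_nhdsWithin] with ε hε hε0
  rw [mem_Ioi] at hε0
  have h4 : uIoc s (s + -ε) = Ioc (s - ε) s := by
    rw [uIoc_of_ge (by linarith), sub_eq_add_neg]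
  rw [h4, abs_neg, abs_of_pos hε0] at hε
  have h5 : ENNReal.ofReal ε ≠ 0 := (ENNReal.ofReal_pos.2 hε0).ne'
  rw [mul_comm η, ENNReal.ofReal_mul hε0.le]
  exact (ENNReal.inv_mul_le_iff h5 ENNReal.ofReal_ne_top).1 hε.le

/-- Along any curve close to `p` the integrand is dominated by the oscillation, so over `(s - ε, s]`
the field acts as if frozen at `(s, p)`. -/
theorem norm_integral_coordField_sub_le {φ : ℝ → (x : M) → TangentSpace (𝓡 n) x} {s ε r η : ℝ}
    {p : M} (hε : 0 ≤ ε) (hη : 0 ≤ η)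
    (h : ∫⁻ τ in Ioc (s - ε) s, scorzaDragoniOsc φ s p r τ ≤ ENNReal.ofReal (η * ε))
    {m : ℝ → M} (hm : ∀ τ ∈ Icc (s - ε) s, m τ ∈ (extChartAt (𝓡 n) p).source ∧
      edist (m τ) p ≤ ENNReal.ofReal r)
    (hi : IntegrableOn (fun τ => coordField (φ τ) p (extChartAt (𝓡 n) p (m τ))) (Icc (s - ε) s)) :
    ‖(∫ τ in (s - ε)..s, coordField (φ τ) p (extChartAt (𝓡 n) p (m τ)))
      - ε • coordField (φ s) p (extChartAt (𝓡 n) p p)‖ ≤ η * ε := by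
  have h1 : (∫ τ in (s - ε)..s, coordField (φ τ) p (extChartAt (𝓡 n) p (m τ)))
      - ε • coordField (φ s) p (extChartAt (𝓡 n) p p) =
      ∫ τ in (s - ε)..s, (coordField (φ τ) p (extChartAt (𝓡 n) p (m τ)) -
        coordField (φ s) p (extChartAt (𝓡 n) p p)) := by
    rw [intervalIntegral.integral_sub _ intervalIntegrable_const, intervalIntegral.integral_const,
      sub_sub_cancel]
    exact (intervalIntegrable_iff_integrableOn_Icc_of_le (by linarith)).2 hi
  rw [h1, ← ENNReal.ofReal_le_ofReal_iff (mul_nonneg hη hε), ofReal_norm,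
    intervalIntegral.integral_of_le (by linarith)]
  refine (enorm_integral_le_lintegral_enorm _).trans (le_trans ?_ h)
  refine setLIntegral_mono' measurableSet_Ioc fun τ hτ => ?_
  exact le_biSup (fun x => ‖coordField (φ τ) p (extChartAt (𝓡 n) p x) -
      coordField (φ s) p (extChartAt (𝓡 n) p p)‖ₑ) (hm τ (Ioc_subset_Icc_self hτ))

/-- Scorza-Dragoni points are defined with the distance of the manifold, while trajectories are
controlled in the chart. -/
theorem exists_edist_le_of_norm_extChartAt_lt (p : M) {r : ℝ} (hr : 0 < r) : ∃ δ > 0, ∀ m : M,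
    m ∈ (extChartAt (𝓡 n) p).source → ‖extChartAt (𝓡 n) p m - extChartAt (𝓡 n) p p‖ < δ →
    edist m p ≤ ENNReal.ofReal r := by
  have h1 : ContinuousAt (extChartAt (𝓡 n) p).symm (extChartAt (𝓡 n) p p) :=
    continuousAt_extChartAt_symm p
  have h2 := h1.tendsto
  rw [extChartAt_to_inv] at h2
  obtain ⟨δ, hδ, h3⟩ := Metric.eventually_nhds_iff.1
    (h2.eventually (Metric.eball_mem_nhds p (ENNReal.ofReal_pos.2 hr)))
  refine ⟨δ, hδ, fun m hm hmδ => ?_⟩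
  have := h3 (y := extChartAt (𝓡 n) p m) (by rwa [dist_eq_norm])
  rw [(extChartAt (𝓡 n) p).left_inv hm] at this
  exact le_of_lt this

end ScorzaDragoni

end Needle

/-! ### The effect of a needle variation -/

section NeedleEffect

theorem IsPrimitiveOn.norm_sub_le {E : Type*} [NormedAddCommGroup E] [NormedSpace ℝ E]
    {u g : ℝ → E} {k : ℝ → ℝ} {a b c d : ℝ} (h : IsPrimitiveOn u g c d) (hcd : c ≤ d)
    (hc : a ≤ c) (hd : d ≤ b) (hk : IntegrableOn k (Icc a b))
    (hk0 : ∀ᵐ s ∂(volume.restrict (Icc a b)), 0 ≤ k s)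
    (hg : ∀ᵐ s ∂(volume.restrict (Icc c d)), ‖g s‖ ≤ k s) :
    ‖u d - u c‖ ≤ ∫ s in Icc a b, k s := by
  have hsub : Icc c d ⊆ Icc a b := Icc_subset_Icc hc hd
  rw [h.sub_eq (left_mem_Icc.2 hcd) (right_mem_Icc.2 hcd), intervalIntegral.integral_of_le hcd,
    ← integral_Icc_eq_integral_Ioc]
  exact (norm_integral_le_of_norm_le (hk.mono_set hsub) hg).trans
    (setIntegral_mono_set hk hk0 (Eventually.of_forall hsub))

/-- The vector is a convex combination of `A` and `B`. -/
theorem norm_add_smul_sub_le {E : Type*} [NormedAddCommGroup E] [NormedSpace ℝ E]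
    {A B : E} {r k : ℝ} (hr : 0 ≤ r) (hr1 : r ≤ 1) (hA : ‖A‖ ≤ k) (hB : ‖B‖ ≤ k) :
    ‖A + r • (B - A)‖ ≤ k := by
  have h1 : A + r • (B - A) = (1 - r) • A + r • B := by module
  rw [h1]
  refine (norm_add_le _ _).trans ?_
  rw [norm_smul, norm_smul, Real.norm_of_nonneg hr, Real.norm_of_nonneg (by linarith)]
  nlinarith [mul_le_mul_of_nonneg_left hA (by linarith : 0 ≤ 1 - r), mul_le_mul_of_nonneg_left hB hr]

theorem intervalIntegral_add_smul_sub {E : Type*} [NormedAddCommGroup E] [NormedSpace ℝ E]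
    {A B : ℝ → E} {a b : ℝ} (hA : IntervalIntegrable A volume a b)
    (hB : IntervalIntegrable B volume a b) (r : ℝ) :
    ∫ τ in a..b, (A τ + r • (B τ - A τ))
      = (∫ τ in a..b, A τ) + r • ((∫ τ in a..b, B τ) - ∫ τ in a..b, A τ) := by
  rw [← intervalIntegral.integral_sub hB hA, ← intervalIntegral.integral_smul]
  exact intervalIntegral.integral_add hA ((hB.sub hA).smul r)

variable {n : ℕ} {M : Type*} [EMetricSpace M] [ChartedSpace (EuclideanSpace ℝ (Fin n)) M]
  [IsManifold (𝓡 n) 2 M]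
  [RiemannianBundle (fun x : M => TangentSpace (𝓡 n) x)]
  [IsContMDiffRiemannianBundle (𝓡 n) 1 (EuclideanSpace ℝ (Fin n))
      (fun x : M => TangentSpace (𝓡 n) x)]
  {W : Type*} [MetricSpace W] {f : ℝ → (x : M) → W → TangentSpace (𝓡 n) x} {S : ℝ}

theorem HypothesisSH.aestronglyMeasurable_coordField_comp (hf : HypothesisSH f S) {p : M} {R : ℝ}
    (hR : 0 < R)
    (hsub : Metric.closedBall (extChartAt (𝓡 n) p p) R ⊆ (extChartAt (𝓡 n) p).target)
    {c d : ℝ} (hc : 0 ≤ c) (hd : d ≤ S) {m : ℝ → M} (hm : ContinuousOn m (Icc c d))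
    (hmem : ∀ s ∈ Icc c d, m s ∈ (extChartAt (𝓡 n) p).source ∧
      ‖extChartAt (𝓡 n) p (m s) - extChartAt (𝓡 n) p p‖ ≤ R)
    {w : ℝ → W} (hw : AEStronglyMeasurable w (volume.restrict (Icc 0 S))) :
    AEStronglyMeasurable (fun s => coordField (fun x => f s x (w s)) p (extChartAt (𝓡 n) p (m s)))
      (volume.restrict (Icc c d)) := by
  have hcont : ContinuousOn (fun s => extChartAt (𝓡 n) p (m s)) (Icc c d) :=
    (continuousOn_extChartAt p).comp hm fun s hs => (hmem s hs).1
  have h1 : AEStronglyMeasurable ((Icc c d).indicator fun s => extChartAt (𝓡 n) p (m s))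
      (volume.restrict (Icc 0 S)) :=
    ((aestronglyMeasurable_indicator_iff measurableSet_Icc).2
      (hcont.aestronglyMeasurable measurableSet_Icc)).restrict
  have h2 := (hf.aestronglyMeasurable_coordField hR hsub h1 hw).mono_set (Icc_subset_Icc hc hd)
  refine h2.congr ?_
  filter_upwards [ae_restrict_mem measurableSet_Icc] with s hs
  rw [indicator_of_mem hs, ballRetract_of_mem hR (hmem s hs).2]

variable {w : ℝ → W} {s : ℝ} {ω : W} {p : M} {α : Type*} {l : Filter α} {ε g : α → ℝ}
  {x u : α → ℝ → M}

/-- First order expansion of the effect of a needle variation, at the end of the needle. -/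
theorem HypothesisSH.needle_isLittleO (hf : HypothesisSH f S)
    (hw : AEStronglyMeasurable w (volume.restrict (Icc 0 S))) (hs0 : 0 < s) (hsS : s ≤ S)
    (hSDw : IsScorzaDragoniPoint (fun s x => f s x (w s)) 0 S s)
    (hSDω : IsScorzaDragoniPoint (fun s x => f s x ω) 0 S s)
    (hε : Tendsto ε l (𝓝[>] 0)) (hg : ∀ᶠ i in l, 0 ≤ g i ∧ g i ≤ 1)
    (hx : ∀ᶠ i in l, IsSolution (fun s x => f s x (w s)) (s - ε i) s (x i))
    (hu : ∀ᶠ i in l, IsSolution (fun τ m => f τ m (w τ) + g i • (f τ m ω - f τ m (w τ)))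
      (s - ε i) s (u i))
    (hxu : ∀ᶠ i in l, u i (s - ε i) = x i (s - ε i)) (hlim : Tendsto (fun i => x i s) l (𝓝 p)) :
    Tendsto (fun i => u i s) l (𝓝 p) ∧
    (fun i => extChartAt (𝓡 n) p (u i s) - extChartAt (𝓡 n) p (x i s) - ε i • g i •
      (coordField (fun x => f s x ω) p (extChartAt (𝓡 n) p p) -
        coordField (fun x => f s x (w s)) p (extChartAt (𝓡 n) p p))) =o[l] ε := by
  obtain ⟨R, hR, k, hsub, hk, hb⟩ := hf.exists_chart_bound p
  have hε0 : ∀ᶠ i in l, 0 < ε i := hε.eventually self_mem_nhdsWithin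
  have hεlt : ∀ e > 0, ∀ᶠ i in l, ε i < e := fun e he =>
    (tendsto_nhds_of_tendsto_nhdsWithin hε).eventually (gt_mem_nhds he)
  have hxs : Tendsto (fun i => ‖extChartAt (𝓡 n) p (x i s) - extChartAt (𝓡 n) p p‖) l (𝓝 0) := by
    have := (((continuousAt_extChartAt (I := 𝓡 n) p).tendsto.comp hlim).sub_const
      (extChartAt (𝓡 n) p p)).norm
    simpa using this
  have hsrc := hlim.eventually (extChartAt_source_mem_nhds (I := 𝓡 n) p)
  have hmem : ∀ {z : M}, ‖extChartAt (𝓡 n) p z - extChartAt (𝓡 n) p p‖ ≤ R →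
      extChartAt (𝓡 n) p z ∈ Metric.closedBall (extChartAt (𝓡 n) p p) R := fun h => by
    rwa [Metric.mem_closedBall, dist_eq_norm]
  -- The limit of `x` is known at the end of the needle, so `x` is followed backwards from there and
  -- `u` forwards from the common initial point. The radius `r` splits into the distance of `x i s`
  -- from `p` and the two displacements, `r / 3` each.
  have hstay : ∀ r, 0 < r → r < R → ∀ᶠ i in l, ∀ τ ∈ Icc (s - ε i) s,
      (x i τ ∈ (extChartAt (𝓡 n) p).source ∧
        ‖extChartAt (𝓡 n) p (x i τ) - extChartAt (𝓡 n) p p‖ ≤ r) ∧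
      (u i τ ∈ (extChartAt (𝓡 n) p).source ∧
        ‖extChartAt (𝓡 n) p (u i τ) - extChartAt (𝓡 n) p p‖ ≤ r) := fun r hr hrR => by
    obtain ⟨e, he, hint⟩ := exists_integral_Icc_le hk ⟨hs0.le, hsS⟩ (by positivity : 0 < r / 3)
    filter_upwards [hε0, hεlt e he, hεlt s hs0, hg, hx, hu, hxu,
      hxs.eventually (gt_mem_nhds (by positivity : 0 < r / 3)), hsrc]
      with i hi0 hie his hgi hxi hui hxui hxr hsi
    have h0 : 0 ≤ s - ε i := by linarith
    have hle : s - ε i ≤ s := by linarith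
    have hI : ∫ τ in Icc (s - ε i) s, k τ ≤ r / 3 :=
      hint _ _ hle ⟨h0, hle.trans hsS⟩ ⟨hs0.le, hsS⟩
        (by rw [sub_sub_cancel_left, abs_neg, abs_of_pos hi0]; exact hie) (by simpa using he)
    have hIsub : Icc (s - ε i) s ⊆ Icc 0 S := Icc_subset_Icc h0 hsS
    have hki := hk.mono_set hIsub
    have hbi := ae_restrict_of_ae_restrict_of_subset hIsub hb
    have hk0 : ∀ᵐ τ ∂(volume.restrict (Icc (s - ε i) s)), 0 ≤ k τ := hbi.mono fun τ hτ => hτ.1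
    have h1 := forall_mem_extChartAt_closedBall_of_right hxi.continuousOn hsub
      (by linarith : r / 3 + r / 3 < R) (by positivity) hsi hxr.le fun c d hc hcd hd hin => by
        refine (((hxi.mono hc hd hcd).isPrimitiveOn hcd fun τ hτ => (hin τ hτ).1).norm_sub_le hcd
          hc hd hki hk0 ?_).trans hI
        filter_upwards [ae_restrict_of_ae_restrict_of_subset (Icc_subset_Icc hc hd) hbi,
          ae_restrict_mem measurableSet_Icc] with τ hτ hτm
        exact (hτ.2 _).1 _ (hmem (hin τ hτm).2)
    have hstart := h1 _ (left_mem_Icc.2 hle)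
    rw [← hxui] at hstart
    have h2 := forall_mem_extChartAt_closedBall_of_left hui.continuousOn hsub
      (by linarith : (r / 3 + r / 3) + r / 3 < R) (by positivity) hstart.1 hstart.2
      fun c d hc hcd hd hin => by
        refine (((hui.mono hc hd hcd).isPrimitiveOn hcd fun τ hτ => (hin τ hτ).1).norm_sub_le hcd
          hc hd hki hk0 ?_).trans hI
        filter_upwards [ae_restrict_of_ae_restrict_of_subset (Icc_subset_Icc hc hd) hbi,
          ae_restrict_mem measurableSet_Icc] with τ hτ hτm
        rw [coordField_add_smul_sub]
        exact norm_add_smul_sub_le hgi.1 hgi.2 ((hτ.2 _).1 _ (hmem (hin τ hτm).2))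
          ((hτ.2 _).1 _ (hmem (hin τ hτm).2))
    exact fun τ hτ => ⟨⟨(h1 τ hτ).1, (h1 τ hτ).2.trans (by linarith)⟩,
      ⟨(h2 τ hτ).1, (h2 τ hτ).2.trans (by linarith)⟩⟩
  refine ⟨?_, ?_⟩
  · have h3 : Tendsto (fun i => extChartAt (𝓡 n) p (u i s)) l (𝓝 (extChartAt (𝓡 n) p p)) := by
      rw [Metric.tendsto_nhds]
      intro e he
      filter_upwards [hstay (min (e / 2) (R / 2)) (by positivity)
        ((min_le_right _ _).trans_lt (by linarith)), hε0] with i hi hi0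
      rw [dist_eq_norm]
      exact ((hi s ⟨by linarith, le_rfl⟩).2.2.trans (min_le_left _ _)).trans_lt (by linarith)
    have h4 : Tendsto (extChartAt (𝓡 n) p).symm (𝓝 (extChartAt (𝓡 n) p p)) (𝓝 p) := by
      have := (continuousAt_extChartAt_symm (I := 𝓡 n) p).tendsto
      rwa [extChartAt_to_inv] at this
    refine (h4.comp h3).congr' ?_
    filter_upwards [hstay (R / 2) (by positivity) (by linarith), hε0] with i hi hi0
    exact (extChartAt (𝓡 n) p).left_inv (hi s ⟨by linarith, le_rfl⟩).2.1
  · rw [Asymptotics.isLittleO_iff]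
    intro η hη
    obtain ⟨r₁, hr₁, hw1⟩ := hSDw.exists_lintegral_le hs0 p (by positivity : 0 < η / 3)
    obtain ⟨r₂, hr₂, hω1⟩ := hSDω.exists_lintegral_le hs0 p (by positivity : 0 < η / 3)
    obtain ⟨δ₁, hδ₁, hed1⟩ := exists_edist_le_of_norm_extChartAt_lt (n := n) p hr₁
    obtain ⟨δ₂, hδ₂, hed2⟩ := exists_edist_le_of_norm_extChartAt_lt (n := n) p hr₂
    set r := min (R / 2) (min (δ₁ / 2) (δ₂ / 2)) with hr
    have hr0 : 0 < r := by positivity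
    have hrR : r < R := (min_le_left _ _).trans_lt (by linarith)
    have hr1 : r < δ₁ := ((min_le_right _ _).trans (min_le_left _ _)).trans_lt (by linarith)
    have hr2 : r < δ₂ := ((min_le_right _ _).trans (min_le_right _ _)).trans_lt (by linarith)
    filter_upwards [hε0, hεlt s hs0, hg, hx, hu, hxu, hstay r hr0 hrR, hε.eventually hw1,
      hε.eventually hω1] with i hi0 his hgi hxi hui hxui hst hwi hωi
    have h0 : 0 ≤ s - ε i := by linarith
    have hle : s - ε i ≤ s := by linarith
    have hIsub : Icc (s - ε i) s ⊆ Icc 0 S := Icc_subset_Icc h0 hsS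
    have hki := hk.mono_set hIsub
    have hbi := ae_restrict_of_ae_restrict_of_subset hIsub hb
    have hint : ∀ (v : ℝ → W) (m : ℝ → M), AEStronglyMeasurable v (volume.restrict (Icc 0 S)) →
        ContinuousOn m (Icc (s - ε i) s) → (∀ τ ∈ Icc (s - ε i) s,
          m τ ∈ (extChartAt (𝓡 n) p).source ∧
          ‖extChartAt (𝓡 n) p (m τ) - extChartAt (𝓡 n) p p‖ ≤ r) →
        IntegrableOn (fun τ => coordField (fun x => f τ x (v τ)) p (extChartAt (𝓡 n) p (m τ)))
          (Icc (s - ε i) s) := fun v m hv hm hin => by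
      refine Integrable.mono' hki (hf.aestronglyMeasurable_coordField_comp hR hsub h0 hsS hm
        (fun τ hτ => ⟨(hin τ hτ).1, (hin τ hτ).2.trans hrR.le⟩) hv) ?_
      filter_upwards [hbi, ae_restrict_mem measurableSet_Icc] with τ hτ hτm
      exact (hτ.2 _).1 _ (hmem ((hin τ hτm).2.trans hrR.le))
    have hI1 := hint w (x i) hw hxi.continuousOn fun τ hτ => (hst τ hτ).1
    have hI2 := hint w (u i) hw hui.continuousOn fun τ hτ => (hst τ hτ).2
    have hI3 := hint (fun _ => ω) (u i) aestronglyMeasurable_const hui.continuousOn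
      fun τ hτ => (hst τ hτ).2
    have e1 := norm_integral_coordField_sub_le hi0.le (by positivity) hwi
      (fun τ hτ => ⟨(hst τ hτ).1.1, hed1 _ (hst τ hτ).1.1 ((hst τ hτ).1.2.trans_lt hr1)⟩) hI1
    have e2 := norm_integral_coordField_sub_le hi0.le (by positivity) hwi
      (fun τ hτ => ⟨(hst τ hτ).2.1, hed1 _ (hst τ hτ).2.1 ((hst τ hτ).2.2.trans_lt hr1)⟩) hI2
    have e3 := norm_integral_coordField_sub_le hi0.le (by positivity) hωi
      (fun τ hτ => ⟨(hst τ hτ).2.1, hed2 _ (hst τ hτ).2.1 ((hst τ hτ).2.2.trans_lt hr2)⟩) hI3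
    have p1 := (hxi.isPrimitiveOn hle fun τ hτ => (hst τ hτ).1.1).sub_eq
      (left_mem_Icc.2 hle) (right_mem_Icc.2 hle)
    have p2 := (hui.isPrimitiveOn hle fun τ hτ => (hst τ hτ).2.1).sub_eq
      (left_mem_Icc.2 hle) (right_mem_Icc.2 hle)
    simp only [coordField_add_smul_sub] at p2
    have J2 := (intervalIntegrable_iff_integrableOn_Icc_of_le hle).2 hI2
    have J3 := (intervalIntegrable_iff_integrableOn_Icc_of_le hle).2 hI3
    rw [intervalIntegral_add_smul_sub J2 J3, hxui] at p2
    generalize (∫ τ in (s - ε i)..s,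
      coordField (fun x => f τ x (w τ)) p (extChartAt (𝓡 n) p (x i τ))) = A1 at *
    generalize (∫ τ in (s - ε i)..s,
      coordField (fun x => f τ x (w τ)) p (extChartAt (𝓡 n) p (u i τ))) = A2 at *
    generalize (∫ τ in (s - ε i)..s,
      coordField (fun x => f τ x ω) p (extChartAt (𝓡 n) p (u i τ))) = A3 at *
    generalize coordField (fun x => f s x (w s)) p (extChartAt (𝓡 n) p p) = F0 at *
    generalize coordField (fun x => f s x ω) p (extChartAt (𝓡 n) p p) = F1 at *
    -- The error is a convex combination of the freezing errors of the two fields along `u`, minus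
    -- that of the reference field along `x`.
    have hfin : extChartAt (𝓡 n) p (u i s) - extChartAt (𝓡 n) p (x i s) - ε i • g i • (F1 - F0) =
        (A2 - ε i • F0) + g i • ((A3 - ε i • F1) - (A2 - ε i • F0)) - (A1 - ε i • F0) := by
      rw [← sub_sub_sub_cancel_right (extChartAt (𝓡 n) p (u i s)) _
        (extChartAt (𝓡 n) p (x i (s - ε i))), p1, p2]
      module
    rw [hfin, Real.norm_of_nonneg hi0.le]
    have e4 := norm_add_smul_sub_le hgi.1 hgi.2 e2 e3
    refine (norm_sub_le _ _).trans ?_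
    nlinarith

end NeedleEffect

/-! ### Several needle variations -/

section Needles

open Asymptotics

variable {n : ℕ} {M : Type*} [EMetricSpace M] [ChartedSpace (EuclideanSpace ℝ (Fin n)) M]
  [IsManifold (𝓡 n) 2 M]
  [RiemannianBundle (fun x : M => TangentSpace (𝓡 n) x)]
  [IsContMDiffRiemannianBundle (𝓡 n) 1 (EuclideanSpace ℝ (Fin n))
      (fun x : M => TangentSpace (𝓡 n) x)]
  {W : Type*} [MetricSpace W] {f : ℝ → (x : M) → W → TangentSpace (𝓡 n) x} {S : ℝ}
  {w : ℝ → W} {y : ℝ → M}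

/-- The difference of the values of the field for `ω` and for the reference control, in the chart
at the point of the reference trajectory. -/
def needleVector (f : ℝ → (x : M) → W → TangentSpace (𝓡 n) x) (w : ℝ → W) (y : ℝ → M) (ω : W)
    (s : ℝ) : EuclideanSpace ℝ (Fin n) :=
  coordField (fun x => f s x ω) (y s) (extChartAt (𝓡 n) (y s) (y s)) -
    coordField (fun x => f s x (w s)) (y s) (extChartAt (𝓡 n) (y s) (y s))

/-- Transport of the effect of a needle variation at `b` to the final time. -/
theorem HypothesisSH.flow_needle_isLittleO (hf : HypothesisSH f S)
    (hw : AEStronglyMeasurable w (volume.restrict (Icc 0 S)))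
    (hy : IsSolution (fun s x => f s x (w s)) 0 S y) {a b : ℝ} (ha : 0 ≤ a) (hab : a < b)
    (hb : b ≤ S) {ω : W} (hSDw : IsScorzaDragoniPoint (fun s x => f s x (w s)) 0 S b)
    (hSDω : IsScorzaDragoniPoint (fun s x => f s x ω) 0 S b)
    {α : Type*} {l : Filter α} {ε g : α → ℝ} {Y : α → ℝ → M}
    (hε : Tendsto ε l (𝓝[>] 0)) (hg : ∀ᶠ i in l, 0 ≤ g i ∧ g i ≤ 1)
    (hY₁ : ∀ᶠ i in l, IsSolution (fun s x => f s x (w s)) a (b - ε i) (Y i))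
    (hY₂ : ∀ᶠ i in l, IsSolution (fun τ m => f τ m (w τ) + g i • (f τ m ω - f τ m (w τ)))
      (b - ε i) b (Y i))
    (h₁ : Tendsto (fun i => Y i a) l (𝓝 (y a)))
    (h₂ : (fun i => extChartAt (𝓡 n) (y a) (Y i a) - extChartAt (𝓡 n) (y a) (y a)) =O[l] ε) :
    Tendsto (fun i => Y i b) l (𝓝 (y b)) ∧
    (fun i => extChartAt (𝓡 n) (y b) (Y i b) - extChartAt (𝓡 n) (y b) (y b)) =O[l] ε ∧
    (fun i => extChartAt (𝓡 n) (y S) (flowMap (fun s x => f s x (w s)) b S (Y i b)) -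
      extChartAt (𝓡 n) (y S) (flowMap (fun s x => f s x (w s)) a S (Y i a)) -
      ε i • g i • coordFlowDifferential (fun s x => f s x (w s)) y b S
        (needleVector f w y ω b)) =o[l] ε := by
  set X : ℝ → (x : M) → TangentSpace (𝓡 n) x := fun s x => f s x (w s) with hXdef
  have hX : IsRegularField X 0 S := hf.isRegularField hw
  have haS : a ≤ S := hab.le.trans hb
  have h0b : 0 ≤ b := ha.trans hab.le
  have hXab := hX.mono ha hb
  have hXaS := hX.mono ha le_rfl
  have hXbS := hX.mono h0b le_rfl
  have hyab := hy.mono ha hb hab.le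
  have hyaS := hy.mono ha le_rfl haS
  have hybS := hy.mono h0b le_rfl hb
  have hε0 : ∀ᶠ i in l, 0 < ε i := hε.eventually self_mem_nhdsWithin
  have hεlt : ∀ᶠ i in l, ε i < b - a :=
    (tendsto_nhds_of_tendsto_nhdsWithin hε).eventually (gt_mem_nhds (sub_pos.2 hab))
  have hex : ∀ᶠ i in l, ∃ z : ℝ → M, IsSolution X a S z ∧ z a = Y i a :=
    h₁.eventually (hyaS.isFlowDifferentiable hXaS le_rfl haS le_rfl).1
  -- `x i` follows the reference field on all of `[a, S]` from the initial point of `Y i`. It exists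
  -- eventually, since the flow is defined near `y a`; elsewhere the choice is a dummy.
  have hch : ∀ i, ∃ z : ℝ → M, (∃ z : ℝ → M, IsSolution X a S z ∧ z a = Y i a) →
      IsSolution X a S z ∧ z a = Y i a := fun i => by
    by_cases h : ∃ z : ℝ → M, IsSolution X a S z ∧ z a = Y i a
    · exact ⟨h.choose, fun _ => h.choose_spec⟩
    · exact ⟨Y i, fun h' => (h h').elim⟩
  choose x hx' using hch
  have hx : ∀ᶠ i in l, IsSolution X a S (x i) ∧ x i a = Y i a := hex.mono fun i => hx' i
  have hxb : ∀ᶠ i in l, flowMap X a b (Y i a) = x i b := hx.mono fun i hi => by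
    rw [← hi.2]; exact flowMap_eq hXab hab.le (hi.1.mono le_rfl hb hab.le)
  have hxS : ∀ᶠ i in l, flowMap X b S (x i b) = flowMap X a S (Y i a) := hx.mono fun i hi => by
    rw [← hi.2, flowMap_eq hXaS haS hi.1,
      flowMap_eq hXbS hb (hi.1.mono hab.le le_rfl hb)]
  have hxlim : Tendsto (fun i => x i b) l (𝓝 (y b)) := by
    have h3 := (hyab.isFlowDifferentiable hXab le_rfl hab.le le_rfl).2.continuousAt.tendsto.comp h₁
    rw [flowMap_eq hXab hab.le hyab] at h3
    exact h3.congr' hxb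
  have hxO : (fun i => extChartAt (𝓡 n) (y b) (x i b) - extChartAt (𝓡 n) (y b) (y b)) =O[l] ε := by
    have h3 := ((flowMap_isLittleO hXab hab.le hyab h₁).trans_isBigO h₂).isBigO
    have h4 := ((coordFlowDifferential X y a b).isBigO_comp
      (fun i => extChartAt (𝓡 n) (y a) (Y i a) - extChartAt (𝓡 n) (y a) (y a)) l).trans h₂
    refine (h3.add h4).congr' ?_ EventuallyEq.rfl
    filter_upwards [hxb] with i hi
    rw [hi, sub_add_cancel]
  -- Before the needle `Y i` also follows the reference field, so by uniqueness it enters the needle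
  -- at the same point as `x i`.
  have hnd := hf.needle_isLittleO (x := x) (u := Y) (p := y b) hw (ha.trans_lt hab) hb hSDw hSDω hε
    hg (by
      filter_upwards [hx, hε0, hεlt] with i hi hi0 hilt
      exact hi.1.mono (by linarith) hb (by linarith)) hY₂ (by
      filter_upwards [hx, hY₁, hε0, hεlt] with i hi hYi hi0 hilt
      have hle : a ≤ b - ε i := by linarith
      exact (hYi.eqOn (hX.mono ha (by linarith)) (hi.1.mono le_rfl (by linarith) hle) hi.2.symm)
        (right_mem_Icc.2 hle)) hxlim
  have hΔ : (fun i => ε i • g i • needleVector f w y ω b) =O[l] ε := by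
    refine IsBigO.of_bound ‖needleVector f w y ω b‖ ?_
    filter_upwards [hg] with i hi
    rw [norm_smul, norm_smul, mul_comm, Real.norm_of_nonneg hi.1]
    exact mul_le_mul_of_nonneg_right (mul_le_of_le_one_left (norm_nonneg _) hi.2) (norm_nonneg _)
  have hYx : (fun i => extChartAt (𝓡 n) (y b) (Y i b) - extChartAt (𝓡 n) (y b) (x i b)) =O[l] ε := by
    refine (hnd.2.isBigO.add hΔ).congr_left fun i => ?_
    simp only [needleVector, sub_add_cancel]
  have hYO : (fun i => extChartAt (𝓡 n) (y b) (Y i b) - extChartAt (𝓡 n) (y b) (y b)) =O[l] ε :=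
    (hYx.add hxO).congr_left fun i => sub_add_sub_cancel _ _ _
  refine ⟨hnd.1, hYO, ?_⟩
  -- The flow from `b` to `S` is expanded at both `Y i b` and `x i b`, and the expansions are
  -- subtracted. The flow of `x i b` equals that of `Y i a` from time `a`.
  have hf1 := (flowMap_isLittleO hXbS hb hybS hnd.1).trans_isBigO hYO
  have hf2 := (flowMap_isLittleO hXbS hb hybS hxlim).trans_isBigO hxO
  have hf3 := ((coordFlowDifferential X y b S).isBigO_comp _ l).trans_isLittleO hnd.2
  refine ((hf1.sub hf2).add hf3).congr' ?_ EventuallyEq.rfl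
  filter_upwards [hxS] with i hi
  rw [hi]
  simp only [map_sub, map_smul, needleVector]
  module

/-- The control equal to `ω i` during the time `e` before `t i`, and to `w` at the other times. -/
def needleControl {N : ℕ} (w : ℝ → W) (ω : Fin N → W) (t : Fin N → ℝ) (e : ℝ) (i : Fin N)
    (s : ℝ) : W :=
  if s ∈ Ioc (t i - e) (t i) then ω i else w s

theorem needleControl_mem_extendedControls {N : ℕ} (hw : w ∈ extendedControls W S)
    (ω : Fin N → W) (t : Fin N → ℝ) (e : ℝ) (i : Fin N) :
    needleControl w ω t e i ∈ extendedControls W S := by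
  have h1 : AEStronglyMeasurable (needleControl w ω t e i) (volume.restrict (Icc 0 S)) :=
    AEStronglyMeasurable.piecewise (s := Ioc (t i - e) (t i)) measurableSet_Ioc
      aestronglyMeasurable_const hw.1.restrict
  refine ⟨h1, ?_⟩
  obtain ⟨w₀, hw₀⟩ := hw.2
  refine ⟨w₀, Integrable.mono' (g := fun s => dist (ω i) w₀ + dist (w s) w₀)
    ((integrable_const _).add hw₀) (h1.dist aestronglyMeasurable_const)
    (Eventually.of_forall fun s => ?_)⟩
  rw [Real.norm_of_nonneg dist_nonneg, needleControl]
  split_ifs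
  · exact le_add_of_nonneg_right dist_nonneg
  · exact le_add_of_nonneg_left dist_nonneg

theorem convexifiedField_eq_of_notMem {N : ℕ} {ω : Fin N → W} {t : Fin N → ℝ} {e : ℝ}
    {γ : Fin N → ℝ} {s : ℝ} (h : ∀ j, s ∉ Ioc (t j - e) (t j)) (x : M) :
    convexifiedField f γ w (needleControl w ω t e) s x = f s x (w s) := by
  rw [convexifiedField, Finset.sum_eq_zero, add_zero]
  intro j _
  rw [needleControl, if_neg (h j), sub_self, smul_zero]

theorem convexifiedField_eq_of_mem {N : ℕ} {ω : Fin N → W} {t : Fin N → ℝ} {e : ℝ}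
    {γ : Fin N → ℝ} {s : ℝ} {i : Fin N} (hi : s ∈ Ioc (t i - e) (t i))
    (h : ∀ j ≠ i, s ∉ Ioc (t j - e) (t j)) (x : M) :
    convexifiedField f γ w (needleControl w ω t e) s x
      = f s x (w s) + γ i • (f s x (ω i) - f s x (w s)) := by
  rw [convexifiedField, Finset.sum_eq_single i, needleControl, if_pos hi]
  · intro j _ hj
    rw [needleControl, if_neg (h j hj), sub_self, smul_zero]
  · exact fun h => (h (Finset.mem_univ _)).elim

/-- First order expansion of the final point of the trajectories with several needles. -/
theorem HypothesisSH.needles_isLittleO (hf : HypothesisSH f S)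
    (hw : AEStronglyMeasurable w (volume.restrict (Icc 0 S)))
    (hy : IsSolution (fun s x => f s x (w s)) 0 S y) (hS : 0 ≤ S) {N : ℕ} {ω : Fin N → W}
    {t : Fin N → ℝ}
    (ht : StrictMono t) (ht0 : ∀ i, 0 < t i) (htS : ∀ i, t i ≤ S)
    (hSDw : ∀ i, IsScorzaDragoniPoint (fun s x => f s x (w s)) 0 S (t i))
    (hSDω : ∀ i j, IsScorzaDragoniPoint (fun s x => f s x (ω j)) 0 S (t i))
    {α : Type*} {l : Filter α} {ε : α → ℝ} {γ : α → Fin N → ℝ} {Y : α → ℝ → M}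
    (hε : Tendsto ε l (𝓝[>] 0)) (hγ : ∀ᶠ i in l, γ i ∈ simplexHull N)
    (hY : ∀ᶠ i in l, IsSolution (convexifiedField f (γ i) w (needleControl w ω t (ε i))) 0 S (Y i))
    (hY0 : ∀ᶠ i in l, Y i 0 = y 0) :
    Tendsto (fun i => Y i S) l (𝓝 (y S)) ∧
    (fun i => extChartAt (𝓡 n) (y S) (Y i S) - extChartAt (𝓡 n) (y S) (y S) -
      ε i • ∑ j, γ i j • coordFlowDifferential (fun s x => f s x (w s)) y (t j) S
        (needleVector f w y (ω j) (t j))) =o[l] ε := by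
  set X : ℝ → (x : M) → TangentSpace (𝓡 n) x := fun s x => f s x (w s) with hXdef
  have hX : IsRegularField X 0 S := hf.isRegularField hw
  set v : Fin N → EuclideanSpace ℝ (Fin n) := fun j => coordFlowDifferential X y (t j) S
        (needleVector f w y (ω j) (t j)) with hv
  have hε0 : ∀ᶠ i in l, 0 < ε i := hε.eventually self_mem_nhdsWithin
  have hεlt : ∀ e > 0, ∀ᶠ i in l, ε i < e := fun e he =>
    (tendsto_nhds_of_tendsto_nhdsWithin hε).eventually (gt_mem_nhds he)
  -- Induction on the number of needles already passed: `a` is `0` or the time of the last one. What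
  -- is expanded is the final point that the reference flow would reach from `Y i a`.
  have hind : ∀ k ≤ N, ∃ a, 0 ≤ a ∧ a ≤ S ∧ (∀ j : Fin N, (j : ℕ) < k → t j ≤ a) ∧
      (∀ j : Fin N, k ≤ (j : ℕ) → a < t j) ∧
      Tendsto (fun i => Y i a) l (𝓝 (y a)) ∧
      (fun i => extChartAt (𝓡 n) (y a) (Y i a) - extChartAt (𝓡 n) (y a) (y a)) =O[l] ε ∧
      (fun i => extChartAt (𝓡 n) (y S) (flowMap X a S (Y i a)) - extChartAt (𝓡 n) (y S) (y S) -
        ε i • ∑ j : Fin N, if (j : ℕ) < k then γ i j • v j else 0) =o[l] ε := by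
    intro k
    induction k with
    | zero =>
      refine fun _ => ⟨0, le_rfl, hS, fun j hj => (Nat.not_lt_zero _ hj).elim, fun j _ => ht0 j,
        ?_, ?_, ?_⟩
      · exact tendsto_const_nhds.congr' (hY0.mono fun i hi => hi.symm)
      · refine (isBigO_zero ε l).congr' ?_ EventuallyEq.rfl
        filter_upwards [hY0] with i hi
        rw [hi, sub_self]
      · refine (isLittleO_zero ε l).congr' ?_ EventuallyEq.rfl
        filter_upwards [hY0] with i hi
        rw [hi, flowMap_eq hX hS hy]
        simp
    | succ k ih =>
      intro hk
      obtain ⟨a, ha0, haS, hlt, hge, hi1, hi2, hi3⟩ := ih (by omega)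
      set j₀ : Fin N := ⟨k, hk⟩ with hj₀
      have hab : a < t j₀ := hge j₀ le_rfl
      -- Needles shorter than the gap to the next time do not overlap.
      have hsep : ∃ e > 0, ∀ j, j₀ < j → e ≤ t j - t j₀ := by
        by_cases h : ∃ j : Fin N, j₀ < j
        · obtain ⟨j, hj⟩ := h
          have hk1 : k + 1 < N := lt_of_le_of_lt (Nat.succ_le_of_lt hj) j.2
          refine ⟨t ⟨k + 1, hk1⟩ - t j₀, sub_pos.2 (ht (Nat.lt_succ_self k)), fun j' hj' => ?_⟩
          exact sub_le_sub_right (ht.monotone (Nat.succ_le_of_lt hj')) _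
        · exact ⟨1, one_pos, fun j hj => (h ⟨j, hj⟩).elim⟩
      obtain ⟨e, he, hsep⟩ := hsep
      have hg : ∀ᶠ i in l, 0 ≤ γ i j₀ ∧ γ i j₀ ≤ 1 := hγ.mono fun i hi =>
        ⟨hi.1 j₀, (Finset.single_le_sum (fun j _ => hi.1 j) (Finset.mem_univ j₀)).trans hi.2⟩
      have hsplit : ∀ (i : α) (τ : ℝ), a < τ → τ ≤ t j₀ → ε i < e → 0 < ε i →
          ∀ j ≠ j₀, τ ∉ Ioc (t j - ε i) (t j) := fun i τ h1 h2 h3 h4 j hj h5 => by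
        rcases lt_or_gt_of_ne hj with h | h
        · exact absurd (h5.2.trans (hlt j h)) (not_le.2 h1)
        · linarith [hsep j h, h5.1]
      have hY₁ : ∀ᶠ i in l, IsSolution X a (t j₀ - ε i) (Y i) := by
        filter_upwards [hY, hε0, hεlt e he, hεlt _ (sub_pos.2 hab)] with i hYi hi0 hie hia
        refine (hYi.mono ha0 (by linarith [htS j₀]) (by linarith)).congr_field ?_
        have h2 : ∀ᵐ s ∂(volume.restrict (Icc a (t j₀ - ε i))), s ≠ a :=
          ae_restrict_of_ae (by simp [ae_iff])
        filter_upwards [h2, ae_restrict_mem measurableSet_Icc] with τ hτa hτ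
        refine (convexifiedField_eq_of_notMem (fun j => ?_) _).symm
        by_cases hj : j = j₀
        · subst hj
          exact fun h => absurd h.1 (not_lt.2 hτ.2)
        · exact hsplit i τ (lt_of_le_of_ne hτ.1 hτa.symm) (by linarith [hτ.2]) hie hi0 j hj
      have hY₂ : ∀ᶠ i in l, IsSolution (fun τ m => f τ m (w τ) + γ i j₀ •
          (f τ m (ω j₀) - f τ m (w τ))) (t j₀ - ε i) (t j₀) (Y i) := by
        filter_upwards [hY, hε0, hεlt e he, hεlt _ (sub_pos.2 hab)] with i hYi hi0 hie hia
        refine (hYi.mono (by linarith) (htS j₀) (by linarith)).congr_field ?_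
        have h2 : ∀ᵐ s ∂(volume.restrict (Icc (t j₀ - ε i) (t j₀))), s ≠ t j₀ - ε i :=
          ae_restrict_of_ae (by simp [ae_iff])
        filter_upwards [h2, ae_restrict_mem measurableSet_Icc] with τ hτa hτ
        have hτ' : t j₀ - ε i < τ := lt_of_le_of_ne hτ.1 hτa.symm
        exact (convexifiedField_eq_of_mem ⟨hτ', hτ.2⟩
          (hsplit i τ (by linarith) hτ.2 hie hi0) _).symm
      obtain ⟨h1, h2, h3⟩ := hf.flow_needle_isLittleO hw hy ha0 hab (htS j₀) (hSDw j₀)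
        (hSDω j₀ j₀) hε hg hY₁ hY₂ hi1 hi2
      refine ⟨t j₀, (ht0 j₀).le, htS j₀, fun j hj => ht.monotone (Nat.lt_succ_iff.1 hj),
        fun j hj => ht (Nat.lt_of_succ_le hj), h1, h2, ?_⟩
      refine (hi3.add h3).congr_left fun i => ?_
      have hsum : (∑ j : Fin N, if (j : ℕ) < k + 1 then γ i j • v j else 0) =
          (∑ j : Fin N, if (j : ℕ) < k then γ i j • v j else 0) + γ i j₀ • v j₀ := by
        rw [← sub_eq_iff_eq_add', ← Finset.sum_sub_distrib, Finset.sum_eq_single j₀]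
        · simp [hj₀]
        · intro j _ hj
          have : (j : ℕ) ≠ k := fun h => hj (Fin.ext h)
          have h4 : (j : ℕ) < k + 1 ↔ (j : ℕ) < k := by omega
          simp only [h4, sub_self]
        · exact fun h => (h (Finset.mem_univ _)).elim
      rw [hsum, smul_add]
      simp only [hv]
      abel
  -- After the last needle the trajectory follows the reference field, so the predicted final point
  -- is the actual one.
  obtain ⟨a, ha0, haS, hlt, -, hi1, -, hi3⟩ := hind N le_rfl
  have hYa : ∀ᶠ i in l, flowMap X a S (Y i a) = Y i S := by
    filter_upwards [hY] with i hYi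
    refine flowMap_eq (hX.mono ha0 le_rfl) haS ((hYi.mono ha0 le_rfl haS).congr_field ?_)
    have h2 : ∀ᵐ s ∂(volume.restrict (Icc a S)), s ≠ a := ae_restrict_of_ae (by simp [ae_iff])
    filter_upwards [h2, ae_restrict_mem measurableSet_Icc] with τ hτa hτ
    refine (convexifiedField_eq_of_notMem (fun j hj => ?_) _).symm
    exact absurd (hj.2.trans (hlt j j.2)) (not_le.2 (lt_of_le_of_ne hτ.1 hτa.symm))
  refine ⟨?_, ?_⟩
  · have hyaS := hy.mono ha0 le_rfl haS
    have h3 := (hyaS.isFlowDifferentiable (hX.mono ha0 le_rfl) le_rfl haS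
      le_rfl).2.continuousAt.tendsto.comp hi1
    rw [flowMap_eq (hX.mono ha0 le_rfl) haS hyaS] at h3
    exact h3.congr' hYa
  · refine hi3.congr' ?_ EventuallyEq.rfl
    filter_upwards [hYa] with i hi
    rw [hi]
    simp only [Fin.is_lt, if_true, hv]

end Needles

/-! ### Intersection of a variational cone and an approximating cone -/

section Intersection

variable {E : Type*} [NormedAddCommGroup E] [InnerProductSpace ℝ E] [FiniteDimensional ℝ E]
  {G G' : Type*} [NormedAddCommGroup G] [NormedSpace ℝ G] [NormedAddCommGroup G'] [NormedSpace ℝ G']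

/-- A linear map that sends a convex cone onto a linear subspace has a continuous section with
values in the cone. -/
theorem exists_continuous_section (C : PointedCone ℝ G) (L : G →L[ℝ] E) (V : Submodule ℝ E)
    (h : L '' (C : Set G) = V) : ∃ τ : V → G, Continuous τ ∧ τ 0 = 0 ∧ (∀ u, τ u ∈ C) ∧
      ∀ u, L (τ u) = u := by
  set b := Module.finBasis ℝ V
  have hmem : ∀ u : V, ∃ g ∈ C, L g = u := fun u => by
    have : (u : E) ∈ L '' (C : Set G) := by rw [h]; exact u.2
    exact this
  choose g hgC hgL using hmem
  have hc : ∀ j, Continuous fun u : V => b.repr u j := fun j =>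
    (b.coord j).continuous_of_finiteDimensional
  -- Both `b j` and `-b j` are lifted to the cone, because its image is a subspace. The positive and
  -- negative parts of the coordinates then give continuous nonnegative coefficients.
  refine ⟨fun u => ∑ j, (max (b.repr u j) 0 • g (b j) + max (-b.repr u j) 0 • g (-b j)),
    ?_, ?_, fun u => ?_, fun u => ?_⟩
  · exact continuous_finsetSum _ fun j _ =>
      (((hc j).max continuous_const).smul continuous_const).add
        (((hc j).neg.max continuous_const).smul continuous_const)
  · simp
  · exact sum_mem fun j _ => add_mem (C.smul_mem (le_max_right _ _) (hgC _))
      (C.smul_mem (le_max_right _ _) (hgC _))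
  · have h1 : ∀ j, L (max (b.repr u j) 0 • g (b j) + max (-b.repr u j) 0 • g (-b j)) =
        ((b.repr u j • b j : V) : E) := fun j => by
      rw [map_add, map_smul, map_smul, hgL, hgL, Submodule.coe_neg, smul_neg, ← sub_eq_add_neg,
        ← sub_smul, Submodule.coe_smul]
      congr 1
      rcases le_total 0 (b.repr u j) with h2 | h2
      · rw [max_eq_left h2, max_eq_right (by linarith), sub_zero]
      · rw [max_eq_right h2, max_eq_left (by linarith), zero_sub, neg_neg]
    rw [map_sum, Finset.sum_congr rfl fun j _ => h1 j, ← Submodule.coe_sum, b.sum_repr]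

/-- Lifts the two projections of the direct sum. The second component is negated before lifting,
which a subspace allows, so that a difference of cone vectors represents `x`. -/
theorem exists_continuous_decomposition (C : PointedCone ℝ G) (L : G →L[ℝ] E)
    (C' : PointedCone ℝ G') (L' : G' →L[ℝ] E)
    (h : AreComplementarySubspaces (L '' (C : Set G)) (L' '' (C' : Set G'))) :
    ∃ (τ : E → G) (τ' : E → G'), Continuous τ ∧ Continuous τ' ∧ τ 0 = 0 ∧ τ' 0 = 0 ∧
      (∀ x, τ x ∈ C) ∧ (∀ x, τ' x ∈ C') ∧ ∀ x, L (τ x) - L' (τ' x) = x := by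
  obtain ⟨V₁, V₂, h₁, h₂, hV⟩ := h
  obtain ⟨σ, hσ, hσ0, hσC, hσL⟩ := exists_continuous_section C L V₁ h₁.symm
  obtain ⟨σ', hσ', hσ0', hσC', hσL'⟩ := exists_continuous_section C' L' V₂ h₂.symm
  set e := (Submodule.prodEquivOfIsCompl V₁ V₂ hV).symm with he
  have hc : Continuous e := (e : E →ₗ[ℝ] V₁ × V₂).continuous_of_finiteDimensional
  refine ⟨fun x => σ (e x).1, fun x => σ' (-(e x).2), hσ.comp (continuous_fst.comp hc),
    hσ'.comp (continuous_snd.comp hc).neg, by simp [hσ0], by simp [hσ0'], fun x => hσC _,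
    fun x => hσC' _, fun x => ?_⟩
  rw [hσL, hσL', Submodule.coe_neg, sub_neg_eq_add]
  have := (Submodule.prodEquivOfIsCompl V₁ V₂ hV).apply_symm_apply x
  rwa [Submodule.coe_prodEquivOfIsCompl'] at this

/-- Two small continuous perturbations of complementary cones intersect. -/
theorem exists_eq_of_norm_sub_le (L : G →L[ℝ] E) (L' : G' →L[ℝ] E) {τ : E → G} {τ' : E → G'}
    (hτ : Continuous τ) (hτ' : Continuous τ') (hL : ∀ x, L (τ x) - L' (τ' x) = x) {κ ε : ℝ}
    (hκ : 0 < κ) (hε : 0 < ε) {A : Set G} {A' : Set G'} (hA : ∀ x, ‖x‖ ≤ κ → τ x ∈ A)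
    (hA' : ∀ x, ‖x‖ ≤ κ → ε • τ' x ∈ A') {Z : G → E} {H : G' → E} (hZ : ContinuousOn Z A)
    (hH : ContinuousOn H A') (hZA : ∀ g ∈ A, ‖Z g - ε • L g‖ ≤ κ / 16 * ε)
    (hHA : ∀ g ∈ A', ‖H g - L' g‖ ≤ κ / 16 * ε) : ∃ g ∈ A, ∃ g' ∈ A', Z g = H g' := by
  -- A fixed point of this map is exactly a coincidence of `Z` and `H`. Replacing both by their
  -- linear parts turns it into the zero map, so its norm is at most the two errors, `κ / 16 + κ /
  -- 16 = κ / 8`.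
  have hcont : ContinuousOn (fun x => x - ε⁻¹ • (Z (τ x) - H (ε • τ' x))) (Metric.closedBall 0 κ) := by
    have hm : ∀ x ∈ Metric.closedBall (0 : E) κ, ‖x‖ ≤ κ := fun x hx => by simpa using hx
    exact continuousOn_id.sub (((hZ.comp hτ.continuousOn fun x hx => hA x (hm x hx)).sub
      (hH.comp (hτ'.const_smul ε).continuousOn fun x hx => hA' x (hm x hx))).const_smul _)
  obtain ⟨x, hx, hfix⟩ := exists_fixedPoint_of_continuousOn hκ hcont fun x hx => by
    have h1 : x - ε⁻¹ • (Z (τ x) - H (ε • τ' x)) =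
        ε⁻¹ • ((H (ε • τ' x) - L' (ε • τ' x)) - (Z (τ x) - ε • L (τ x))) := by
      nth_rewrite 1 [← hL x]
      rw [map_smul, ← inv_smul_smul₀ hε.ne' (L (τ x) - L' (τ' x)), ← smul_sub]
      congr 1
      module
    rw [h1, norm_smul, norm_inv, Real.norm_of_nonneg hε.le, inv_mul_le_iff₀ hε]
    refine (norm_sub_le _ _).trans ?_
    linarith [hZA _ (hA x hx), hHA _ (hA' x hx)]
  refine ⟨τ x, hA x hx, ε • τ' x, hA' x hx, ?_⟩
  have h2 := sub_eq_self.1 hfix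
  exact sub_eq_zero.1 ((smul_eq_zero.1 h2).resolve_left (inv_ne_zero hε.ne'))

/-- The cone of the nonnegative vectors. -/
def nonnegCone (N : ℕ) : PointedCone ℝ (Fin N → ℝ) where
  carrier := {γ | ∀ i, 0 ≤ γ i}
  zero_mem' := fun _ => le_rfl
  add_mem' := fun ha hb i => add_nonneg (ha i) (hb i)
  smul_mem' := fun c _ ha i => mul_nonneg c.2 (ha i)

/-- The linear map with the given values on the vectors of the standard basis. -/
def combination {N : ℕ} (v : Fin N → E) : (Fin N → ℝ) →L[ℝ] E :=
  ∑ i, (ContinuousLinearMap.proj i : (Fin N → ℝ) →L[ℝ] ℝ).smulRight (v i)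

theorem combination_apply {N : ℕ} (v : Fin N → E) (γ : Fin N → ℝ) :
    combination v γ = ∑ i, γ i • v i := by
  simp [combination]

theorem combination_image_nonnegCone {N : ℕ} (v : Fin N → E) :
    combination v '' (nonnegCone N : Set (Fin N → ℝ)) = PointedCone.hull ℝ (Set.range v) := by
  ext x
  rw [SetLike.mem_coe, Submodule.mem_span_range_iff_exists_fun]
  constructor
  · rintro ⟨γ, hγ, rfl⟩
    exact ⟨fun i => ⟨γ i, hγ i⟩, by rw [combination_apply]; rfl⟩
  · rintro ⟨c, rfl⟩
    exact ⟨fun i => (c i : ℝ), fun i => (c i).2, by rw [combination_apply]; rfl⟩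

theorem simplexHull_mem_nhdsWithin (N : ℕ) :
    simplexHull N ∈ 𝓝[(nonnegCone N : Set (Fin N → ℝ))] 0 := by
  have h1 : Continuous fun γ : Fin N → ℝ => ∑ i, γ i :=
    continuous_finsetSum _ fun i _ => continuous_apply i
  have h2 : ∀ᶠ γ : Fin N → ℝ in 𝓝 0, ∑ i, γ i < 1 :=
    h1.continuousAt.eventually (gt_mem_nhds (by simp))
  filter_upwards [nhdsWithin_le_nhds h2, self_mem_nhdsWithin] with γ hγ hγ0
  exact ⟨hγ0, hγ.le⟩

/-- Uniform continuity, near a compact set, of a function that is continuous on a neighbourhood. -/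
theorem exists_edist_lt_imp {X Y : Type*} [PseudoEMetricSpace X] [PseudoMetricSpace Y] {φ : X → Y}
    {K O : Set X} (hK : IsCompact K) (hO : IsOpen O) (hKO : K ⊆ O) (hφ : ContinuousOn φ O) {η : ℝ}
    (hη : 0 < η) : ∃ δ : ℝ, 0 < δ ∧ ∀ x ∈ K, ∀ x', edist x x' < ENNReal.ofReal δ →
      x' ∈ O ∧ dist (φ x) (φ x') < η := by
  have h1 := hK.uniformContinuousAt_of_continuousAt φ
    (fun x hx => hφ.continuousAt (hO.mem_nhds (hKO hx))) (Metric.dist_mem_uniformity hη)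
  obtain ⟨V, hV, -, hVO⟩ := lebesgue_number_of_compact_open hK hO hKO
  obtain ⟨δ, hδ, h2⟩ := mem_uniformity_edist.1 (inter_mem h1 hV)
  obtain ⟨δ', hδ', h3⟩ := ENNReal.lt_iff_exists_real_btwn.1 hδ
  refine ⟨δ', ENNReal.ofReal_pos.1 h3.1, fun x hx x' hxx' => ?_⟩
  have h4 := h2 (hxx'.trans h3.2)
  exact ⟨hVO x hx h4.2, h4.1 hx⟩

end Intersection

/-! ### The main theorem -/

section Main

variable {n : ℕ} {M : Type*} [EMetricSpace M] [ChartedSpace (EuclideanSpace ℝ (Fin n)) M]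
  {W : Type*} [MetricSpace W] {f : ℝ → (x : M) → W → TangentSpace (𝓡 n) x} {S : ℝ}
  {w : ℝ → W} {y : ℝ → M}

theorem edist_le_controlDist {y₀ : M} {w₁ w₂ : ℝ → W} {y₁ y₂ : ℝ → M}
    (h₁ : IsTrajectory f y₀ S w₁ y₁) (h₂ : IsTrajectory f y₀ S w₂ y₂) {s : ℝ} (hs : s ∈ Icc 0 S) :
    edist (y₁ s) (y₂ s) ≤ controlDist f y₀ S w₁ w₂ :=
  le_iSup_of_le y₁ (le_iSup_of_le h₁ (le_iSup_of_le y₂ (le_iSup_of_le h₂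
    (le_iSup_of_le s (le_iSup_of_le hs le_rfl)))))

variable [IsManifold (𝓡 n) 2 M]
  [RiemannianBundle (fun x : M => TangentSpace (𝓡 n) x)]
  [IsContMDiffRiemannianBundle (𝓡 n) 1 (EuclideanSpace ℝ (Fin n))
      (fun x : M => TangentSpace (𝓡 n) x)]

/-- The expansion of the final point of the trajectories with several needles is uniform. -/
theorem HypothesisSH.eventually_needles (hf : HypothesisSH f S)
    (hw : AEStronglyMeasurable w (volume.restrict (Icc 0 S)))
    (hy : IsSolution (fun s x => f s x (w s)) 0 S y) (hS : 0 ≤ S) {N : ℕ} {ω : Fin N → W}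
    {t : Fin N → ℝ}
    (ht : StrictMono t) (ht0 : ∀ i, 0 < t i) (htS : ∀ i, t i ≤ S)
    (hSDw : ∀ i, IsScorzaDragoniPoint (fun s x => f s x (w s)) 0 S (t i))
    (hSDω : ∀ i j, IsScorzaDragoniPoint (fun s x => f s x (ω j)) 0 S (t i))
    {K : Set M} (hK : K ∈ 𝓝 (y S)) {η : ℝ} (hη : 0 < η) :
    ∀ᶠ e in 𝓝[>] (0 : ℝ), ∀ γ ∈ simplexHull N, ∀ Y : ℝ → M,
      IsSolution (convexifiedField f γ w (needleControl w ω t e)) 0 S Y → Y 0 = y 0 →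
      Y S ∈ K ∧ ‖extChartAt (𝓡 n) (y S) (Y S) - extChartAt (𝓡 n) (y S) (y S) -
        e • combination (fun j => coordFlowDifferential (fun s x => f s x (w s)) y (t j) S
        (needleVector f w y (ω j) (t j))) γ‖ ≤ η * e := by
  -- Running the expansion along the filter of all triples `(e, γ, Y)` with `e → 0⁺` makes it
  -- uniform in `γ` and `Y`.
  set l : Filter (ℝ × (Fin N → ℝ) × (ℝ → M)) := comap Prod.fst (𝓝[>] 0) ⊓
    𝓟 {q | q.2.1 ∈ simplexHull N ∧
      IsSolution (convexifiedField f q.2.1 w (needleControl w ω t q.1)) 0 S q.2.2 ∧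
      q.2.2 0 = y 0} with hl
  have hε : Tendsto (fun q : ℝ × (Fin N → ℝ) × (ℝ → M) => q.1) l (𝓝[>] 0) :=
    tendsto_comap.mono_left inf_le_left
  have hP : ∀ᶠ q : ℝ × (Fin N → ℝ) × (ℝ → M) in l, q.2.1 ∈ simplexHull N ∧
      IsSolution (convexifiedField f q.2.1 w (needleControl w ω t q.1)) 0 S q.2.2 ∧
      q.2.2 0 = y 0 := mem_inf_of_right (mem_principal_self _)
  obtain ⟨h1, h2⟩ := hf.needles_isLittleO hw hy hS ht ht0 htS hSDw hSDω hε
    (hP.mono fun q hq => hq.1) (hP.mono fun q hq => hq.2.1) (hP.mono fun q hq => hq.2.2)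
  have h3 := ((h1.eventually hK).and (h2.def hη)).and (hε.eventually self_mem_nhdsWithin)
  rw [hl, eventually_inf_principal, eventually_comap] at h3
  filter_upwards [h3] with e he γ hγ Y hY hY0
  obtain ⟨⟨h4, h5⟩, h6⟩ := he (e, γ, Y) rfl ⟨hγ, hY, hY0⟩
  rw [Real.norm_of_nonneg (le_of_lt h6)] at h5
  rw [combination_apply]
  exact ⟨h4, h5⟩

/-- If the extended variational cone is a subspace complementary to an approximating cone to the
target, the target is reached arbitrarily near the end point of the reference trajectory. -/
theorem HypothesisSH.mem_closure_reachableSet_inter (hf : HypothesisSH f S) {y₀ : M}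
    {V : Set (ℝ → W)} {T : Set M} (hV : IsAbundant f y₀ S V) (hw : w ∈ extendedControls W S)
    (hy : IsTrajectory f y₀ S w y) {N : ℕ} (hN : 0 < N) {ω : Fin N → W} {t : Fin N → ℝ}
    (ht : StrictMono t) (ht0 : ∀ i, 0 < t i) (htS : ∀ i, t i ≤ S)
    (hSDw : ∀ i, IsScorzaDragoniPoint (fun s x => f s x (w s)) 0 S (t i))
    (hSDω : ∀ i j, IsScorzaDragoniPoint (fun s x => f s x (ω j)) 0 S (t i))
    {m : ℕ} {F : EuclideanSpace ℝ (Fin m) → Set M}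
    {Γ : PointedCone ℝ (EuclideanSpace ℝ (Fin m))} {U : Set (EuclideanSpace ℝ (Fin m))}
    (hU : U ∈ 𝓝 0) (L : EuclideanSpace ℝ (Fin m) →L[ℝ] EuclideanSpace ℝ (Fin n))
    (hF : IsQDQ (fun γ => extChartAt (𝓡 n) (y S) '' (F γ ∩ (extChartAt (𝓡 n) (y S)).source))
      {L} 0 (extChartAt (𝓡 n) (y S) (y S)) (Γ ∩ U)) (hFT : ∀ γ ∈ Γ, F γ ⊆ T)
    (hcompl : AreComplementarySubspaces (combination (fun j =>
      coordFlowDifferential (fun s x => f s x (w s)) y (t j) S (needleVector f w y (ω j) (t j))) ''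
      (nonnegCone N : Set (Fin N → ℝ))) (L '' (Γ : Set (EuclideanSpace ℝ (Fin m))))) :
    y S ∈ closure (reachableSet f y₀ S V ∩ T) := by
  have hS : 0 ≤ S := (ht0 ⟨0, hN⟩).le.trans (htS _)
  set v : Fin N → EuclideanSpace ℝ (Fin n) := fun j =>
    coordFlowDifferential (fun s x => f s x (w s)) y (t j) S (needleVector f w y (ω j) (t j))
  set φ := extChartAt (𝓡 n) (y S)
  obtain ⟨τ, τ', hτ, hτ', hτ0, hτ0', hτC, hτC', hτL⟩ := exists_continuous_decomposition _ _ _ _ hcompl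
  -- Near `0` the nonnegative orthant coincides with the simplex, so continuity of the sections at
  -- `0` gives such a radius, independent of the needle length.
  obtain ⟨κ, hκ, hκτ⟩ : ∃ κ > 0, ∀ x, ‖x‖ ≤ κ → τ x ∈ simplexHull N ∧ ‖τ' x‖ ≤ 1 := by
    have h1 : ∀ᶠ x in 𝓝 (0 : EuclideanSpace ℝ (Fin n)), τ x ∈ simplexHull N := by
      have h2 : Tendsto τ (𝓝 0) (𝓝[(nonnegCone N : Set (Fin N → ℝ))] 0) :=
        tendsto_nhdsWithin_iff.2 ⟨by simpa [hτ0] using hτ.tendsto 0, Eventually.of_forall hτC⟩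
      exact h2 (simplexHull_mem_nhdsWithin N)
    have h2 : ∀ᶠ x in 𝓝 (0 : EuclideanSpace ℝ (Fin n)), ‖τ' x‖ < 1 :=
      hτ'.norm.continuousAt.eventually (gt_mem_nhds (by simp [hτ0']))
    obtain ⟨r, hr, h3⟩ := Metric.nhds_basis_closedBall.mem_iff.1 (h1.and h2)
    exact ⟨r, hr, fun x hx => ⟨(h3 (by simpa using hx)).1, (h3 (by simpa using hx)).2.le⟩⟩
  rw [mem_closure_iff_nhds]
  intro O' hO'
  -- Inside the chart domain, where equality of coordinates gives equality of points.
  set O := interior O' ∩ φ.source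
  have hO : IsOpen O := isOpen_interior.inter (isOpen_extChartAt_source _)
  have hpO : y S ∈ O := ⟨mem_interior_iff_mem_nhds.2 hO', mem_extChartAt_source _⟩
  have : LocallyCompactSpace M := ChartedSpace.locallyCompactSpace (EuclideanSpace ℝ (Fin n)) M
  obtain ⟨K, hK, hpK, hKO⟩ := exists_compact_subset hO hpO
  obtain ⟨-, ρ, -, hρ0, hρ, hQ⟩ := hF
  have ev1 := hf.eventually_needles hw.1 hy.1 hS ht ht0 htS hSDw hSDω
    (mem_interior_iff_mem_nhds.1 hpK) (by positivity : 0 < κ / 32)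
  have ev2 : ∀ᶠ e in 𝓝[>] (0 : ℝ), (ρ e.toNNReal : ℝ) < κ / 32 := by
    have h1 : Tendsto (fun e : ℝ => (ρ e.toNNReal : ℝ)) (𝓝 0) (𝓝 0) := by
      have h2 : Tendsto Real.toNNReal (𝓝 0) (𝓝 0) := by
        simpa using continuous_real_toNNReal.tendsto 0
      exact (NNReal.tendsto_coe.2 (hρ.comp h2))
    exact nhdsWithin_le_nhds (h1.eventually (gt_mem_nhds (by positivity)))
  have ev3 : ∀ᶠ e in 𝓝[>] (0 : ℝ), Metric.closedBall (0 : EuclideanSpace ℝ (Fin m)) e ⊆ U := by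
    obtain ⟨r, hr, hrU⟩ := Metric.nhds_basis_closedBall.mem_iff.1 hU
    filter_upwards [Ioo_mem_nhdsGT hr] with e he
    exact (Metric.closedBall_subset_closedBall he.2.le).trans hrU
  -- The same `e` is the needle length and the radius in the QDQ, so that both expansions have the
  -- same scale.
  obtain ⟨e, ⟨⟨he1, he2⟩, he3⟩, he0⟩ := (((ev1.and ev2).and ev3).and self_mem_nhdsWithin).exists
  obtain ⟨L', h, hL', hh, hLh⟩ := hQ e.toNNReal (Real.toNNReal_pos.2 he0)
  simp only [sub_zero, Real.coe_toNNReal e he0.le] at hL' hh hLh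
  have hφO : ContinuousOn φ O := (continuousOn_extChartAt (y S)).mono inter_subset_right
  -- The precision `δ` of abundance is chosen after `e`. Compactness of `K` makes it uniform over
  -- the end points of all convexified trajectories.
  obtain ⟨δ, hδ, hδK⟩ := exists_edist_lt_imp hK hO hKO hφO (by positivity : 0 < κ / 32 * e)
  obtain ⟨θ, hθV, hθc, hθ⟩ := hV N hN w (needleControl w ω t e) hw
    (fun i => needleControl_mem_extendedControls hw ω t e i) δ hδ
  have : Nonempty (ℝ → M) := ⟨y⟩
  choose! Y z hY hY0 hz hYz using hθ
  have hSI : S ∈ Icc 0 S := right_mem_Icc.2 hS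
  have hzO : ∀ γ ∈ simplexHull N, z γ S ∈ O ∧ dist (φ (Y γ S)) (φ (z γ S)) < κ / 32 * e :=
    fun γ hγ => hδK _ (he1 γ hγ _ (hY γ hγ) ((hY0 γ hγ).trans hy.2.symm)).1 _ (hYz γ hγ)
  have hzc : ContinuousOn (fun γ => z γ S) (simplexHull N) := fun γ₀ hγ₀ => by
    refine tendsto_iff_edist_tendsto_0.2 (tendsto_of_tendsto_of_tendsto_of_le_of_le'
      tendsto_const_nhds (hθc γ₀ hγ₀) (Eventually.of_forall fun _ => zero_le) ?_)
    filter_upwards [self_mem_nhdsWithin] with γ hγ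
    exact edist_le_controlDist (hz γ hγ) (hz γ₀ hγ₀) hSI
  have hZ : ContinuousOn (fun γ => φ (z γ S) - φ (y S)) (simplexHull N) :=
    (hφO.comp hzc fun γ hγ => (hzO γ hγ).1).sub continuousOn_const
  -- Abundance and the needle expansion contribute `κ / 32 * e` each.
  have hZA : ∀ γ ∈ simplexHull N, ‖(φ (z γ S) - φ (y S)) - e • combination v γ‖ ≤ κ / 16 * e := by
    intro γ hγ
    have h1 := (he1 γ hγ _ (hY γ hγ) ((hY0 γ hγ).trans hy.2.symm)).2
    have h2 := (hzO γ hγ).2.le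
    rw [dist_comm, dist_eq_norm] at h2
    have h3 : (φ (z γ S) - φ (y S)) - e • combination v γ = (φ (z γ S) - φ (Y γ S)) +
      (φ (Y γ S) - φ (y S) - e • combination v γ) := by abel
    rw [h3]
    exact (norm_add_le _ _).trans (by linarith)
  have hH : ContinuousOn (fun ζ => L' ζ ζ + h ζ) {ζ | ‖ζ‖ ≤ e ∧ ζ ∈ (Γ : Set _) ∩ U} :=
    (hL'.clm_apply continuousOn_id).add hh
  have hHA : ∀ ζ ∈ {ζ | ‖ζ‖ ≤ e ∧ ζ ∈ (Γ : Set (EuclideanSpace ℝ (Fin m))) ∩ U},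
      ‖(L' ζ ζ + h ζ) - L ζ‖ ≤ κ / 16 * e := by
    intro ζ hζ
    obtain ⟨⟨L₁, hL₁, h1⟩, h2, -⟩ := hLh ζ hζ.1 hζ.2
    rw [mem_singleton_iff.1 hL₁] at h1
    have h3 : (L' ζ ζ + h ζ) - L ζ = (L' ζ - L) ζ + h ζ := by
      rw [sub_apply]; abel
    rw [h3]
    refine (norm_add_le _ _).trans ?_
    -- The variation of `L'` and the term `h` contribute at most `ρ(e) e` each, and `ρ(e) < κ / 32`.
    have h4 := (L' ζ - L).le_of_opNorm_le h1 ζ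
    have h5 : (ρ e.toNNReal : ℝ) * ‖ζ‖ ≤ ρ e.toNNReal * e :=
      mul_le_mul_of_nonneg_left hζ.1 (NNReal.coe_nonneg _)
    nlinarith
  obtain ⟨γ, hγ, ζ, hζ, heq⟩ := exists_eq_of_norm_sub_le (combination v) L hτ hτ' hτL hκ he0
    (fun x hx => (hκτ x hx).1) (fun x hx => by
      have h1 : ‖e • τ' x‖ ≤ e := by
        rw [norm_smul, Real.norm_of_nonneg he0.le]
        exact mul_le_of_le_one_right he0.le (hκτ x hx).2
      exact ⟨h1, Γ.smul_mem he0.le (hτC' x), he3 (by simpa using h1)⟩) hZ hH hZA hHA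
  obtain ⟨q, ⟨hqF, hqs⟩, hq⟩ := (hLh ζ hζ.1 hζ.2).2.2
  -- The point of the target and the reachable point have the same coordinates, and both lie in the
  -- chart domain.
  have hqz : q = z γ S := by
    refine φ.injOn hqs (hzO γ hγ).1.2 (hq.trans ?_)
    rw [add_assoc, ← heq, add_sub_cancel]
  refine ⟨z γ S, interior_subset (hzO γ hγ).1.1, ⟨θ γ, hθV γ hγ, z γ, hz γ hγ, rfl⟩, ?_⟩
  rw [← hqz]
  exact hFT ζ hζ.2.1 hqF

end Main

end

theorem mainTheorem7 {n : ℕ} {M : Type*} [EMetricSpace M]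
    [ChartedSpace (EuclideanSpace ℝ (Fin n)) M] [IsManifold (𝓡 n) 2 M]
    [RiemannianBundle (fun x : M => TangentSpace (𝓡 n) x)]
    [IsContMDiffRiemannianBundle (𝓡 n) 1 (EuclideanSpace ℝ (Fin n))
      (fun x : M => TangentSpace (𝓡 n) x)]
    [IsRiemannianManifold (𝓡 n) M]
    {W : Type*} [MetricSpace W]
    (S : ℝ) (f : ℝ → (x : M) → W → TangentSpace (𝓡 n) x) (hf : HypothesisSH f S)
    (y₀ : M) (V : Set (ℝ → W)) (hVW : V ⊆ extendedControls W S)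
    (T : Set M) (hT : IsClosed T)
    (hV : IsAbundant f y₀ S V)
    (w : ℝ → W) (hw : w ∈ extendedControls W S)
    (y : ℝ → M) (hy : IsTrajectory f y₀ S w y) (hyT : y S ∈ T)
    (N : ℕ) (hN : 0 < N) (ω : Fin N → W) (t : Fin N → ℝ)
    (ht : StrictMono t) (ht0 : ∀ i, 0 < t i) (htS : ∀ i, t i ≤ S)
    (hSDw : ∀ i, IsScorzaDragoniPoint (fun s x => f s x (w s)) 0 S (t i))
    (hSDω : ∀ i j, IsScorzaDragoniPoint (fun s x => f s x (ω j)) 0 S (t i))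
    (C : Set (TangentSpace (𝓡 n) (y S))) (hC : IsQDQApproxCone T (y S) C)
    (hcompl : AreComplementarySubspaces
      (extendedVariationalCone f S w y ω t : Set (TangentSpace (𝓡 n) (y S))) C) :
    ∃ z : ℕ → M, (∀ k, z k ∈ reachableSet f y₀ S V ∩ T) ∧
      Tendsto z atTop (𝓝 (y S)) := by
  have : IsManifold (𝓡 n) 1 M := IsManifold.of_le (n := 2) (by norm_num)
  obtain ⟨m, F, Γ, L, ⟨U, hU, hF⟩, hFT, rfl⟩ := hC
  obtain ⟨L₁, hL₁⟩ : ∃ L₁ : EuclideanSpace ℝ (Fin m) →L[ℝ] EuclideanSpace ℝ (Fin n), L₁ = L :=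
    ⟨L, rfl⟩
  -- The chart at `y S` has identity derivative at its own base point, so `L` is its own coordinate
  -- representation.
  have hLL : (fun L : EuclideanSpace ℝ (Fin m) →L[ℝ] TangentSpace (𝓡 n) (y S) =>
      (mfderiv (𝓡 n) 𝓘(ℝ, EuclideanSpace ℝ (Fin n)) (extChartAt (𝓡 n) (y S)) (y S)).comp L) '' {L}
      = {L₁} := by
    rw [image_singleton, hL₁]
    refine congrArg _ (ContinuousLinearMap.ext fun x => ?_)
    exact mfderiv_extChartAt_apply_self _
  have hF' : IsQDQ (fun γ => extChartAt (𝓡 n) (y S) '' (F γ ∩ (extChartAt (𝓡 n) (y S)).source))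
      {L₁} 0 (extChartAt (𝓡 n) (y S) (y S)) (Γ ∩ U) :=
    Eq.mp (congrArg (fun Λ => IsQDQ _ Λ 0 _ _) hLL) hF
  -- The generated convex cone is the image of the nonnegative orthant, the form in which the needle
  -- expansion produces it.
  have hcone : (extendedVariationalCone f S w y ω t : Set (TangentSpace (𝓡 n) (y S))) =
      combination (fun j => coordFlowDifferential (fun s x => f s x (w s)) y (t j) S
        (needleVector f w y (ω j) (t j))) '' (nonnegCone N : Set (Fin N → ℝ)) := by
    rw [combination_image_nonnegCone]
    simp only [needleVector, coordField_self]
    rfl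
  have hcompl' : AreComplementarySubspaces (combination (fun j =>
      coordFlowDifferential (fun s x => f s x (w s)) y (t j) S (needleVector f w y (ω j) (t j))) ''
      (nonnegCone N : Set (Fin N → ℝ))) (L₁ '' (Γ : Set (EuclideanSpace ℝ (Fin m)))) := by
    rw [← hcone, hL₁]
    exact hcompl
  obtain ⟨z, hz, hlim⟩ := mem_closure_iff_seq_limit.1 (hf.mem_closure_reachableSet_inter hV hw hy hN
    ht ht0 htS hSDw hSDω hU L₁ hF' hFT hcompl')
  exact ⟨z, hz, hlim⟩
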